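/- **Setting.** Let $L$ have unary predicates $F,O_0,O_1,O$, binary relations $E,R_0,R_1$ and a binary function $\mathrm{eval}$, and let $T$ be the universal theory saying: (1) $F,O_0,O_1$ partition the universe and $O=O_0\cup O_1$; (2) $E\subseteq O^2$ is an equivalence relation on $O$; (3) $\mathrm{eval}:F\times O\to O_0$ satisfies $E(y,\mathrm{eval}(x,y))$ and $E(y,z)\to\mathrm{eval}(x,y)=\mathrm{eval}(x,z)$ for $x\in F$, $y,z\in O$ (with the convention $\mathrm{eval}(x,y)=x$ for $(x,y)\notin F\times O$); (4) $R_0\subseteq O_0\times O_1$, $R_1\subseteq F\times O_1$, and $R_0(\mathrm{eval}(x,z),z)\leftrightarrow R_1(x,z)$ for $x\in F$, $z\in O_1$. Let $\mathbb K$ be the class of finite models of $T$ (including the empty one), and let $T^*$ be the theory of the Fraïssé limit of $\mathbb K$. As usual, $\mathbb M$ denotes a monster model of the theory under consideration; models are small elementary submodels of $\mathbb M$. For subsets $A,B,C$ of a monster model of $T^*$, write $A\perp^*_C B$ if $\mathrm{dcl}(AC)\cap\mathrm{dcl}(BC)\subseteq\mathrm{dcl}(C)$ and $\mathrm{dcl}(AC)/E\cap\mathrm{dcl}(BC)/E\subseteq\mathrm{dcl}(C)/E$,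 where $X/E$ is the set of $E$-classes represented by an element of $X\cap O$. A formula $\varphi(x;y)$ has SOP$_1$ modulo a complete theory if, in a model of it, there are tuples $(a_\eta)_{\eta\in 2^{<\omega}}$ such that $\{\varphi(x;a_{\eta|k}):k<\omega\}$ is consistent for every $\eta\in2^\omega$, and $\{\varphi(x;a_\eta),\varphi(x;a_{\rho\frown 1})\}$ is inconsistent whenever $\rho\frown 0\trianglelefteq\eta$. The theory is NSOP$_1$ if no formula has SOP$_1$ modulo it. For a set $A$ and an infinite cardinal $\lambda$, $\varphi(x;a)$ $\lambda$-shreds over $A$, witnessed by $\langle b_\alpha:\alpha<\lambda\rangle$, if this sequence of finite tuples is $A$-indiscernible and for no $\alpha<\lambda$ and no $c\models\varphi(x;a)$ is $\langle b_\beta:\alpha\le\beta<\lambda\rangle$ indiscernible over $Ac$. For a complete theory $S$ in a language $L_S$, put $|S|=|L_S|+\aleph_0$. For $m<\omega$, $\kappa^m_{\mathrm{shred}}(S)$ is the least regular cardinal $\kappa$ for which there are no increasing continuous sequence of models $\langle M_i:i\le\kappa\rangle$ of $S$ and $p\in S^m(M_\kappa)$ such that for every $i<\kappa$ the type $p\restriction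 M_{i+1}$ implies a formula that $(|S|+|M_i|)^+$-shreds over $M_i$, witnessed by a sequence contained in $M_{i+1}$; it is $\infty$ if there is no such $\kappa$. Let $\kappa_{\mathrm{shred}}(S)=\sup_m\kappa^m_{\mathrm{shred}}(S)$; $S$ is unshreddable if $\kappa_{\mathrm{shred}}(S)<\infty$. **Theorem.** 1. $\mathbb K$ is a Fraïssé class and has a Fraïssé limit, and $T^*$, the complete theory of that limit, is $\aleph_0$-categorical. 2. (Independence theorem over models.) Let $M\models T^*$ be a model, $a,a'$ small tuples and $B,C$ small sets such that $a\equiv_M a'$, $a\perp^*_M B$, $a'\perp^*_M C$ and $B\perp^*_M C$. Then there is $a''$ with $a''\equiv_{MB}a$, $a''\equiv_{MC}a'$ and $a''\perp^*_M BC$. 3. $T^*$ is NSOP$_1$. 4. $\kappa_{\mathrm{shred}}(T^*)=\infty$. Hence NSOP$_1$ does not imply unshreddability. -/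

import Mathlib

open FirstOrder CategoryTheory
open FirstOrder.Language
open scoped Cardinal

namespace Shredding

/-! ### Model-theoretic notions

"In the monster model" is expressed through elementary extensions: a tuple of the monster model
over a small model `N` is a tuple of some elementary extension of `N`. -/

section General

variable {L : FirstOrder.Language.{0, 0}}

/-- `⟨b i : i ∈ S⟩`, a sequence of `n`-tuples of `N`, is indiscernible over the set `A`: any two
increasing `k`-tuples of terms of the sequence satisfy the same formulas with parameters in `A`. -/
def IndiscernibleOn {N : Type} [L.Structure N] {I : Type*} [LinearOrder I] {n : ℕ}
    (A : Set N) (S : Set I) (b : I → Fin n → N) : Prop :=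
  ∀ (k r : ℕ) (ψ : L.Formula ((Fin k × Fin n) ⊕ Fin r)) (d : Fin r → N), (∀ i, d i ∈ A) →
    ∀ f g : Fin k → I, StrictMono f → StrictMono g → (∀ i, f i ∈ S) → (∀ i, g i ∈ S) →
      (ψ.Realize (Sum.elim (fun x => b (f x.1) x.2) d) ↔
        ψ.Realize (Sum.elim (fun x => b (g x.1) x.2) d))

/-- The sequence `⟨b α : α < lam⟩` witnesses that `φ(x; a)` `lam`-shreds over `A`: it is
indiscernible over `A`, and for no `α < lam` and no realization `c` of `φ(x; a)` (in any elementary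
extension) is the end segment `⟨b β : α ≤ β < lam⟩` indiscernible over `A ∪ c`. -/
def WitnessesShredding {N : Type} [L.Structure N] {m r n : ℕ} (lam : Cardinal.{0})
    (φ : L.Formula (Fin m ⊕ Fin r)) (a : Fin r → N) (A : Set N)
    (b : Ordinal.{0} → Fin n → N) : Prop :=
  IndiscernibleOn (L := L) A (Set.Iio lam.ord) b ∧
    ∀ (N' : Type) [L.Structure N'] (e : N ↪ₑ[L] N') (c : Fin m → N'),
      φ.Realize (Sum.elim c (e ∘ a)) →
        ∀ α < lam.ord, ¬ IndiscernibleOn (L := L) (e '' A ∪ Set.range c) (Set.Ico α lam.ord)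
          (fun β => e ∘ b β)

/-- The set `S^m(N)` of complete `m`-types over (the universe of) a structure `N`. -/
abbrev TypeOver (L : FirstOrder.Language.{0, 0}) (N : Type) [L.Structure N] (m : ℕ) : Type :=
  (L.elementaryDiagram N).CompleteType (Fin m)

/-- The formula `φ(x; a)` belongs to the complete type `p` over `N`. -/
def TypeOver.Contains {N : Type} [L.Structure N] {m r : ℕ} (p : TypeOver L N m)
    (φ : L.Formula (Fin m ⊕ Fin r)) (a : Fin r → N) : Prop :=
  Formula.equivSentence ((BoundedFormula.constantsVarsEquiv (L := L) (γ := N)).symm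
    (Formula.relabel (Sum.elim Sum.inr fun i => Sum.inl (a i)) φ)) ∈ p

/-- For `p ∈ S^m(N)` and `A ⊆ B ⊆ N`: the restriction `p ↾ B` shreds over `A` with a built-in
witness, i.e. `p ↾ B` contains a formula `φ(x; a)` that `lam`-shreds over `A` for
`lam = (|L| + ℵ₀ + |A|)⁺`, as witnessed by a sequence of tuples contained in `B`. -/
def RestrictionShredsBuiltIn {N : Type} [L.Structure N] {m : ℕ} (p : TypeOver L N m)
    (B A : Set N) : Prop :=
  A ⊆ B ∧ ∃ (r : ℕ) (φ : L.Formula (Fin m ⊕ Fin r)) (a : Fin r → N),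
    (∀ i, a i ∈ B) ∧ p.Contains φ a ∧
      ∃ (n : ℕ) (b : Ordinal.{0} → Fin n → N),
        (∀ α < (Order.succ (L.card + ℵ₀ + #A)).ord, ∀ j, b α j ∈ B) ∧
          WitnessesShredding (Order.succ (L.card + ℵ₀ + #A)) φ a A b

/-- There are an increasing continuous sequence `⟨M i : i ≤ κ⟩` of models of `T` (each elementary
in the last one, `N = M κ`) and `p ∈ S^m(M κ)` such that, for all `i < κ`, the restriction
`p ↾ M (i + 1)` shreds over `M i` with a built-in witness. -/
def HasShreddingChain (T : L.Theory) (m : ℕ) (κ : Cardinal.{0}) : Prop :=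
  ∃ (N : Theory.ModelType.{0, 0, 0} T) (M : Ordinal.{0} → L.ElementarySubstructure N)
    (p : TypeOver L N m),
    (M κ.ord : Set N) = Set.univ ∧
    (∀ i j, i ≤ j → j ≤ κ.ord → (M i : Set N) ⊆ M j) ∧
    (∀ δ ≤ κ.ord, Order.IsSuccLimit δ → (M δ : Set N) = ⋃ i ∈ Set.Iio δ, (M i : Set N)) ∧
    ∀ i < κ.ord, RestrictionShredsBuiltIn p (M (i + 1) : Set N) (M i : Set N)

/-- `κ^m_shred(T)`: the least regular cardinal `κ` with no shredding chain of length `κ` in `m`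
variables, and `⊤` (that is, `∞`) if there is no such `κ`. -/
noncomputable def kappaShredAt (T : L.Theory) (m : ℕ) : WithTop Cardinal.{0} :=
  sInf {c | ∃ κ : Cardinal.{0}, κ.IsRegular ∧ ¬ HasShreddingChain T m κ ∧ c = (κ : WithTop Cardinal)}

/-- `κ_shred(T) = sup_m κ^m_shred(T)`. -/
noncomputable def kappaShred (T : L.Theory) : WithTop Cardinal.{0} :=
  ⨆ m : ℕ, kappaShredAt T m

/-- `T` is unshreddable. -/
def Unshreddable (T : L.Theory) : Prop :=
  kappaShred T < ⊤

/-- The formula `φ(x; y)` has `SOP₁` modulo `T`, as witnessed by a tree `(a η)` indexed by finite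
binary sequences, in a model of `T`. A set of instances is consistent if every finite subset is
realized in the model. -/
def FormulaSOP1 (T : L.Theory) {m n : ℕ} (φ : L.Formula (Fin m ⊕ Fin n)) : Prop :=
  ∃ (N : Theory.ModelType.{0, 0, 0} T) (a : List Bool → Fin n → N),
    (∀ η : ℕ → Bool, ∀ s : Finset ℕ, ∃ c : Fin m → N, ∀ k ∈ s,
      φ.Realize (Sum.elim c (a (List.ofFn fun i : Fin k => η i)))) ∧
    ∀ ρ η : List Bool, (ρ ++ [false]) <+: η →
      ¬ ∃ c : Fin m → N, φ.Realize (Sum.elim c (a η)) ∧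
        φ.Realize (Sum.elim c (a (ρ ++ [true])))

/-- `T` is `NSOP₁`: no formula has `SOP₁` modulo `T`. -/
def NSOP1 (T : L.Theory) : Prop :=
  ∀ (m n : ℕ) (φ : L.Formula (Fin m ⊕ Fin n)), ¬ FormulaSOP1 T φ

/-- `a ≡_A a'`: the tuples `a` and `a'` have the same type over `A`. -/
def SameTypeOver (L : FirstOrder.Language.{0, 0}) {N : Type} [L.Structure N] {α : Type} (A : Set N)
    (a a' : α → N) : Prop :=
  ∀ (r : ℕ) (φ : L.Formula (α ⊕ Fin r)) (d : Fin r → N), (∀ i, d i ∈ A) →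
    (φ.Realize (Sum.elim a d) ↔ φ.Realize (Sum.elim a' d))

/-- The definable closure of `A`: the elements `x` such that `{x}` is definable over `A`. -/
def dcl (L : FirstOrder.Language.{0, 0}) {N : Type} [L.Structure N] (A : Set N) : Set N :=
  {x | A.Definable₁ L {x}}

end General

/-! ### The theory of selector functions -/

/-- The function symbols: a binary `eval`. -/
inductive SelFunctions : ℕ → Type
  | eval : SelFunctions 2

/-- The relation symbols: unary `F`, `O₀`, `O₁`, `O` and binary `E`, `R₀`, `R₁`. -/
inductive SelRelations : ℕ → Type
  | F : SelRelations 1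
  | O0 : SelRelations 1
  | O1 : SelRelations 1
  | O : SelRelations 1
  | E : SelRelations 2
  | R0 : SelRelations 2
  | R1 : SelRelations 2

/-- The language of the selector-function theory. -/
def selLang : FirstOrder.Language.{0, 0} := ⟨SelFunctions, SelRelations⟩

instance : Countable (Σ l, selLang.Functions l) := by
  refine Function.Injective.countable (f := fun _ : (Σ l, selLang.Functions l) => (0 : ℕ)) ?_
  rintro ⟨_, ⟨⟩⟩ ⟨_, ⟨⟩⟩ _
  rfl

section Syntax1

variable {n : ℕ}

/-- The atomic formula `F(t)`. -/
def fF (t : selLang.Term (Empty ⊕ Fin n)) : selLang.BoundedFormula Empty n :=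
  Relations.boundedFormula₁ (L := selLang) SelRelations.F t

/-- The atomic formula `O₀(t)`. -/
def fO0 (t : selLang.Term (Empty ⊕ Fin n)) : selLang.BoundedFormula Empty n :=
  Relations.boundedFormula₁ (L := selLang) SelRelations.O0 t

/-- The atomic formula `O₁(t)`. -/
def fO1 (t : selLang.Term (Empty ⊕ Fin n)) : selLang.BoundedFormula Empty n :=
  Relations.boundedFormula₁ (L := selLang) SelRelations.O1 t

/-- The atomic formula `O(t)`. -/
def fO (t : selLang.Term (Empty ⊕ Fin n)) : selLang.BoundedFormula Empty n :=
  Relations.boundedFormula₁ (L := selLang) SelRelations.O t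

/-- The atomic formula `E(t, u)`. -/
def fE (t u : selLang.Term (Empty ⊕ Fin n)) : selLang.BoundedFormula Empty n :=
  Relations.boundedFormula₂ (L := selLang) SelRelations.E t u

/-- The atomic formula `R₀(t, u)`. -/
def fR0 (t u : selLang.Term (Empty ⊕ Fin n)) : selLang.BoundedFormula Empty n :=
  Relations.boundedFormula₂ (L := selLang) SelRelations.R0 t u

/-- The atomic formula `R₁(t, u)`. -/
def fR1 (t u : selLang.Term (Empty ⊕ Fin n)) : selLang.BoundedFormula Empty n :=
  Relations.boundedFormula₂ (L := selLang) SelRelations.R1 t u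

/-- The term `eval(t, u)`. -/
def tEval (t u : selLang.Term (Empty ⊕ Fin n)) : selLang.Term (Empty ⊕ Fin n) :=
  Functions.apply₂ (L := selLang) SelFunctions.eval t u

end Syntax1

/-- The universal theory `T`. Since `eval` is a function `F × O → O₀`, while function symbols of a
one-sorted language are total, the last axiom fixes the irrelevant values by `eval(x, y) = x`
for `(x, y) ∉ F × O`. -/
def selTheory : selLang.Theory :=
  { -- `F`, `O₀`, `O₁` partition the universe and `O = O₀ ∪ O₁`
    ∀' (fF &0 ⊔ (fO0 &0 ⊔ fO1 &0)),
    ∀' ∼(fF &0 ⊓ fO0 &0),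
    ∀' ∼(fF &0 ⊓ fO1 &0),
    ∀' ∼(fO0 &0 ⊓ fO1 &0),
    ∀' (fO &0 ⇔ (fO0 &0 ⊔ fO1 &0)),
    -- `E ⊆ O²` is an equivalence relation on `O`
    ∀' ∀' (fE &0 &1 ⟹ (fO &0 ⊓ fO &1)),
    ∀' (fO &0 ⟹ fE &0 &0),
    ∀' ∀' (fE &0 &1 ⟹ fE &1 &0),
    ∀' ∀' ∀' (fE &0 &1 ⟹ (fE &1 &2 ⟹ fE &0 &2)),
    -- `eval : F × O → O₀` is a selector function
    ∀' ∀' ((fF &0 ⊓ fO &1) ⟹ fO0 (tEval &0 &1)),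
    ∀' ∀' ((fF &0 ⊓ fO &1) ⟹ fE &1 (tEval &0 &1)),
    ∀' ∀' ∀' ((fF &0 ⊓ (fO &1 ⊓ fO &2)) ⟹ (fE &1 &2 ⟹ (tEval &0 &1 =' tEval &0 &2))),
    -- `R₀ ⊆ O₀ × O₁`, `R₁ ⊆ F × O₁`, and `R₀(eval(x, z), z) ↔ R₁(x, z)` on `F × O₁`
    ∀' ∀' (fR0 &0 &1 ⟹ (fO0 &0 ⊓ fO1 &1)),
    ∀' ∀' (fR1 &0 &1 ⟹ (fF &0 ⊓ fO1 &1)),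
    ∀' ∀' ((fF &0 ⊓ fO1 &1) ⟹ (fR0 (tEval &0 &1) &1 ⇔ fR1 &0 &1)),
    -- the convention for `eval` outside `F × O`
    ∀' ∀' (∼(fF &0 ⊓ fO &1) ⟹ (tEval &0 &1 =' &0)) }

/-- The class `𝕂` of finite models of `T` (the empty structure is one of them). -/
def selClass : Set (Bundled.{0} selLang.Structure) :=
  {M | Finite M ∧ (M : Type) ⊨ selTheory}

/-- `T*`: the theory of the (countable) Fraïssé limit of `𝕂`, which is unique up to isomorphism. -/
def selTheoryStar : selLang.Theory :=
  {φ | ∀ (M : Type) [selLang.Structure M] [Countable M], IsFraisseLimit selClass M → M ⊨ φ}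

/-- `X/E`: the set of `E`-classes represented by an element of `X`. -/
def classesOf {N : Type} [selLang.Structure N] (X : Set N) : Set (Set N) :=
  {K | ∃ x ∈ X, Structure.RelMap (L := selLang) SelRelations.O ![x] ∧
    K = {y | Structure.RelMap (L := selLang) SelRelations.E ![x, y]}}

/-- The relation `A ⫝*_C B`. -/
def IndStar {N : Type} [selLang.Structure N] (A C B : Set N) : Prop :=
  classesOf (dcl selLang (A ∪ C)) ∩ classesOf (dcl selLang (B ∪ C)) ⊆
      classesOf (dcl selLang C) ∧
    dcl selLang (A ∪ C) ∩ dcl selLang (B ∪ C) ⊆ dcl selLang C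

end Shredding

open Shredding

/-! Everything rests on one free gluing construction. Take models of `T` with some elements and some
`E`-classes identified, form the quotient of the disjoint union, and give each class one new element
of `O₀`: it is the value of `eval` at a function and a class that no common piece contains. The new
elements bear no `R₀` relation and `R₁` is determined by the other symbols, so the axioms survive
(`GlueData.valid_raw`).

A value of `eval` lies in `O₀` and depends only on a class, so terms collapse to depth one and
finitely generated models are finite. Back and forth between models realizing all finite extensions
(`EC`) then eliminates quantifiers (`EC.realize_iff`). Being `EC` is a first-order property, so
these are exactly the models of `T*`, and the countable ones are the Fraïssé limits. Gluing two
copies of a model shows that definable closure is generation by terms (`EC.dcl_eq`); hence `⫝*` says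
that two generated substructures share only the elements and classes of the base. Under three such
conditions three copies of a model can be glued along prescribed overlaps (`coherent_tripleRel`),
and this is the independence theorem.

`NSOP₁` uses the same three-copy amalgam directly. Pigeonhole on the finitely many types over a
finite set extracts from an `SOP₁` tree a path and a sequence of side branches with eventually equal
types. Limits of the two sequences in iterated ultrapowers are tuples `b₀`, `b₁` of the same type,
with `b₁` independent from `b₀` and `b₀` independent from a solution `c` of the path. Amalgamation
gives a common solution at `b₀` and `b₁`, which the tree forbids (`EC.not_sop_array`,
`EC.not_sop_tree`).

For shredding, let a function select `u` in its class. Then `R₀(eval(x, y), y)` becomes `R₀(u, y)`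
on that class, and `u` may be related to every other term of a sequence there, while the sequence is
indiscernible over a model that has no relation with it. One function selecting a point in each of
many classes, one new class per step, gives a type that shreds at every step of a chain of any
infinite length. The chain consists of existentially closed models of controlled size which acquire
no relation with the sequences reserved for later: this is the purpose of `exists_completion`. -/

namespace Shredding

/-! ### The theory `T` semantically -/

section Accessors

variable {N : Type} [selLang.Structure N]

/-- `x ∈ F`. -/
def IsF (x : N) : Prop := Structure.RelMap (L := selLang) SelRelations.F ![x]

/-- `x ∈ O₀`. -/
def IsO0 (x : N) : Prop := Structure.RelMap (L := selLang) SelRelations.O0 ![x]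

/-- `x ∈ O₁`. -/
def IsO1 (x : N) : Prop := Structure.RelMap (L := selLang) SelRelations.O1 ![x]

/-- `x ∈ O`. -/
def IsO (x : N) : Prop := Structure.RelMap (L := selLang) SelRelations.O ![x]

/-- `E(x, y)`. -/
def RelE (x y : N) : Prop := Structure.RelMap (L := selLang) SelRelations.E ![x, y]

/-- `R₀(x, y)`. -/
def Rel0 (x y : N) : Prop := Structure.RelMap (L := selLang) SelRelations.R0 ![x, y]

/-- `R₁(x, y)`. -/
def Rel1 (x y : N) : Prop := Structure.RelMap (L := selLang) SelRelations.R1 ![x, y]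

/-- `eval(x, y)`. -/
def ev (x y : N) : N := Structure.funMap (L := selLang) SelFunctions.eval ![x, y]

end Accessors

/-- The axioms of `T`, spelled out. -/
structure IsSel (N : Type) [selLang.Structure N] : Prop where
  cover : ∀ x : N, IsF x ∨ IsO0 x ∨ IsO1 x
  not_F_O0 : ∀ x : N, IsF x → ¬ IsO0 x
  not_F_O1 : ∀ x : N, IsF x → ¬ IsO1 x
  not_O0_O1 : ∀ x : N, IsO0 x → ¬ IsO1 x
  O_iff : ∀ x : N, IsO x ↔ IsO0 x ∨ IsO1 x
  E_O : ∀ x y : N, RelE x y → IsO x ∧ IsO y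
  E_refl : ∀ x : N, IsO x → RelE x x
  E_symm : ∀ x y : N, RelE x y → RelE y x
  E_trans : ∀ x y z : N, RelE x y → RelE y z → RelE x z
  ev_O0 : ∀ x y : N, IsF x → IsO y → IsO0 (ev x y)
  E_ev : ∀ x y : N, IsF x → IsO y → RelE y (ev x y)
  ev_congr : ∀ x y z : N, IsF x → RelE y z → ev x y = ev x z
  R0_sort : ∀ x y : N, Rel0 x y → IsO0 x ∧ IsO1 y
  R1_sort : ∀ x y : N, Rel1 x y → IsF x ∧ IsO1 y
  R0_iff_R1 : ∀ x y : N, IsF x → IsO1 y → (Rel0 (ev x y) y ↔ Rel1 x y)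
  ev_triv : ∀ x y : N, ¬ (IsF x ∧ IsO y) → ev x y = x

section Realize

variable {N : Type} [selLang.Structure N] {n : ℕ} {v : Empty → N} {xs : Fin n → N}
  (t u : selLang.Term (Empty ⊕ Fin n))

theorem realize_fF : (fF t).Realize v xs ↔ IsF (t.realize (Sum.elim v xs)) :=
  BoundedFormula.realize_rel₁

theorem realize_fO0 : (fO0 t).Realize v xs ↔ IsO0 (t.realize (Sum.elim v xs)) :=
  BoundedFormula.realize_rel₁

theorem realize_fO1 : (fO1 t).Realize v xs ↔ IsO1 (t.realize (Sum.elim v xs)) :=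
  BoundedFormula.realize_rel₁

theorem realize_fO : (fO t).Realize v xs ↔ IsO (t.realize (Sum.elim v xs)) :=
  BoundedFormula.realize_rel₁

theorem realize_fE : (fE t u).Realize v xs ↔
    RelE (t.realize (Sum.elim v xs)) (u.realize (Sum.elim v xs)) :=
  BoundedFormula.realize_rel₂

theorem realize_fR0 : (fR0 t u).Realize v xs ↔
    Rel0 (t.realize (Sum.elim v xs)) (u.realize (Sum.elim v xs)) :=
  BoundedFormula.realize_rel₂

theorem realize_fR1 : (fR1 t u).Realize v xs ↔
    Rel1 (t.realize (Sum.elim v xs)) (u.realize (Sum.elim v xs)) :=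
  BoundedFormula.realize_rel₂

theorem realize_tEval {w : Empty ⊕ Fin n → N} :
    (tEval t u).realize w = ev (t.realize w) (u.realize w) :=
  Term.realize_functions_apply₂

end Realize

theorem models_selTheory_iff (N : Type) [selLang.Structure N] : N ⊨ selTheory ↔ IsSel N := by
  rw [Theory.model_iff]
  simp only [selTheory, Set.mem_insert_iff, Set.mem_singleton_iff, forall_eq_or_imp, forall_eq,
    Sentence.Realize, Formula.Realize, BoundedFormula.realize_all, BoundedFormula.realize_imp,
    BoundedFormula.realize_not, BoundedFormula.realize_iff, BoundedFormula.realize_sup,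
    BoundedFormula.realize_inf, BoundedFormula.realize_bdEqual, realize_fF, realize_fO0,
    realize_fO1, realize_fO, realize_fE, realize_fR0, realize_fR1, realize_tEval,
    Function.comp_apply, Term.realize_var, Sum.elim_inr]
  constructor
  · rintro ⟨h1, h2, h3, h4, h5, h6, h7, h8, h9, h10, h11, h12, h13, h14, h15, h16⟩
    exact ⟨h1, fun x h h' => h2 x ⟨h, h'⟩, fun x h h' => h3 x ⟨h, h'⟩, fun x h h' => h4 x ⟨h, h'⟩,
      h5, h6, h7, h8, h9, fun x y hx hy => h10 x y ⟨hx, hy⟩, fun x y hx hy => h11 x y ⟨hx, hy⟩,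
      fun x y z hx hy => h12 x y z ⟨hx, h6 y z hy⟩ hy, h13, h14,
      fun x y hx hy => h15 x y ⟨hx, hy⟩, h16⟩
  · intro h
    exact ⟨h.cover, fun x h' => h.not_F_O0 x h'.1 h'.2, fun x h' => h.not_F_O1 x h'.1 h'.2,
      fun x h' => h.not_O0_O1 x h'.1 h'.2, h.O_iff, h.E_O, h.E_refl, h.E_symm,
      h.E_trans, fun x y h' => h.ev_O0 x y h'.1 h'.2, fun x y h' => h.E_ev x y h'.1 h'.2,
      fun x y z h1 hy => h.ev_congr x y z h1.1 hy, h.R0_sort,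
      h.R1_sort, fun x y h' => h.R0_iff_R1 x y h'.1 h'.2, h.ev_triv⟩

/-- The sort axiom and the axiom linking `R₀` with `R₁` leave no freedom for `R₁`. For this reason
raw data and partial isomorphisms below do not mention it. -/
theorem IsSel.R1_iff {N : Type} [selLang.Structure N] (h : IsSel N) (x y : N) :
    Rel1 x y ↔ IsF x ∧ IsO1 y ∧ Rel0 (ev x y) y :=
  ⟨fun h' => ⟨(h.R1_sort x y h').1, (h.R1_sort x y h').2,
    (h.R0_iff_R1 x y (h.R1_sort x y h').1 (h.R1_sort x y h').2).2 h'⟩,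
    fun h' => (h.R0_iff_R1 x y h'.1 h'.2.1).1 h'.2.2⟩

/-- The data from which a model of `T` can be recovered. -/
structure SelRaw (X : Type) where
  /-- the sort of functions -/
  F : X → Prop
  /-- the sort `O₀` -/
  O0 : X → Prop
  /-- the sort `O₁` -/
  O1 : X → Prop
  /-- the equivalence relation -/
  E : X → X → Prop
  /-- the relation `R₀` -/
  R0 : X → X → Prop
  /-- the function `eval` -/
  ev : X → X → X

namespace SelRaw

variable {X : Type}

/-- The structure given by raw data. -/
@[reducible] def toStructure (r : SelRaw X) : selLang.Structure X where
  funMap := fun {_} f x => match f with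
    | SelFunctions.eval => r.ev (x 0) (x 1)
  RelMap := fun {_} R x => match R with
    | SelRelations.F => r.F (x 0)
    | SelRelations.O0 => r.O0 (x 0)
    | SelRelations.O1 => r.O1 (x 0)
    | SelRelations.O => r.O0 (x 0) ∨ r.O1 (x 0)
    | SelRelations.E => r.E (x 0) (x 1)
    | SelRelations.R0 => r.R0 (x 0) (x 1)
    | SelRelations.R1 => r.F (x 0) ∧ r.O1 (x 1) ∧ r.R0 (r.ev (x 0) (x 1)) (x 1)

/-- The axioms of `T` for raw data. -/
structure Valid (r : SelRaw X) : Prop where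
  cover : ∀ x, r.F x ∨ r.O0 x ∨ r.O1 x
  not_F_O0 : ∀ x, r.F x → ¬ r.O0 x
  not_F_O1 : ∀ x, r.F x → ¬ r.O1 x
  not_O0_O1 : ∀ x, r.O0 x → ¬ r.O1 x
  E_O : ∀ x y, r.E x y → (r.O0 x ∨ r.O1 x)
  E_refl : ∀ x, (r.O0 x ∨ r.O1 x) → r.E x x
  E_symm : ∀ x y, r.E x y → r.E y x
  E_trans : ∀ x y z, r.E x y → r.E y z → r.E x z
  ev_O0 : ∀ x y, r.F x → (r.O0 y ∨ r.O1 y) → r.O0 (r.ev x y)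
  E_ev : ∀ x y, r.F x → (r.O0 y ∨ r.O1 y) → r.E y (r.ev x y)
  ev_congr : ∀ x y z, r.F x → r.E y z → r.ev x y = r.ev x z
  R0_sort : ∀ x y, r.R0 x y → r.O0 x ∧ r.O1 y
  ev_triv : ∀ x y, ¬ (r.F x ∧ (r.O0 y ∨ r.O1 y)) → r.ev x y = x

theorem Valid.isSel {r : SelRaw X} (h : r.Valid) : @IsSel X r.toStructure :=
  letI := r.toStructure
  { cover := h.cover
    not_F_O0 := h.not_F_O0
    not_F_O1 := h.not_F_O1
    not_O0_O1 := h.not_O0_O1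
    O_iff := fun _ => Iff.rfl
    E_O := fun x y h' => ⟨h.E_O x y h', h.E_O y x (h.E_symm x y h')⟩
    E_refl := h.E_refl
    E_symm := h.E_symm
    E_trans := h.E_trans
    ev_O0 := h.ev_O0
    E_ev := h.E_ev
    ev_congr := h.ev_congr
    R0_sort := h.R0_sort
    R1_sort := fun _ _ h' => ⟨h'.1, h'.2.1⟩
    R0_iff_R1 := fun _ _ hx hy => ⟨fun h' => ⟨hx, hy, h'⟩, fun h' => h'.2.2⟩
    ev_triv := h.ev_triv }

/-- The raw data of a structure. -/
def ofStructure (X : Type) [selLang.Structure X] : SelRaw X :=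
  ⟨IsF, IsO0, IsO1, RelE, Rel0, Shredding.ev⟩

theorem ofStructure_valid [selLang.Structure X] (h : IsSel X) : (ofStructure X).Valid where
  cover := h.cover
  not_F_O0 := h.not_F_O0
  not_F_O1 := h.not_F_O1
  not_O0_O1 := h.not_O0_O1
  E_O := fun x y h' => (h.O_iff x).1 (h.E_O x y h').1
  E_refl := fun x h' => h.E_refl x ((h.O_iff x).2 h')
  E_symm := h.E_symm
  E_trans := h.E_trans
  ev_O0 := fun x y hx hy => h.ev_O0 x y hx ((h.O_iff y).2 hy)
  E_ev := fun x y hx hy => h.E_ev x y hx ((h.O_iff y).2 hy)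
  ev_congr := h.ev_congr
  R0_sort := h.R0_sort
  ev_triv := fun x y h' => h.ev_triv x y (by rwa [h.O_iff])

end SelRaw

/-! ### Partial isomorphisms and embeddings -/

/-- A partial isomorphism, as a relation closed under `eval`. -/
structure PIso {N N' : Type} [selLang.Structure N] [selLang.Structure N'] (I : N → N' → Prop) :
    Prop where
  F : ∀ {x y}, I x y → (IsF x ↔ IsF y)
  O0 : ∀ {x y}, I x y → (IsO0 x ↔ IsO0 y)
  O1 : ∀ {x y}, I x y → (IsO1 x ↔ IsO1 y)
  eq : ∀ {x y x' y'}, I x y → I x' y' → (x = x' ↔ y = y')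
  E : ∀ {x y x' y'}, I x y → I x' y' → (RelE x x' ↔ RelE y y')
  R0 : ∀ {x y x' y'}, I x y → I x' y' → (Rel0 x x' ↔ Rel0 y y')
  ev : ∀ {x y x' y'}, I x y → I x' y' → I (ev x x') (ev y y')

theorem comp_vec_one {N N' : Type} (f : N → N') (x : N) : f ∘ ![x] = ![f x] := by
  funext i; fin_cases i; rfl

theorem comp_vec_two {N N' : Type} (f : N → N') (x y : N) : f ∘ ![x, y] = ![f x, f y] := by
  funext i; fin_cases i <;> rfl

section Embeddings

variable {N N' A : Type} [selLang.Structure N] [selLang.Structure N'] [selLang.Structure A]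

section

variable (f : N ↪[selLang] N')

theorem emb_F (x : N) : IsF (f x) ↔ IsF x := by
  unfold IsF; rw [← comp_vec_one f x]; exact f.map_rel _ _

theorem emb_O0 (x : N) : IsO0 (f x) ↔ IsO0 x := by
  unfold IsO0; rw [← comp_vec_one f x]; exact f.map_rel _ _

theorem emb_O1 (x : N) : IsO1 (f x) ↔ IsO1 x := by
  unfold IsO1; rw [← comp_vec_one f x]; exact f.map_rel _ _

theorem emb_O (x : N) : IsO (f x) ↔ IsO x := by
  unfold IsO; rw [← comp_vec_one f x]; exact f.map_rel _ _

theorem emb_E (x y : N) : RelE (f x) (f y) ↔ RelE x y := by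
  unfold RelE; rw [← comp_vec_two f x]; exact f.map_rel _ _

theorem emb_R0 (x y : N) : Rel0 (f x) (f y) ↔ Rel0 x y := by
  unfold Rel0; rw [← comp_vec_two f x]; exact f.map_rel _ _

theorem emb_R1 (x y : N) : Rel1 (f x) (f y) ↔ Rel1 x y := by
  unfold Rel1; rw [← comp_vec_two f x]; exact f.map_rel _ _

theorem emb_ev (x y : N) : f (ev x y) = ev (f x) (f y) := by
  unfold ev; rw [← comp_vec_two f x]; exact f.map_fun _ _

theorem IsSel.of_embedding (f : N ↪[selLang] N') (h : IsSel N') : IsSel N where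
  cover x := by simpa only [emb_F, emb_O0, emb_O1] using h.cover (f x)
  not_F_O0 x := by simpa only [emb_F, emb_O0, emb_O1] using h.not_F_O0 (f x)
  not_F_O1 x := by simpa only [emb_F, emb_O0, emb_O1] using h.not_F_O1 (f x)
  not_O0_O1 x := by simpa only [emb_F, emb_O0, emb_O1] using h.not_O0_O1 (f x)
  O_iff x := by simpa only [emb_O, emb_O0, emb_O1] using h.O_iff (f x)
  E_O x y := by simpa only [emb_O, emb_E] using h.E_O (f x) (f y)
  E_refl x := by simpa only [emb_O, emb_E] using h.E_refl (f x)
  E_symm x y := by simpa only [emb_E] using h.E_symm (f x) (f y)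
  E_trans x y z := by simpa only [emb_E] using h.E_trans (f x) (f y) (f z)
  ev_O0 x y := by simpa only [← emb_ev, emb_F, emb_O, emb_O0] using h.ev_O0 (f x) (f y)
  E_ev x y := by simpa only [← emb_ev, emb_F, emb_O, emb_E] using h.E_ev (f x) (f y)
  ev_congr x y z := by
    simpa only [← emb_ev, emb_F, emb_E, f.injective.eq_iff] using h.ev_congr (f x) (f y) (f z)
  R0_sort x y := by simpa only [emb_R0, emb_O0, emb_O1] using h.R0_sort (f x) (f y)
  R1_sort x y := by simpa only [emb_R1, emb_F, emb_O1] using h.R1_sort (f x) (f y)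
  R0_iff_R1 x y := by
    simpa only [← emb_ev, emb_R0, emb_R1, emb_F, emb_O1] using h.R0_iff_R1 (f x) (f y)
  ev_triv x y := by
    simpa only [← emb_ev, emb_F, emb_O, f.injective.eq_iff] using h.ev_triv (f x) (f y)

theorem PIso.of_embedding : PIso fun x y => f x = y where
  F := by rintro x _ rfl; rw [emb_F]
  O0 := by rintro x _ rfl; rw [emb_O0]
  O1 := by rintro x _ rfl; rw [emb_O1]
  eq := by rintro x _ x' _ rfl rfl; rw [f.injective.eq_iff]
  E := by rintro x _ x' _ rfl rfl; rw [emb_E]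
  R0 := by rintro x _ x' _ rfl rfl; rw [emb_R0]
  ev := by rintro x _ x' _ rfl rfl; rw [emb_ev]

end

namespace PIso

variable {I : N → N' → Prop} (hI : PIso I)

include hI

theorem symm : PIso fun y x => I x y where
  F h := (hI.F h).symm
  O0 h := (hI.O0 h).symm
  O1 h := (hI.O1 h).symm
  eq h h' := (hI.eq h h').symm
  E h h' := (hI.E h h').symm
  R0 h h' := (hI.R0 h h').symm
  ev h h' := hI.ev h h'

theorem O (hN : IsSel N) (hN' : IsSel N') {x : N} {y : N'} (h : I x y) : IsO x ↔ IsO y := by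
  rw [hN.O_iff, hN'.O_iff, hI.O0 h, hI.O1 h]

end PIso

/-- A total functional partial isomorphism is an embedding. -/
def PIso.toEmbedding (hN : IsSel N) (hN' : IsSel N') (f : N → N') (hf : PIso fun x y => f x = y) :
    N ↪[selLang] N' where
  toFun := f
  inj' x y h := (hf.eq rfl rfl).2 h
  map_fun' := by
    intro n g x
    cases g
    have : x = ![x 0, x 1] := by funext i; fin_cases i <;> rfl
    rw [this, comp_vec_two]
    exact hf.ev rfl rfl
  map_rel' := by
    intro n R x
    cases R
    iterate 4
      have : x = ![x 0] := by funext i; fin_cases i; rfl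
      rw [this, comp_vec_one]
      first
        | exact (hf.F rfl).symm
        | exact (hf.O0 rfl).symm
        | exact (hf.O1 rfl).symm
        | exact (hf.O hN hN' rfl).symm
    all_goals
      have : x = ![x 0, x 1] := by funext i; fin_cases i <;> rfl
      rw [this, comp_vec_two]
    · exact (hf.E rfl rfl).symm
    · exact (hf.R0 rfl rfl).symm
    -- `R₁` is recovered from the sorts, `eval` and `R₀`.
    · refine (hN'.R1_iff _ _).trans (Iff.trans ?_ (hN.R1_iff _ _).symm)
      rw [← hf.F rfl, ← hf.O1 rfl, hf.ev rfl rfl |>.symm, ← hf.R0 rfl rfl]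

/-- A set closed under `eval` is a substructure. -/
def selSub (S : Set N) (h : ∀ x ∈ S, ∀ y ∈ S, ev x y ∈ S) : selLang.Substructure N where
  carrier := S
  fun_mem := by
    intro n g x hx
    cases g
    have : x = ![x 0, x 1] := by funext i; fin_cases i <;> rfl
    rw [this]
    exact h _ (hx 0) _ (hx 1)

theorem ev_mem (S : selLang.Substructure N) {x y : N} (hx : x ∈ S) (hy : y ∈ S) : ev x y ∈ S := by
  refine S.fun_mem _ _ fun i => ?_
  fin_cases i
  · exact hx
  · exact hy

theorem IsSel.substructure (h : IsSel N) (S : selLang.Substructure N) : IsSel S :=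
  IsSel.of_embedding S.subtype h

/-- One application of `eval` suffices: a proper value lies in `O₀`, so it is never again a
function, and as an argument it can be replaced by the `E`-equivalent element it came from. Improper
values are the first argument. -/
theorem IsSel.ev_closed (h : IsSel N) {s : Set N} :
    ∀ x ∈ s ∪ Set.image2 ev s s, ∀ y ∈ s ∪ Set.image2 ev s s, ev x y ∈ s ∪ Set.image2 ev s s := by
  have key : ∀ x ∈ s ∪ Set.image2 ev s s, x ∈ s ∨ ∃ p ∈ s, ∃ q ∈ s, IsF p ∧ IsO q ∧ x = ev p q := by
    rintro x (hx | ⟨p, hp, q, hq, rfl⟩)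
    · exact Or.inl hx
    · by_cases h' : IsF p ∧ IsO q
      · exact Or.inr ⟨p, hp, q, hq, h'.1, h'.2, rfl⟩
      · left; rwa [h.ev_triv _ _ h']
  intro x hx y hy
  rcases key x hx with hx' | ⟨p, hp, q, hq, hF, hO, rfl⟩
  · rcases key y hy with hy' | ⟨p, hp, q, hq, hF, hO, rfl⟩
    · exact Or.inr ⟨x, hx', y, hy', rfl⟩
    · by_cases hxF : IsF x
      · rw [← h.ev_congr x q (ev p q) hxF (h.E_ev p q hF hO)]
        exact Or.inr ⟨x, hx', q, hq, rfl⟩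
      · rw [h.ev_triv _ _ fun h' => hxF h'.1]
        exact Or.inl hx'
  · rw [h.ev_triv _ _ fun h' => h.not_F_O0 _ h'.1 (h.ev_O0 _ _ hF hO)]
    exact hx

theorem IsSel.finite_closure (h : IsSel N) {s : Set N} (hs : s.Finite) :
    Finite (Substructure.closure selLang s) := by
  have : Substructure.closure selLang s ≤ selSub (s ∪ Set.image2 ev s s) h.ev_closed :=
    Substructure.closure_le.2 fun x hx => Or.inl hx
  exact ((hs.union (hs.image2 _ hs)).subset this).to_subtype

end Embeddings

/-! ### Existentially closed models and elimination of quantifiers -/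

/-- The models of `T` over which every extension of finite models can be realized. -/
structure EC (N : Type) [selLang.Structure N] : Prop where
  isSel : IsSel N
  extend : ∀ (A B : Type) [selLang.Structure A] [selLang.Structure B] [Finite B], IsSel B →
    ∀ (f : A ↪[selLang] B) (g : A ↪[selLang] N), ∃ h : B ↪[selLang] N, ∀ a, h (f a) = g a

section QE

variable {N N' A : Type} [selLang.Structure N] [selLang.Structure N'] [selLang.Structure A]

/-- The forth step: the copy of `A` in `N'` together with `y` generates a finite model, which
existential closedness of `N` copies over `g`. -/
theorem EC.forth (hN : EC N) (hN' : IsSel N') [Finite A] (g : A ↪[selLang] N)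
    (g' : A ↪[selLang] N') (y : N') : ∃ (B : Type) (_ : selLang.Structure B) (_ : Finite B)
      (i : A ↪[selLang] B) (h : B ↪[selLang] N) (h' : B ↪[selLang] N') (b : B),
      (∀ a, h (i a) = g a) ∧ (∀ a, h' (i a) = g' a) ∧ h' b = y := by
  let S := Substructure.closure selLang (Set.range g' ∪ {y})
  have hfin : Finite S := hN'.finite_closure ((Set.finite_range _).union (Set.finite_singleton y))
  let i : A ↪[selLang] S := g'.codRestrict S
    fun a => Substructure.subset_closure (Or.inl (Set.mem_range_self a))
  obtain ⟨h, hh⟩ := hN.extend A S (hN'.substructure S) i g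
  exact ⟨S, inferInstance, hfin, i, h, S.subtype,
    ⟨y, Substructure.subset_closure (Or.inr rfl)⟩, hh, fun a => rfl, rfl⟩

/-- Back and forth by induction on the formula. The finite model `A` is quantified inside the
induction, since each quantifier replaces it by a larger one. -/
theorem EC.realize_bounded (hN : EC N) (hN' : EC N') {α : Type} {n : ℕ}
    (φ : selLang.BoundedFormula α n) : ∀ (A : Type) [selLang.Structure A] [Finite A]
      (g : A ↪[selLang] N) (g' : A ↪[selLang] N') (v : α → A) (xs : Fin n → A),
      φ.Realize (g ∘ v) (g ∘ xs) ↔ φ.Realize (g' ∘ v) (g' ∘ xs) := by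
  induction φ with
  | falsum => intros; rfl
  | equal t u =>
    intro A _ _ g g' v xs
    simp only [BoundedFormula.Realize, ← Sum.comp_elim, HomClass.realize_term,
      g.injective.eq_iff, g'.injective.eq_iff]
  | rel R ts =>
    intro A _ _ g g' v xs
    simp only [BoundedFormula.Realize, ← Sum.comp_elim, HomClass.realize_term]
    exact (g.map_rel R _).trans (g'.map_rel R _).symm
  | imp φ ψ ih1 ih2 =>
    intro A _ _ g g' v xs
    simp only [BoundedFormula.realize_imp, ih1 A g g', ih2 A g g']
  | all φ ih =>
    intro A _ _ g g' v xs
    simp only [BoundedFormula.realize_all]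
    constructor
    · intro H y
      obtain ⟨B, _, _, i, h, h', b, e, e', rfl⟩ := hN.forth hN'.isSel g g' y
      have e1 : g = h.comp i := by ext a; exact (e a).symm
      have e2 : g' = h'.comp i := by ext a; exact (e' a).symm
      have := H (h b)
      subst e1 e2
      have key := ih B h h' (i ∘ v) (Fin.snoc (i ∘ xs) b)
      rw [Fin.comp_snoc, Fin.comp_snoc] at key
      exact key.1 this
    · intro H y
      obtain ⟨B, _, _, i, h', h, b, e', e, rfl⟩ := hN'.forth hN.isSel g' g y
      have e1 : g = h.comp i := by ext a; exact (e a).symm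
      have e2 : g' = h'.comp i := by ext a; exact (e' a).symm
      have := H (h' b)
      subst e1 e2
      have key := ih B h h' (i ∘ v) (Fin.snoc (i ∘ xs) b)
      rw [Fin.comp_snoc, Fin.comp_snoc] at key
      exact key.2 this

/-- Elimination of quantifiers: partial isomorphisms between existentially closed models preserve
all formulas. -/
theorem EC.realize_iff_of_freeVar (hN : EC N) (hN' : EC N') {I : N → N' → Prop} (hI : PIso I)
    {α : Type} [DecidableEq α] (φ : selLang.Formula α) (v : α → N) (v' : α → N')
    (h : ∀ a ∈ φ.freeVarFinset, I (v a) (v' a)) : φ.Realize v ↔ φ.Realize v' := by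
  -- Only the free variables count, so the generated model is finite even when `α` is infinite.
  let S := Substructure.closure selLang (Set.range fun a : φ.freeVarFinset => v a)
  have hfin : Finite S := hN.isSel.finite_closure (Set.finite_range _)
  -- The domain of `I` is closed under `eval` and contains the generators of `S`.
  have hdom : ∀ x : S, ∃ y, I x y := by
    have : S ≤ selSub {x | ∃ y, I x y} (by
        rintro x ⟨y, hy⟩ x' ⟨y', hy'⟩; exact ⟨_, hI.ev hy hy'⟩) :=
      Substructure.closure_le.2 (by rintro _ ⟨a, rfl⟩; exact ⟨_, h a a.2⟩)
    exact fun x => this x.2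
  choose f hf using hdom
  have hg : PIso fun (x : S) y => f x = y :=
    { F := by rintro x _ rfl; exact (emb_F S.subtype x).symm.trans (hI.F (hf x))
      O0 := by rintro x _ rfl; exact (emb_O0 S.subtype x).symm.trans (hI.O0 (hf x))
      O1 := by rintro x _ rfl; exact (emb_O1 S.subtype x).symm.trans (hI.O1 (hf x))
      eq := by
        rintro x _ x' _ rfl rfl
        exact Subtype.ext_iff.trans (hI.eq (hf x) (hf x'))
      E := by
        rintro x _ x' _ rfl rfl
        exact (emb_E S.subtype x x').symm.trans (hI.E (hf x) (hf x'))
      R0 := by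
        rintro x _ x' _ rfl rfl
        exact (emb_R0 S.subtype x x').symm.trans (hI.R0 (hf x) (hf x'))
      ev := by
        rintro x _ x' _ rfl rfl
        have h1 : I (ev x.1 x'.1) (f (ev x x')) := by
          have := hf (ev x x')
          rwa [show ((ev x x' : S) : N) = ev x.1 x'.1 from emb_ev S.subtype x x'] at this
        exact (hI.eq h1 (hI.ev (hf x) (hf x'))).1 rfl }
  let w : φ.freeVarFinset → S := fun a => ⟨v a, Substructure.subset_closure ⟨a, rfl⟩⟩
  have key := hN.realize_bounded hN' (φ.restrictFreeVar id) S S.subtype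
    (hg.toEmbedding (hN.isSel.substructure S) hN'.isSel f) w default
  rw [BoundedFormula.realize_restrictFreeVar v (by intro a; rfl),
    BoundedFormula.realize_restrictFreeVar v' (by
      intro a
      exact (hI.eq (hf (w a)) (h a a.2)).1 rfl)] at key
  rw [Formula.Realize, Formula.Realize]
  convert key

theorem EC.realize_iff (hN : EC N) (hN' : EC N') {I : N → N' → Prop} (hI : PIso I) {α : Type}
    (φ : selLang.Formula α) (v : α → N) (v' : α → N') (h : ∀ a, I (v a) (v' a)) :
    φ.Realize v ↔ φ.Realize v' := by
  classical
  exact hN.realize_iff_of_freeVar hN' hI φ v v' fun a _ => h a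

/-- Embeddings between existentially closed models are elementary. -/
def EC.elementary (hN : EC N) (hN' : EC N') (f : N ↪[selLang] N') : N ↪ₑ[selLang] N' where
  toFun := f
  map_formula' _ φ x :=
    (hN.realize_iff hN' (PIso.of_embedding f) φ x (f ∘ x) fun _ => rfl).symm

end QE

end Shredding

namespace Shredding

/-! ### Gluing models of `T` -/

/-- Models `P j` of `T` together with an identification `R` of some of their elements and an
identification `Rc` of some of their `E`-classes. -/
structure GlueData {J : Type} (P : J → Type) [∀ j, selLang.Structure (P j)] where
  /-- the identification of elements -/
  R : (Σ j, P j) → (Σ j, P j) → Prop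
  /-- the identification of classes -/
  Rc : (Σ j, P j) → (Σ j, P j) → Prop
  isSel : ∀ j, IsSel (P j)
  R_refl : ∀ x, R x x
  R_symm : ∀ {x y}, R x y → R y x
  R_trans : ∀ {x y z}, R x y → R y z → R x z
  R_inj : ∀ {j} {x y : P j}, R ⟨j, x⟩ ⟨j, y⟩ → x = y
  Rc_symm : ∀ {x y}, Rc x y → Rc y x
  Rc_trans : ∀ {x y z}, Rc x y → Rc y z → Rc x z
  Rc_iff : ∀ {j} {x y : P j}, Rc ⟨j, x⟩ ⟨j, y⟩ ↔ RelE x y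
  Rc_of_R : ∀ {j k} {x : P j} {y : P k}, R ⟨j, x⟩ ⟨k, y⟩ → IsO x → Rc ⟨j, x⟩ ⟨k, y⟩
  F : ∀ {j k} {x : P j} {y : P k}, R ⟨j, x⟩ ⟨k, y⟩ → IsF x → IsF y
  O0 : ∀ {j k} {x : P j} {y : P k}, R ⟨j, x⟩ ⟨k, y⟩ → IsO0 x → IsO0 y
  O1 : ∀ {j k} {x : P j} {y : P k}, R ⟨j, x⟩ ⟨k, y⟩ → IsO1 x → IsO1 y
  ev : ∀ {j k} {x x' : P j} {y y' : P k}, R ⟨j, x⟩ ⟨k, y⟩ → IsF x → Rc ⟨j, x'⟩ ⟨k, y'⟩ →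
    R ⟨j, Shredding.ev x x'⟩ ⟨k, Shredding.ev y y'⟩
  R0 : ∀ {j k} {x x' : P j} {y y' : P k}, R ⟨j, x⟩ ⟨k, y⟩ → R ⟨j, x'⟩ ⟨k, y'⟩ →
    Rel0 x x' → Rel0 y y'

namespace GlueData

variable {J : Type} {P : J → Type} [∀ j, selLang.Structure (P j)] (G : GlueData P)

/-- The setoid of identified elements. -/
def setoid : Setoid (Σ j, P j) := ⟨G.R, G.R_refl, G.R_symm, G.R_trans⟩

/-- The class of an element in the disjoint union of the pieces. -/
def cls (x : Σ j, P j) : Set (Σ j, P j) := {y | G.Rc x y}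

/-- The universe of the glued model: the identified elements, and one new element of `O₀` for each
class. -/
def Carrier : Type := Quotient G.setoid ⊕ Set.range G.cls

/-- The image of an element of a piece. -/
def inj (j : J) (x : P j) : G.Carrier := Sum.inl (Quotient.mk G.setoid ⟨j, x⟩)

/-- The new element in the class of an element of a piece. -/
def dflt (j : J) (x : P j) : G.Carrier := Sum.inr ⟨G.cls ⟨j, x⟩, Set.mem_range_self _⟩

theorem inj_eq_iff {j k : J} {x : P j} {y : P k} : G.inj j x = G.inj k y ↔ G.R ⟨j, x⟩ ⟨k, y⟩ :=
  Sum.inl_injective.eq_iff.trans (Quotient.eq (r := G.setoid))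

theorem inj_ne_dflt {j k : J} {x : P j} {y : P k} : G.inj j x ≠ G.dflt k y := Sum.inl_ne_inr

theorem cases_carrier (d : G.Carrier) : ∃ j x, d = G.inj j x ∨ d = G.dflt j x := by
  rcases d with q | ⟨_, ⟨j, x⟩, rfl⟩
  · obtain ⟨⟨j, x⟩, rfl⟩ := Quotient.exists_rep q
    exact ⟨j, x, Or.inl rfl⟩
  · exact ⟨j, x, Or.inr rfl⟩

theorem O {j k : J} {x : P j} {y : P k} (h : G.R ⟨j, x⟩ ⟨k, y⟩) (hx : IsO x) : IsO y := by
  rw [(G.isSel _).O_iff] at hx ⊢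
  exact hx.imp (G.O0 h) (G.O1 h)

theorem Rc_O {j k : J} {x : P j} {y : P k} (h : G.Rc ⟨j, x⟩ ⟨k, y⟩) : IsO x :=
  ((G.isSel j).E_O _ _ (G.Rc_iff.1 (G.Rc_trans h (G.Rc_symm h)))).1

theorem cls_eq_of_Rc {x y : Σ j, P j} (h : G.Rc x y) : G.cls x = G.cls y :=
  Set.ext fun _ => ⟨fun h' => G.Rc_trans (G.Rc_symm h) h', fun h' => G.Rc_trans h h'⟩

theorem cls_eq_iff {j k : J} {x : P j} {y : P k} (hx : IsO x) :
    G.cls ⟨j, x⟩ = G.cls ⟨k, y⟩ ↔ G.Rc ⟨j, x⟩ ⟨k, y⟩ := by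
  refine ⟨fun h => ?_, G.cls_eq_of_Rc⟩
  have : (⟨j, x⟩ : Σ j, P j) ∈ G.cls ⟨j, x⟩ := G.Rc_iff.2 ((G.isSel j).E_refl x hx)
  rw [h] at this
  exact G.Rc_symm this

theorem cls_eq_of_R {x y : Σ j, P j} (h : G.R x y) : G.cls x = G.cls y := by
  obtain ⟨j, x⟩ := x
  obtain ⟨k, y⟩ := y
  by_cases hx : IsO x
  · exact G.cls_eq_of_Rc (G.Rc_of_R h hx)
  · have hy : ¬ IsO y := fun hy => hx (G.O (G.R_symm h) hy)
    exact Set.ext fun ⟨l, z⟩ => ⟨fun h' => (hx (G.Rc_O h')).elim, fun h' => (hy (G.Rc_O h')).elim⟩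

/-- The class of an element of the glued model. -/
def clsD : G.Carrier → Set (Σ j, P j)
  | Sum.inl q => Quotient.lift G.cls (fun _ _ h => G.cls_eq_of_R h) q
  | Sum.inr c => c

@[simp] theorem clsD_inj (j : J) (x : P j) : G.clsD (G.inj j x) = G.cls ⟨j, x⟩ := rfl

theorem exists_clsD (d : G.Carrier) : ∃ j x, G.clsD d = G.cls ⟨j, x⟩ := by
  obtain ⟨j, x, rfl | rfl⟩ := G.cases_carrier d
  · exact ⟨j, x, rfl⟩
  · exact ⟨j, x, rfl⟩

/-- Membership in `F` for the glued model. -/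
def DF (d : G.Carrier) : Prop := ∃ j x, d = G.inj j x ∧ IsF x

/-- Membership in `O₀` for the glued model. -/
def DO0 (d : G.Carrier) : Prop := (∃ j x, d = G.inj j x ∧ IsO0 x) ∨ ∃ j x, d = G.dflt j x

/-- Membership in `O₁` for the glued model. -/
def DO1 (d : G.Carrier) : Prop := ∃ j x, d = G.inj j x ∧ IsO1 x

/-- `eval(u, v)` is determined by some piece. -/
def Meet (u v : G.Carrier) (w : Σ j, P j × P j) : Prop :=
  u = G.inj w.1 w.2.1 ∧ IsF w.2.1 ∧ IsO w.2.2 ∧ G.clsD v = G.cls ⟨w.1, w.2.2⟩ ∧ (G.DO0 v ∨ G.DO1 v)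

open Classical in
/-- The raw data of the glued model. -/
noncomputable def raw : SelRaw G.Carrier where
  F := G.DF
  O0 := G.DO0
  O1 := G.DO1
  E u v := (G.DO0 u ∨ G.DO1 u) ∧ (G.DO0 v ∨ G.DO1 v) ∧ G.clsD u = G.clsD v
  R0 u v := ∃ j x y, u = G.inj j x ∧ v = G.inj j y ∧ Rel0 x y
  ev u v :=
    if h : ∃ w, G.Meet u v w then G.inj h.choose.1 (Shredding.ev h.choose.2.1 h.choose.2.2)
    else if G.DF u ∧ (G.DO0 v ∨ G.DO1 v) then
      G.dflt (G.exists_clsD v).choose (G.exists_clsD v).choose_spec.choose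
    else u

noncomputable instance : selLang.Structure G.Carrier := G.raw.toStructure

theorem DF_inj {j : J} {x : P j} : G.DF (G.inj j x) ↔ IsF x := by
  refine ⟨?_, fun h => ⟨j, x, rfl, h⟩⟩
  rintro ⟨k, y, h, hy⟩
  exact G.F (G.R_symm (G.inj_eq_iff.1 h)) hy

theorem DO0_inj {j : J} {x : P j} : G.DO0 (G.inj j x) ↔ IsO0 x := by
  refine ⟨?_, fun h => Or.inl ⟨j, x, rfl, h⟩⟩
  rintro (⟨k, y, h, hy⟩ | ⟨k, y, h⟩)
  · exact G.O0 (G.R_symm (G.inj_eq_iff.1 h)) hy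
  · exact (G.inj_ne_dflt h).elim

theorem DO1_inj {j : J} {x : P j} : G.DO1 (G.inj j x) ↔ IsO1 x := by
  refine ⟨?_, fun h => ⟨j, x, rfl, h⟩⟩
  rintro ⟨k, y, h, hy⟩
  exact G.O1 (G.R_symm (G.inj_eq_iff.1 h)) hy

theorem DO_inj {j : J} {x : P j} : G.DO0 (G.inj j x) ∨ G.DO1 (G.inj j x) ↔ IsO x := by
  rw [DO0_inj, DO1_inj, (G.isSel j).O_iff]

theorem DF_dflt {j : J} {x : P j} : ¬ G.DF (G.dflt j x) := by
  rintro ⟨k, y, h, -⟩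
  exact G.inj_ne_dflt h.symm

theorem DO0_dflt {j : J} {x : P j} : G.DO0 (G.dflt j x) := Or.inr ⟨j, x, rfl⟩

/-- The chosen piece does not matter: compatibility of the gluing data makes the value depend only
on the identified function and the identified class. -/
theorem raw_ev_of_meet {j : J} {x y : P j} {u v : G.Carrier} (hm : G.Meet u v ⟨j, x, y⟩) :
    G.raw.ev u v = G.inj j (Shredding.ev x y) := by
  have h : ∃ w, G.Meet u v w := ⟨_, hm⟩
  have : G.raw.ev u v = G.inj h.choose.1 (Shredding.ev h.choose.2.1 h.choose.2.2) := dif_pos h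
  rw [this, G.inj_eq_iff]
  obtain ⟨h1, h2, h3, h4, -⟩ := h.choose_spec
  obtain ⟨h1', h2', h3', h4', -⟩ := hm
  exact G.ev (G.inj_eq_iff.1 (h1.symm.trans h1')) h2 ((G.cls_eq_iff h3).1 (h4.symm.trans h4'))

theorem raw_ev_of_not_meet {u v : G.Carrier} (h : ¬ ∃ w, G.Meet u v w) (hu : G.DF u)
    (hv : G.DO0 v ∨ G.DO1 v) : ∀ {j : J} {x : P j}, G.clsD v = G.cls ⟨j, x⟩ →
      G.raw.ev u v = G.dflt j x := by
  intro j x hx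
  have : G.raw.ev u v = G.dflt (G.exists_clsD v).choose (G.exists_clsD v).choose_spec.choose :=
    (dif_neg h).trans (if_pos ⟨hu, hv⟩)
  rw [this]
  have h2 := (G.exists_clsD v).choose_spec.choose_spec
  exact congrArg Sum.inr (Subtype.ext (h2.symm.trans hx))

theorem raw_ev_cases {u v : G.Carrier} (hu : G.DF u) (hv : G.DO0 v ∨ G.DO1 v) :
    (∃ j x y, G.Meet u v ⟨j, x, y⟩ ∧ G.raw.ev u v = G.inj j (Shredding.ev x y)) ∨
      (¬ ∃ w, G.Meet u v w) ∧ ∃ j x, G.clsD v = G.cls ⟨j, x⟩ ∧ G.raw.ev u v = G.dflt j x := by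
  by_cases h : ∃ w, G.Meet u v w
  · obtain ⟨⟨j, x, y⟩, hm⟩ := h
    exact Or.inl ⟨j, x, y, hm, G.raw_ev_of_meet hm⟩
  · obtain ⟨j, x, hx⟩ := G.exists_clsD v
    exact Or.inr ⟨h, j, x, hx, G.raw_ev_of_not_meet h hu hv hx⟩

/-- The new elements are in `O₀`, lie in the right class and carry no `R₀`, so they can serve as
values of `eval`. Invariance of `eval` under `E` holds because `Meet` sees its second argument only
through the class. -/
theorem valid_raw : G.raw.Valid where
  cover d := by
    obtain ⟨j, x, rfl | rfl⟩ := G.cases_carrier d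
    · exact ((G.isSel j).cover x).imp G.DF_inj.2 (Or.imp G.DO0_inj.2 G.DO1_inj.2)
    · exact Or.inr (Or.inl G.DO0_dflt)
  not_F_O0 d h := by
    obtain ⟨j, x, rfl, hx⟩ := h
    exact fun h => (G.isSel j).not_F_O0 x hx (G.DO0_inj.1 h)
  not_F_O1 d h := by
    obtain ⟨j, x, rfl, hx⟩ := h
    exact fun h => (G.isSel j).not_F_O1 x hx (G.DO1_inj.1 h)
  not_O0_O1 d h h' := by
    obtain ⟨j, x, rfl, hx⟩ := h'
    exact (G.isSel j).not_O0_O1 x (G.DO0_inj.1 h) hx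
  E_O u v h := h.1
  E_refl u h := ⟨h, h, rfl⟩
  E_symm u v h := ⟨h.2.1, h.1, h.2.2.symm⟩
  E_trans u v w h h' := ⟨h.1, h'.2.1, h.2.2.trans h'.2.2⟩
  ev_O0 u v hu hv := by
    rcases G.raw_ev_cases hu hv with ⟨j, x, y, hm, h⟩ | ⟨-, j, x, -, h⟩
    · rw [h]
      exact G.DO0_inj.2 ((G.isSel j).ev_O0 x y hm.2.1 hm.2.2.1)
    · rw [h]
      exact G.DO0_dflt
  E_ev u v hu hv := by
    rcases G.raw_ev_cases hu hv with ⟨j, x, y, hm, h⟩ | ⟨-, j, x, hc, h⟩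
    · rw [h]
      refine ⟨hv, Or.inl (G.DO0_inj.2 ((G.isSel j).ev_O0 x y hm.2.1 hm.2.2.1)), ?_⟩
      rw [hm.2.2.2.1, clsD_inj]
      exact G.cls_eq_of_Rc (G.Rc_iff.2 ((G.isSel j).E_ev x y hm.2.1 hm.2.2.1))
    · rw [h]
      exact ⟨hv, Or.inl G.DO0_dflt, hc⟩
  ev_congr u v w hu h := by
    obtain ⟨hv, hw, hc⟩ := h
    rcases G.raw_ev_cases hu hv with ⟨j, x, y, hm, h⟩ | ⟨hm, j, x, hx, h⟩
    · rw [h, G.raw_ev_of_meet (v := w) ⟨hm.1, hm.2.1, hm.2.2.1, hc ▸ hm.2.2.2.1, hw⟩]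
    · rw [h, G.raw_ev_of_not_meet _ hu hw (hc ▸ hx)]
      rintro ⟨w', hm'⟩
      exact hm ⟨w', hm'.1, hm'.2.1, hm'.2.2.1, hc ▸ hm'.2.2.2.1, hv⟩
  R0_sort u v h := by
    obtain ⟨j, x, y, rfl, rfl, h⟩ := h
    exact ⟨G.DO0_inj.2 ((G.isSel j).R0_sort x y h).1, G.DO1_inj.2 ((G.isSel j).R0_sort x y h).2⟩
  ev_triv u v h := by
    refine (dif_neg ?_).trans (if_neg h)
    rintro ⟨⟨j, x, y⟩, h1, h2, -, -, h5⟩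
    exact h ⟨⟨j, x, h1, h2⟩, h5⟩

theorem isSel_carrier : IsSel G.Carrier := G.valid_raw.isSel

theorem R0_inj {j : J} {x y : P j} : Rel0 (G.inj j x) (G.inj j y) ↔ Rel0 x y := by
  refine ⟨?_, fun h => ⟨j, x, y, rfl, rfl, h⟩⟩
  rintro ⟨k, x', y', hx, hy, h⟩
  exact G.R0 (G.R_symm (G.inj_eq_iff.1 hx)) (G.R_symm (G.inj_eq_iff.1 hy)) h

theorem E_inj {j k : J} {x : P j} {y : P k} :
    RelE (G.inj j x) (G.inj k y) ↔ G.Rc ⟨j, x⟩ ⟨k, y⟩ := by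
  constructor
  · rintro ⟨h1, h2, h3⟩
    exact (G.cls_eq_iff (G.DO_inj.1 h1)).1 h3
  · intro h
    exact ⟨G.DO_inj.2 (G.Rc_O h), G.DO_inj.2 (G.Rc_O (G.Rc_symm h)), G.cls_eq_of_Rc h⟩

theorem ev_inj {j : J} {x y : P j} :
    Shredding.ev (G.inj j x) (G.inj j y) = G.inj j (Shredding.ev x y) := by
  by_cases h : IsF x ∧ IsO y
  · exact G.raw_ev_of_meet ⟨rfl, h.1, h.2, rfl, G.DO_inj.2 h.2⟩
  · rw [(G.isSel j).ev_triv _ _ h, G.isSel_carrier.ev_triv]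
    rintro ⟨h1, h2⟩
    exact h ⟨G.DF_inj.1 h1, G.DO_inj.1 h2⟩

theorem piso_inj (j : J) : PIso fun (x : P j) (d : G.Carrier) => G.inj j x = d where
  F := by rintro x _ rfl; exact G.DF_inj.symm
  O0 := by rintro x _ rfl; exact G.DO0_inj.symm
  O1 := by rintro x _ rfl; exact G.DO1_inj.symm
  eq := by
    rintro x _ y _ rfl rfl
    exact ⟨fun h => h ▸ rfl, fun h => G.R_inj (G.inj_eq_iff.1 h)⟩
  E := by rintro x _ y _ rfl rfl; exact (G.E_inj.trans G.Rc_iff).symm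
  R0 := by rintro x _ y _ rfl rfl; exact G.R0_inj.symm
  ev := by rintro x _ y _ rfl rfl; exact G.ev_inj.symm

/-- The embedding of a piece into the glued model. -/
noncomputable def of (j : J) : P j ↪[selLang] G.Carrier :=
  (G.piso_inj j).toEmbedding (G.isSel j) G.isSel_carrier (G.inj j)

end GlueData

end Shredding

namespace Shredding

/-! ### Gluing many models to one -/

section Star

/-- Two elements of the same piece are equivalent. -/
inductive SameE {J : Type} {P : J → Type} [∀ j, selLang.Structure (P j)] :
    (Σ j, P j) → (Σ j, P j) → Prop
  | intro (j : J) (x y : P j) (h : RelE x y) : SameE ⟨j, x⟩ ⟨j, y⟩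

variable {J : Type} {P : J → Type} [∀ j, selLang.Structure (P j)] {Y : Type} [selLang.Structure Y]

theorem SameE.relE {j : J} {x y : P j} (h : SameE (⟨j, x⟩ : Σ j, P j) ⟨j, y⟩) : RelE x y := by
  cases h; assumption

theorem SameE.symm (hP : ∀ j, IsSel (P j)) {x y : Σ j, P j} (h : SameE x y) : SameE y x := by
  obtain ⟨j, x, y, h⟩ := h; exact ⟨j, y, x, (hP j).E_symm _ _ h⟩

/-- The class of `x` is represented, through the partial isomorphism `I`, by that of `y`. -/
def RepClass {N : Type} [selLang.Structure N] (I : N → Y → Prop) (x : N) (y : Y) : Prop :=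
  ∃ s y', RelE x s ∧ I s y' ∧ RelE y' y

section RepClass

variable {N : Type} [selLang.Structure N] {I : N → Y → Prop} (hI : PIso I) (hN : IsSel N)
  (hY : IsSel Y)

include hN in
theorem RepClass.congr_left {x x' : N} {y : Y} (h : RelE x' x) (h' : RepClass I x y) :
    RepClass I x' y := by
  obtain ⟨s, y', h1, h2⟩ := h'
  exact ⟨s, y', hN.E_trans _ _ _ h h1, h2⟩

include hY in
theorem RepClass.congr_right {x : N} {y y' : Y} (h : RelE y y') (h' : RepClass I x y) :
    RepClass I x y' := by
  obtain ⟨s, z, h1, h2, h3⟩ := h'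
  exact ⟨s, z, h1, h2, hY.E_trans _ _ _ h3 h⟩

include hI hN hY

theorem RepClass.of_rel {x : N} {y : Y} (h : I x y) (hx : IsO x) : RepClass I x y :=
  ⟨x, y, hN.E_refl x hx, h, hY.E_refl y ((hI.O hN hY h).1 hx)⟩

theorem RepClass.relE_right {x : N} {y y' : Y} (h : RepClass I x y) (h' : RepClass I x y') :
    RelE y y' := by
  obtain ⟨s, z, h1, h2, h3⟩ := h
  obtain ⟨s', z', h1', h2', h3'⟩ := h'
  have : RelE z z' := (hI.E h2 h2').1 (hN.E_trans _ _ _ (hN.E_symm _ _ h1) h1')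
  exact hY.E_trans _ _ _ (hY.E_symm _ _ h3) (hY.E_trans _ _ _ this h3')

theorem RepClass.relE_left {x x' : N} {y : Y} (h : RepClass I x y) (h' : RepClass I x' y) :
    RelE x x' := by
  obtain ⟨s, z, h1, h2, h3⟩ := h
  obtain ⟨s', z', h1', h2', h3'⟩ := h'
  have : RelE s s' := (hI.E h2 h2').2 (hY.E_trans _ _ _ h3 (hY.E_symm _ _ h3'))
  exact hN.E_trans _ _ _ h1 (hN.E_trans _ _ _ this (hN.E_symm _ _ h1'))

theorem RepClass.ev {x x' : N} {y y' : Y} (h : I x y) (hx : IsF x) (h' : RepClass I x' y') :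
    I (ev x x') (ev y y') := by
  obtain ⟨s, z, h1, h2, h3⟩ := h'
  rw [hN.ev_congr x x' s hx h1, ← hY.ev_congr y z y' ((hI.F h).1 hx) h3]
  exact hI.ev h h2

end RepClass

variable (hY : IsSel Y) (hP : ∀ j, IsSel (P j)) (rep : ∀ j, P j → Y → Prop)
  (hrep : ∀ j, PIso (rep j))

/-- Gluing of pieces `P j` along partial isomorphisms with `Y`. -/
def starGlue : GlueData P where
  R x x' := x = x' ∨ ∃ y, rep x.1 x.2 y ∧ rep x'.1 x'.2 y
  Rc x x' := SameE x x' ∨ ∃ y, RepClass (rep x.1) x.2 y ∧ RepClass (rep x'.1) x'.2 y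
  isSel := hP
  R_refl x := Or.inl rfl
  R_symm := by
    rintro x y (rfl | ⟨z, h, h'⟩)
    · exact Or.inl rfl
    · exact Or.inr ⟨z, h', h⟩
  R_trans := by
    rintro x ⟨j, y⟩ z (rfl | ⟨w, h, h'⟩) (rfl | ⟨w', h1, h1'⟩)
    · exact Or.inl rfl
    · exact Or.inr ⟨w', h1, h1'⟩
    · exact Or.inr ⟨w, h, h'⟩
    · cases ((hrep j).eq h' h1).1 rfl
      exact Or.inr ⟨w, h, h1'⟩
  R_inj := by
    rintro j x y (h | ⟨z, h, h'⟩)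
    · cases h; rfl
    · exact ((hrep j).eq h h').2 rfl
  Rc_symm := by
    rintro x y (h | ⟨z, h, h'⟩)
    · exact Or.inl (h.symm hP)
    · exact Or.inr ⟨z, h', h⟩
  Rc_trans := by
    rintro x ⟨k, y⟩ z (h | ⟨w, h, h'⟩) h1
    · obtain ⟨_, x, _, h⟩ := h
      rcases h1 with h1 | ⟨w', h1, h1'⟩
      · obtain ⟨_, _, z, h1⟩ := h1
        exact Or.inl ⟨_, _, _, (hP k).E_trans _ _ _ h h1⟩
      · exact Or.inr ⟨w', h1.congr_left (hP k) h, h1'⟩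
    · rcases h1 with h1 | ⟨w', h1, h1'⟩
      · obtain ⟨_, _, z, h1⟩ := h1
        exact Or.inr ⟨w, h, h'.congr_left (hP k) ((hP k).E_symm _ _ h1)⟩
      · exact Or.inr ⟨w', h.congr_right hY (h'.relE_right (hrep k) (hP k) hY h1), h1'⟩
  Rc_iff := by
    intro j x y
    refine ⟨?_, fun h => Or.inl ⟨j, x, y, h⟩⟩
    rintro (h | ⟨z, h, h'⟩)
    · exact h.relE
    · exact h.relE_left (hrep j) (hP j) hY h'
  Rc_of_R := by
    rintro j k x y (h | ⟨z, h, h'⟩) hx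
    · cases h; exact Or.inl ⟨j, x, x, (hP j).E_refl x hx⟩
    · refine Or.inr ⟨z, .of_rel (hrep j) (hP j) hY h hx, .of_rel (hrep k) (hP k) hY h' ?_⟩
      exact ((hrep k).O (hP k) hY h').2 (((hrep j).O (hP j) hY h).1 hx)
  F := by
    rintro j k x y (h | ⟨z, h, h'⟩) hx
    · cases h; exact hx
    · exact ((hrep k).F h').2 (((hrep j).F h).1 hx)
  O0 := by
    rintro j k x y (h | ⟨z, h, h'⟩) hx
    · cases h; exact hx
    · exact ((hrep k).O0 h').2 (((hrep j).O0 h).1 hx)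
  O1 := by
    rintro j k x y (h | ⟨z, h, h'⟩) hx
    · cases h; exact hx
    · exact ((hrep k).O1 h').2 (((hrep j).O1 h).1 hx)
  ev := by
    rintro j k x x' y y' h hx h'
    have hy : IsF y := by
      rcases h with h | ⟨z, h, h'⟩
      · cases h; exact hx
      · exact ((hrep k).F h').2 (((hrep j).F h).1 hx)
    rcases h' with h' | ⟨w, h1, h1'⟩
    · cases h'
      rename_i h'
      rcases h with h | ⟨z, h, h2⟩
      · cases h
        rw [(hP _).ev_congr _ _ _ hx h']
        exact Or.inl rfl
      · cases ((hrep _).eq h h2).2 rfl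
        rw [(hP _).ev_congr _ _ _ hx h']
        exact Or.inl rfl
    · rcases h with h | ⟨z, h, h2⟩
      · cases h
        rw [(hP j).ev_congr x x' y' hx (h1.relE_left (hrep j) (hP j) hY h1')]
        exact Or.inl rfl
      · exact Or.inr ⟨_, h1.ev (hrep j) (hP j) hY h hx, h1'.ev (hrep k) (hP k) hY h2 hy⟩
  R0 := by
    rintro j k x x' y y' (h | ⟨z, h, h1⟩) (h' | ⟨z', h', h1'⟩) h2
    · cases h; cases h'; exact h2
    · cases h
      cases ((hrep j).eq h' h1').2 rfl; exact h2
    · cases h'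
      cases ((hrep j).eq h h1).2 rfl; exact h2
    · exact ((hrep k).R0 h1 h1').2 (((hrep j).R0 h h').1 h2)

end Star

/-! ### One step of the completion -/

section Step

/-- A finite model of `T` on `Fin m` and a partial isomorphism of it with `Y`. -/
structure Code (Y : Type) [selLang.Structure Y] where
  /-- the size -/
  m : ℕ
  /-- the structure -/
  raw : SelRaw (Fin m)
  /-- the partial isomorphism -/
  ι : Fin m → Option Y
  valid : raw.Valid
  piso : @PIso (Fin m) Y raw.toStructure _ fun b y => ι b = some y

variable {Y : Type} [selLang.Structure Y]

/-- The pieces of the completion step: `Y` and the finite models given by codes. -/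
def Piece (Y : Type) [selLang.Structure Y] : Option (Code Y) → Type
  | none => Y
  | some c => Fin c.m

instance Piece.instStructure : ∀ j : Option (Code Y), selLang.Structure (Piece Y j)
  | none => inferInstanceAs (selLang.Structure Y)
  | some c => c.raw.toStructure

/-- The partial isomorphisms of the pieces with `Y`. -/
def Piece.rep : ∀ j : Option (Code Y), Piece Y j → Y → Prop
  | none => fun x y => x = y
  | some c => fun b y => c.ι b = some y

theorem Piece.piso_rep : ∀ j : Option (Code Y), PIso (Piece.rep j)
  | none => PIso.of_embedding (Embedding.refl selLang Y)
  | some c => c.piso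

theorem Piece.isSel (hY : IsSel Y) : ∀ j : Option (Code Y), IsSel (Piece Y j)
  | none => hY
  | some c => c.valid.isSel

/-- The elements of `Y` which are needed for an element of a piece. -/
def Piece.supp : ∀ j : Option (Code Y), Piece Y j → Set Y
  | none => fun x => {x}
  | some c => fun _ => {y | ∃ b, c.ι b = some y}

/-- The gluing of one step of the completion. -/
def stepGlue (hY : IsSel Y) : GlueData (Piece Y) :=
  starGlue hY (Piece.isSel hY) Piece.rep Piece.piso_rep

variable (hY : IsSel Y)

/-- The embedding into one step of the completion. -/
noncomputable def stepBase : Y ↪[selLang] (stepGlue hY).Carrier := (stepGlue hY).of none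

theorem Piece.mem_of_rep {Z : Set Y} {j : Option (Code Y)} {x : Piece Y j} {y : Y}
    (hx : Piece.supp j x ⊆ Z) (h : Piece.rep j x y) : y ∈ Z := by
  cases j with
  | none => cases h; exact hx rfl
  | some c => exact hx ⟨x, h⟩

theorem Piece.exists_of_repClass {Z : Set Y} {j : Option (Code Y)} {x : Piece Y j} {y : Y}
    (hY : IsSel Y) (hx : Piece.supp j x ⊆ Z) (h : RepClass (Piece.rep j) x y) :
    ∃ z ∈ Z, RelE z y := by
  obtain ⟨s, z, h1, h2, h3⟩ := h
  cases j with
  | none => cases h2; exact ⟨x, hx rfl, hY.E_trans _ _ _ h1 h3⟩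
  | some c => exact ⟨z, hx ⟨s, h2⟩, h3⟩

theorem inj_eq_stepBase {j : Option (Code Y)} {x : Piece Y j} {y : Y} (h : Piece.rep j x y) :
    (stepGlue hY).inj j x = stepBase hY y :=
  (stepGlue hY).inj_eq_iff.2 (Or.inr ⟨y, h, rfl⟩)

/-- The elements of the step which only need elements of `Z`. -/
def CutSet (Z : selLang.Substructure Y) : Set (stepGlue hY).Carrier :=
  {d | ∃ j x, Piece.supp j x ⊆ Z ∧ (d = (stepGlue hY).inj j x ∨ d = (stepGlue hY).dflt j x)}

variable {hY} in
theorem stepBase_mem_cutSet {Z : selLang.Substructure Y} {y : Y} :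
    stepBase hY y ∈ CutSet hY Z ↔ y ∈ Z := by
  constructor
  · rintro ⟨j, x, hx, h | h⟩
    · rcases (stepGlue hY).inj_eq_iff.1 h.symm with h | ⟨z, h, h'⟩
      · cases h; exact hx rfl
      · cases h'; exact Piece.mem_of_rep hx h
    · exact ((stepGlue hY).inj_ne_dflt h).elim
  · intro h
    exact ⟨none, y, by rintro _ rfl; exact h, Or.inl rfl⟩

/-- An element of `F` in the cut is a base element of `Z` or lies properly in a piece. -/
theorem cutSet_F {Z : selLang.Substructure Y} {d : (stepGlue hY).Carrier} (hd : d ∈ CutSet hY Z)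
    (hF : IsF d) : (∃ y ∈ Z, d = stepBase hY y) ∨
      ∃ c : Code Y, ∃ x : Piece Y (some c), Piece.supp (some c) x ⊆ Z ∧
        d = (stepGlue hY).inj (some c) x ∧ ∀ j x', d = (stepGlue hY).inj j x' → j = some c := by
  obtain ⟨j, x, hx, rfl | rfl⟩ := hd
  · cases j with
    | none => exact Or.inl ⟨x, hx rfl, rfl⟩
    | some c =>
      by_cases h : ∃ y, Piece.rep (some c) x y
      · obtain ⟨y, h⟩ := h
        exact Or.inl ⟨y, Piece.mem_of_rep hx h, inj_eq_stepBase hY h⟩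
      · refine Or.inr ⟨c, x, hx, rfl, fun j x' h' => ?_⟩
        rcases (stepGlue hY).inj_eq_iff.1 h' with h' | ⟨z, h', -⟩
        · cases h'; rfl
        · exact (h ⟨z, h'⟩).elim
  · exact ((stepGlue hY).DF_dflt hF).elim

/-- A class with an element in the cut that is also the class of an element `y` of `Y` has an
element in `Z`. -/
theorem cutSet_class {Z : selLang.Substructure Y} {j : Option (Code Y)} {x : Piece Y j} {y : Y}
    (hx : Piece.supp j x ⊆ Z) (h : (stepGlue hY).Rc ⟨j, x⟩ ⟨none, y⟩) : ∃ z ∈ Z, RelE z y := by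
  rcases h with h | ⟨w, h, h'⟩
  · cases h; rename_i h; exact ⟨x, hx rfl, h⟩
  · obtain ⟨z, hz, hw⟩ := Piece.exists_of_repClass hY hx h
    obtain ⟨_, _, h1, rfl, h2⟩ := h'
    exact ⟨z, hz, hY.E_trans _ _ _ hw (hY.E_symm _ _ (hY.E_trans _ _ _ h1 h2))⟩

/-- A function from `Z` applied to a class needed only over `Z`: either both arguments lie in one
piece, which already has support in `Z`, or the class is represented in `Z` and the value is
computed there. -/
theorem cutSet_ev {Z : selLang.Substructure Y} {k l : Option (Code Y)} {y : Piece Y k}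
    {x' y' : Piece Y l} {y0 : Y} (hy : Piece.supp k y ⊆ Z) (hy0 : y0 ∈ Z)
    (hx' : Piece.rep l x' y0) (hF : IsF x') (h : (stepGlue hY).Rc ⟨k, y⟩ ⟨l, y'⟩) :
    (stepGlue hY).inj l (ev x' y') ∈ CutSet hY Z := by
  rcases h with h | ⟨w, h, h'⟩
  · cases h
    rename_i y' h
    cases k with
    | none =>
      obtain rfl : x' = y0 := hx'
      have e : ev (N := Y) x' y = ev (N := Y) x' y' := hY.ev_congr _ _ _ hF h
      have : ev (N := Y) x' y' ∈ Z := e ▸ ev_mem Z hy0 (hy rfl)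
      exact stepBase_mem_cutSet.2 this
    | some c =>
      refine ⟨some c, _, ?_, Or.inl rfl⟩
      exact hy
  · obtain ⟨z, hz, hzw⟩ := Piece.exists_of_repClass hY hy h
    have := h'.ev (Piece.piso_rep l) (Piece.isSel hY l) hY hx' hF
    rw [inj_eq_stepBase hY this, stepBase_mem_cutSet,
      ← hY.ev_congr y0 z w (((Piece.piso_rep l).F hx').1 hF) hzw]
    exact ev_mem Z hy0 hz

/-- A function in the cut comes from `Z` or belongs to exactly one piece. In the second case a
determined value stays in that piece, whose support does not depend on the element. An undetermined
value is the default of the class, which needs no more than the argument does. -/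
theorem ev_mem_cutSet {Z : selLang.Substructure Y} : ∀ u ∈ CutSet hY Z, ∀ v ∈ CutSet hY Z,
    ev u v ∈ CutSet hY Z := by
  intro u hu v hv
  by_cases hFO : IsF u ∧ IsO v
  swap
  · rwa [(stepGlue hY).isSel_carrier.ev_triv _ _ hFO]
  obtain ⟨hF, hO⟩ := hFO
  obtain ⟨k, y, hy, hv'⟩ := hv
  have hcls : (stepGlue hY).clsD v = (stepGlue hY).cls ⟨k, y⟩ := by
    rcases hv' with rfl | rfl <;> rfl
  change (stepGlue hY).raw.ev u v ∈ _
  rcases (stepGlue hY).raw_ev_cases (u := u) (v := v) hF hO with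
    ⟨l, x', y', ⟨h1, h2, h3, h4, -⟩, h⟩ | ⟨hm, -⟩
  · rw [h]
    dsimp only at h1 h2 h3 h4
    have hRc : (stepGlue hY).Rc ⟨k, y⟩ ⟨l, y'⟩ :=
      (stepGlue hY).Rc_symm (((stepGlue hY).cls_eq_iff h3).1 (h4.symm.trans hcls))
    rcases cutSet_F hY hu hF with ⟨y0, hy0, rfl⟩ | ⟨c, x, hx, rfl, hc⟩
    · refine cutSet_ev hY hy hy0 ?_ h2 hRc
      rcases (stepGlue hY).inj_eq_iff.1 h1 with h1 | ⟨w, h1, h1'⟩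
      · cases h1; rfl
      · cases h1; exact h1'
    · cases hc _ _ h1
      refine ⟨some c, _, ?_, Or.inl rfl⟩
      exact hx
  · exact ⟨k, y, hy, Or.inr ((stepGlue hY).raw_ev_of_not_meet hm hF hO hcls)⟩

/-- The substructure of the step which only needs elements of `Z`. -/
noncomputable def stepCut (Z : selLang.Substructure Y) :
    selLang.Substructure (stepGlue hY).Carrier :=
  selSub (CutSet hY Z) (ev_mem_cutSet hY)

end Step

end Shredding

namespace Shredding

/-! ### Continuity, absence of new relations, the extension property and the size of one completion
step -/

section StepProperties

variable {Y : Type} [selLang.Structure Y] (hY : IsSel Y)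

theorem stepBase_mem_stepCut {Z : selLang.Substructure Y} {y : Y} :
    stepBase hY y ∈ stepCut hY Z ↔ y ∈ Z := stepBase_mem_cutSet

theorem Piece.finite_supp : ∀ (j : Option (Code Y)) (x : Piece Y j), (Piece.supp j x).Finite
  | none, x => Set.finite_singleton _
  | some c, _ => by
    refine ((Set.finite_range c.ι).preimage (Option.some_injective Y).injOn).subset ?_
    rintro y ⟨b, hb⟩
    exact ⟨b, hb⟩

/-- Supports are finite, so one member of the chain contains the whole support. -/
theorem exists_mem_stepCut {ι : Type*} [LinearOrder ι] [Nonempty ι]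
    {Z : ι → selLang.Substructure Y} (hZ : Monotone Z) {W : selLang.Substructure Y}
    (hW : ∀ y ∈ W, ∃ i, y ∈ Z i) {d : (stepGlue hY).Carrier} (hd : d ∈ stepCut hY W) :
    ∃ i, d ∈ stepCut hY (Z i) := by
  obtain ⟨j, x, hx, h⟩ := hd
  have := (Piece.finite_supp j x).to_subtype
  choose f hf using fun y : Piece.supp j x => hW y (hx y.2)
  obtain ⟨i, hi⟩ := Finite.exists_le f
  exact ⟨i, j, x, fun y hy => hZ (hi ⟨y, hy⟩) (hf ⟨y, hy⟩), h⟩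

theorem stepCut_mono {Z W : selLang.Substructure Y} (h : Z ≤ W) : stepCut hY Z ≤ stepCut hY W := by
  rintro d ⟨j, x, hx, h'⟩
  exact ⟨j, x, hx.trans h, h'⟩

/-! The point `b` is unrelated to the elements of `Z`. -/

/-- `b` is not related by `E`, `R₀` or `R₁` to any element of `Z`. -/
def Avoids {N : Type} [selLang.Structure N] (Z : Set N) (b : N) : Prop :=
  ∀ z ∈ Z, ¬ RelE z b ∧ ¬ Rel0 z b ∧ ¬ Rel1 z b

/-- Each relation of the glued model is inherited from a piece. A piece with support in `Z` cannot
contain `b`, nor its class, without `Z` meeting that class. For `R₁` the value `eval(d, b)` is then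
a default element, which has no `R₀`, unless `d` itself comes from `Z`. -/
theorem avoids_stepCut {Z : selLang.Substructure Y} {b : Y} (hb : IsO1 b)
    (h : Avoids (Z : Set Y) b) : Avoids (stepCut hY Z : Set (stepGlue hY).Carrier)
      (stepBase hY b) := by
  have hbb : RelE b b := hY.E_refl b ((hY.O_iff b).2 (Or.inr hb))
  intro d hd
  refine ⟨fun hE => ?_, fun hR => ?_, fun hR => ?_⟩
  · obtain ⟨j, x, hx, h'⟩ := hd
    have hRc : (stepGlue hY).Rc ⟨j, x⟩ ⟨none, b⟩ := by
      obtain ⟨h1, h2, h3⟩ := hE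
      have h4 : (stepGlue hY).cls ⟨j, x⟩ = (stepGlue hY).cls ⟨none, b⟩ := by
        rcases h' with rfl | rfl <;> exact h3
      exact (stepGlue hY).Rc_symm (((stepGlue hY).cls_eq_iff ((stepGlue hY).DO_inj.1 h2)).1 h4.symm)
    obtain ⟨z, hz, hzb⟩ := cutSet_class hY hx hRc
    exact (h z hz).1 hzb
  · obtain ⟨k, x', y', h1, h2', h3⟩ := hR
    replace h1 : d = (stepGlue hY).inj k x' := h1
    rcases (stepGlue hY).inj_eq_iff.1 h2'.symm with h2 | ⟨w, h2, rfl⟩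
    · cases h2
      subst h1
      exact (h x' ((stepBase_mem_cutSet (hY := hY)).1 hd)).2.1 h3
    · obtain ⟨j, x, hx, rfl | rfl⟩ := hd
      · rcases (stepGlue hY).inj_eq_iff.1 h1 with h1 | ⟨w', h1, h1'⟩
        · cases h1
          cases k with
          | none =>
            obtain rfl : y' = b := h2
            exact (h _ (hx rfl)).2.1 h3
          -- Here `b` is in the support of the piece, hence in `Z`, and is `E`-related to itself.
          | some c => exact (h _ (hx ⟨y', h2⟩)).1 hbb
        · exact (h w' (Piece.mem_of_rep hx h1)).2.1 (((Piece.piso_rep k).R0 h1' h2).1 h3)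
      · exact (stepGlue hY).inj_ne_dflt h1.symm
  · have hS := (stepGlue hY).isSel_carrier
    obtain ⟨hF, hO, hR0⟩ := (hS.R1_iff _ _).1 hR
    have hO' : IsO (stepBase hY b) := (hS.O_iff _).2 (Or.inr hO)
    rcases cutSet_F hY hd hF with ⟨z, hz, rfl⟩ | ⟨c, x, hx, rfl, hc⟩
    · exact (h z hz).2.2 ((emb_R1 (stepBase hY) z b).1 hR)
    · change Rel0 ((stepGlue hY).raw.ev _ _) _ at hR0
      rcases (stepGlue hY).raw_ev_cases hF hO' with ⟨l, x', y', hm, -⟩ | ⟨-, j, x', -, h'⟩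
      · obtain ⟨h1, h2, h3, h4, -⟩ := hm
        cases hc _ _ h1
        have hRc : (stepGlue hY).Rc ⟨some c, y'⟩ ⟨none, b⟩ :=
          ((stepGlue hY).cls_eq_iff h3).1 h4.symm
        obtain ⟨z, hz, hzb⟩ := cutSet_class hY (Z := Z) (by exact hx) hRc
        exact (h z hz).1 hzb
      · obtain ⟨k, x1, y1, h1, -⟩ := hR0
        exact (stepGlue hY).inj_ne_dflt (h1.symm.trans h')

/-- Transport of raw data along a bijection. -/
def SelRaw.comap {X X' : Type} (r : SelRaw X) (e : X' ≃ X) : SelRaw X' where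
  F x := r.F (e x)
  O0 x := r.O0 (e x)
  O1 x := r.O1 (e x)
  E x y := r.E (e x) (e y)
  R0 x y := r.R0 (e x) (e y)
  ev x y := e.symm (r.ev (e x) (e y))

theorem SelRaw.Valid.comap {X X' : Type} {r : SelRaw X} (h : r.Valid) (e : X' ≃ X) :
    (r.comap e).Valid where
  cover x := h.cover (e x)
  not_F_O0 x := h.not_F_O0 (e x)
  not_F_O1 x := h.not_F_O1 (e x)
  not_O0_O1 x := h.not_O0_O1 (e x)
  E_O x y := h.E_O (e x) (e y)
  E_refl x := h.E_refl (e x)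
  E_symm x y := h.E_symm (e x) (e y)
  E_trans x y z := h.E_trans (e x) (e y) (e z)
  ev_O0 x y := by simpa [SelRaw.comap] using h.ev_O0 (e x) (e y)
  E_ev x y := by simpa [SelRaw.comap] using h.E_ev (e x) (e y)
  ev_congr x y z := by simpa [SelRaw.comap] using h.ev_congr (e x) (e y) (e z)
  R0_sort x y := h.R0_sort (e x) (e y)
  ev_triv x y h' := by
    simp only [SelRaw.comap, Equiv.symm_apply_eq]; exact h.ev_triv (e x) (e y) h'

theorem PIso.comp {N₁ N₂ N₃ : Type} [selLang.Structure N₁] [selLang.Structure N₂]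
    [selLang.Structure N₃] {I : N₁ → N₂ → Prop} {I' : N₂ → N₃ → Prop} (h : PIso I) (h' : PIso I') :
    PIso fun x z => ∃ y, I x y ∧ I' y z where
  F := by rintro x y ⟨z, hz, hz'⟩; exact (h.F hz).trans (h'.F hz')
  O0 := by rintro x y ⟨z, hz, hz'⟩; exact (h.O0 hz).trans (h'.O0 hz')
  O1 := by rintro x y ⟨z, hz, hz'⟩; exact (h.O1 hz).trans (h'.O1 hz')
  eq := by
    rintro x y x' y' ⟨z, hz, hz'⟩ ⟨w, hw, hw'⟩; exact (h.eq hz hw).trans (h'.eq hz' hw')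
  E := by
    rintro x y x' y' ⟨z, hz, hz'⟩ ⟨w, hw, hw'⟩; exact (h.E hz hw).trans (h'.E hz' hw')
  R0 := by
    rintro x y x' y' ⟨z, hz, hz'⟩ ⟨w, hw, hw'⟩; exact (h.R0 hz hw).trans (h'.R0 hz' hw')
  ev := by
    rintro x y x' y' ⟨z, hz, hz'⟩ ⟨w, hw, hw'⟩; exact ⟨_, h.ev hz hw, h'.ev hz' hw'⟩

/-- Every finite extension problem over `Y` is isomorphic to one living on some `Fin m`. Coding
bounds the number of pieces, so that a single step can solve all problems at once and still be
counted. -/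
theorem exists_code {A B : Type} [selLang.Structure A] [selLang.Structure B] [Finite B]
    (hB : IsSel B) (f : A ↪[selLang] B) (g : A ↪[selLang] Y) :
    ∃ (c : Code Y) (e : B ≃ Fin c.m),
      @PIso (Fin c.m) B c.raw.toStructure _ (fun i b => e.symm i = b) ∧
        ∀ i y, c.ι i = some y ↔ ∃ a, e (f a) = i ∧ g a = y := by
  classical
  let e := Finite.equivFin B
  let r := (SelRaw.ofStructure B).comap e.symm
  have hr : r.Valid := (SelRaw.ofStructure_valid hB).comap e.symm
  let _ := r.toStructure
  have he : PIso fun (i : Fin (Nat.card B)) (b : B) => e.symm i = b :=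
    { F := by rintro i _ rfl; exact Iff.rfl
      O0 := by rintro i _ rfl; exact Iff.rfl
      O1 := by rintro i _ rfl; exact Iff.rfl
      eq := by rintro i _ j _ rfl rfl; exact e.symm.injective.eq_iff.symm
      E := by rintro i _ j _ rfl rfl; exact Iff.rfl
      R0 := by rintro i _ j _ rfl rfl; exact Iff.rfl
      ev := by rintro i _ j _ rfl rfl; exact e.symm_apply_apply _ }
  let ι : Fin (Nat.card B) → Option Y := fun i =>
    if h : ∃ a, e (f a) = i then some (g h.choose) else none
  have hι : ∀ i y, ι i = some y ↔ ∃ a, e (f a) = i ∧ g a = y := by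
    intro i y
    by_cases h : ∃ a, e (f a) = i
    · simp only [ι, dif_pos h, Option.some.injEq]
      constructor
      · intro h'
        exact ⟨_, h.choose_spec, h'⟩
      · rintro ⟨a, ha, rfl⟩
        have := h.choose_spec.trans ha.symm
        rw [f.injective (e.injective this)]
    · simp only [ι, dif_neg h, reduceCtorEq, false_iff]
      rintro ⟨a, ha, -⟩
      exact h ⟨a, ha⟩
  refine ⟨⟨Nat.card B, r, ι, hr, ?_⟩, e, he, hι⟩
  -- The coded partial map is the composite of the enumeration, the inverse of `f`, and `g`.
  have := (he.comp (PIso.of_embedding f).symm).comp (PIso.of_embedding g)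
  convert this using 4 with i y
  rw [hι]
  constructor
  · rintro ⟨a, rfl, rfl⟩
    exact ⟨a, ⟨_, rfl, (e.symm_apply_apply _).symm⟩, rfl⟩
  · rintro ⟨a, ⟨_, h1, h2⟩, h⟩
    exact ⟨a, e.symm_apply_eq.1 (h1.trans h2.symm) |>.symm, h⟩

/-- The piece coding the problem is glued to `Y` exactly along `g`. Its support is the range of `g`,
so the solution stays in the cut. -/
theorem step_extend {A B : Type} [selLang.Structure A] [selLang.Structure B] [Finite B]
    (hB : IsSel B) (f : A ↪[selLang] B) (g : A ↪[selLang] Y) {Z : selLang.Substructure Y}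
    (hg : ∀ a, g a ∈ Z) : ∃ h : B ↪[selLang] (stepGlue hY).Carrier,
      (∀ a, h (f a) = stepBase hY (g a)) ∧ ∀ b, h b ∈ stepCut hY Z := by
  obtain ⟨c, e, he, hι⟩ := exists_code hB f g
  have he' : PIso (N := B) (N' := Piece Y (some c)) fun b i => e b = i := by
    have := PIso.symm (N := Piece Y (some c)) he
    convert this using 4 with b i
    exact eq_comm.trans (Equiv.symm_apply_eq e).symm
  let h := ((stepGlue hY).of (some c)).comp
    (he'.toEmbedding hB (Piece.isSel hY (some c)) e)
  refine ⟨h, fun a => ?_, fun b => ?_⟩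
  · exact inj_eq_stepBase hY ((hι _ _).2 ⟨a, rfl, rfl⟩)
  · refine ⟨some c, e b, ?_, Or.inl rfl⟩
    rintro y ⟨i, hi⟩
    obtain ⟨a, -, rfl⟩ := (hι _ _).1 hi
    exact hg a

instance finite_selRaw (X : Type) [Finite X] : Finite (SelRaw X) := by
  refine Finite.of_injective (β := (X → Prop) × (X → Prop) × (X → Prop) × (X → X → Prop) ×
    (X → X → Prop) × (X → X → X)) (fun r => (r.F, r.O0, r.O1, r.E, r.R0, r.ev)) ?_
  rintro ⟨⟩ ⟨⟩ h
  simp only [Prod.mk.injEq] at h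
  obtain ⟨rfl, rfl, rfl, rfl, rfl, rfl⟩ := h
  rfl

theorem mk_sigma_nat_le {κ : Cardinal.{0}} (hκ : ℵ₀ ≤ κ) (T : ℕ → Type) (hT : ∀ m, #(T m) ≤ κ) :
    #(Σ m, T m) ≤ κ := by
  rw [Cardinal.mk_sigma]
  refine (Cardinal.sum_le_sum _ (fun _ => κ) hT).trans ?_
  rw [Cardinal.sum_const', Cardinal.mk_nat]
  exact Cardinal.mul_le_of_le hκ hκ le_rfl

/-- An element of the cut is named by an element of `Z`, or by a finite structure with a partial map
into `Z` and a point, together with a bit telling a glued element from a default one. -/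
theorem mk_stepCut_le {Z : selLang.Substructure Y} {κ : Cardinal.{0}} (hκ : ℵ₀ ≤ κ)
    (hZ : #Z ≤ κ) : #(stepCut hY Z) ≤ κ := by
  let T : Type := Z ⊕ Σ m : ℕ, SelRaw (Fin m) × (Fin m → Option Z) × Fin m
  have hT : #T ≤ κ := by
    rw [Cardinal.mk_sum, Cardinal.lift_id, Cardinal.lift_id]
    refine Cardinal.add_le_of_le hκ hZ (mk_sigma_nat_le hκ _ fun m => ?_)
    have h1 : #(SelRaw (Fin m)) ≤ κ := (Cardinal.mk_le_aleph0).trans hκ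
    have h2 : #(Fin m → Option Z) ≤ κ := by
      rw [← Cardinal.power_def, Cardinal.mk_fin, Cardinal.mk_option]
      refine (Cardinal.power_le_power_right (Cardinal.add_le_of_le hκ hZ
        (Cardinal.one_le_aleph0.trans hκ))).trans ?_
      exact Cardinal.power_nat_le hκ
    have h3 : #(Fin m) ≤ κ := (Cardinal.mk_le_aleph0).trans hκ
    rw [Cardinal.mk_prod, Cardinal.mk_prod]
    simp only [Cardinal.lift_id]
    exact Cardinal.mul_le_of_le hκ h1 (Cardinal.mul_le_of_le hκ h2 h3)
  -- A relation rather than a map, because not every name satisfies the validity conditions of a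
  -- code.
  let Rel : T → (Σ j, Piece Y j) → Prop := fun t x => match t with
    | Sum.inl z => x = ⟨none, z.1⟩
    | Sum.inr ⟨m, r, ι, b⟩ => ∃ h h', x = ⟨some ⟨m, r, fun b => (ι b).map Subtype.val, h, h'⟩, b⟩
  have hRel : ∀ t x x', Rel t x → Rel t x' → x = x' := by
    rintro (z | ⟨m, r, ι, b⟩) x x' h h'
    · exact h.trans h'.symm
    · obtain ⟨_, _, rfl⟩ := h
      obtain ⟨_, _, rfl⟩ := h'
      rfl
  have hex : ∀ (j) (x : Piece Y j), Piece.supp j x ⊆ Z → ∃ t, Rel t ⟨j, x⟩ := by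
    intro j x hx
    cases j with
    | none => exact ⟨Sum.inl ⟨x, hx rfl⟩, rfl⟩
    | some c =>
      have : ∀ b, ∃ o : Option Z, c.ι b = o.map Subtype.val := by
        intro b
        rcases h : c.ι b with _ | y
        · exact ⟨none, rfl⟩
        · exact ⟨some ⟨y, hx ⟨b, h⟩⟩, rfl⟩
      choose ι hι using this
      have hι' : c.ι = fun b => (ι b).map Subtype.val := funext hι
      have h' := c.piso
      simp only [hι'] at h'
      refine ⟨Sum.inr ⟨c.m, c.raw, ι, x⟩, c.valid, h', ?_⟩
      clear_value Rel
      obtain ⟨m, r, ι0, h, h''⟩ := c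
      dsimp only at hι' ι x h' ⊢
      subst hι'
      rfl
  have hc : ∀ d : stepCut hY Z, ∃ t : T × Bool, ∃ j x, Rel t.1 ⟨j, x⟩ ∧
      d.1 = bif t.2 then (stepGlue hY).inj j x else (stepGlue hY).dflt j x := by
    rintro ⟨d, j, x, hx, h⟩
    obtain ⟨t, ht⟩ := hex j x hx
    rcases h with rfl | rfl
    · exact ⟨(t, true), j, x, ht, rfl⟩
    · exact ⟨(t, false), j, x, ht, rfl⟩
  choose F hF using hc
  have hinj : Function.Injective F := by
    intro d d' h
    obtain ⟨j, x, h1, h2⟩ := hF d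
    obtain ⟨j', x', h1', h2'⟩ := hF d'
    rw [h] at h1 h2
    cases hRel _ _ _ h1 h1'
    exact Subtype.ext (h2.trans h2'.symm)
  refine (Cardinal.mk_le_of_injective hinj).trans ?_
  rw [Cardinal.mk_prod, Cardinal.lift_id, Cardinal.lift_id]
  exact Cardinal.mul_le_of_le hκ hT ((Cardinal.mk_le_aleph0).trans hκ)

end StepProperties

end Shredding

namespace Shredding

/-! ### The completion -/

section Completion

/-- The axioms are universal in at most three variables, so they may be checked inside embedded
models, one triple at a time. This gives the axioms in a direct limit. -/
theorem IsSel.of_local {N : Type} [selLang.Structure N]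
    (H : ∀ x y z : N, ∃ (A : Type) (_ : selLang.Structure A) (f : A ↪[selLang] N) (a b c : A),
      IsSel A ∧ f a = x ∧ f b = y ∧ f c = z) : IsSel N where
  cover x := by
    obtain ⟨A, _, f, a, b, c, h, rfl, -, -⟩ := H x x x
    simpa only [emb_F, emb_O0, emb_O1] using h.cover a
  not_F_O0 x := by
    obtain ⟨A, _, f, a, b, c, h, rfl, -, -⟩ := H x x x
    simpa only [emb_F, emb_O0, emb_O1] using h.not_F_O0 a
  not_F_O1 x := by
    obtain ⟨A, _, f, a, b, c, h, rfl, -, -⟩ := H x x x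
    simpa only [emb_F, emb_O0, emb_O1] using h.not_F_O1 a
  not_O0_O1 x := by
    obtain ⟨A, _, f, a, b, c, h, rfl, -, -⟩ := H x x x
    simpa only [emb_F, emb_O0, emb_O1] using h.not_O0_O1 a
  O_iff x := by
    obtain ⟨A, _, f, a, b, c, h, rfl, -, -⟩ := H x x x
    simpa only [emb_O, emb_O0, emb_O1] using h.O_iff a
  E_O x y := by
    obtain ⟨A, _, f, a, b, c, h, rfl, rfl, -⟩ := H x y y
    simpa only [emb_O, emb_E] using h.E_O a b
  E_refl x := by
    obtain ⟨A, _, f, a, b, c, h, rfl, -, -⟩ := H x x x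
    simpa only [emb_O, emb_E] using h.E_refl a
  E_symm x y := by
    obtain ⟨A, _, f, a, b, c, h, rfl, rfl, -⟩ := H x y y
    simpa only [emb_E] using h.E_symm a b
  E_trans x y z := by
    obtain ⟨A, _, f, a, b, c, h, rfl, rfl, rfl⟩ := H x y z
    simpa only [emb_E] using h.E_trans a b c
  ev_O0 x y := by
    obtain ⟨A, _, f, a, b, c, h, rfl, rfl, -⟩ := H x y y
    simpa only [← emb_ev, emb_F, emb_O, emb_O0] using h.ev_O0 a b
  E_ev x y := by
    obtain ⟨A, _, f, a, b, c, h, rfl, rfl, -⟩ := H x y y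
    simpa only [← emb_ev, emb_F, emb_O, emb_E] using h.E_ev a b
  ev_congr x y z := by
    obtain ⟨A, _, f, a, b, c, h, rfl, rfl, rfl⟩ := H x y z
    simpa only [← emb_ev, emb_F, emb_E, f.injective.eq_iff] using h.ev_congr a b c
  R0_sort x y := by
    obtain ⟨A, _, f, a, b, c, h, rfl, rfl, -⟩ := H x y y
    simpa only [emb_R0, emb_O0, emb_O1] using h.R0_sort a b
  R1_sort x y := by
    obtain ⟨A, _, f, a, b, c, h, rfl, rfl, -⟩ := H x y y
    simpa only [emb_R1, emb_F, emb_O1] using h.R1_sort a b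
  R0_iff_R1 x y := by
    obtain ⟨A, _, f, a, b, c, h, rfl, rfl, -⟩ := H x y y
    simpa only [← emb_ev, emb_R0, emb_R1, emb_F, emb_O1] using h.R0_iff_R1 a b
  ev_triv x y := by
    obtain ⟨A, _, f, a, b, c, h, rfl, rfl, -⟩ := H x y y
    simpa only [← emb_ev, emb_F, emb_O, f.injective.eq_iff] using h.ev_triv a b

/-- A bundled model of `T`. -/
structure SelModel where
  /-- the universe -/
  X : Type
  /-- the structure -/
  str : selLang.Structure X
  isSel : IsSel X

instance (Y : SelModel) : selLang.Structure Y.X := Y.str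

/-- The iterated completion steps. -/
noncomputable def iterStep (Y : SelModel) : ℕ → SelModel
  | 0 => Y
  | n + 1 => ⟨(stepGlue (iterStep Y n).isSel).Carrier, inferInstance,
      (stepGlue (iterStep Y n).isSel).isSel_carrier⟩

variable (Y : SelModel)

/-- The embedding of one step into the next one. -/
noncomputable def iterBase (n : ℕ) : (iterStep Y n).X ↪[selLang] (iterStep Y (n + 1)).X :=
  stepBase (iterStep Y n).isSel

/-- The cuts of the iterated steps. -/
noncomputable def iterCut (Z : selLang.Substructure Y.X) :
    ∀ n, selLang.Substructure (iterStep Y n).X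
  | 0 => Z
  | n + 1 => stepCut (iterStep Y n).isSel (iterCut Z n)

/-- The completion of a model of `T`. -/
abbrev Completion : Type :=
  Language.DirectLimit (fun n => (iterStep Y n).X) (DirectedSystem.natLERec (iterBase Y))

/-- The embeddings of the iterated steps into the completion. -/
noncomputable def ofStep (n : ℕ) : (iterStep Y n).X ↪[selLang] Completion Y :=
  Language.DirectLimit.of selLang ℕ (fun n => (iterStep Y n).X)
    (DirectedSystem.natLERec (iterBase Y)) n

theorem ofStep_base (n : ℕ) (x : (iterStep Y n).X) :
    ofStep Y (n + 1) (iterBase Y n x) = ofStep Y n x := by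
  have := Language.DirectLimit.of_f (L := selLang) (G := fun n => (iterStep Y n).X)
    (f := DirectedSystem.natLERec (iterBase Y)) (hij := Nat.le_succ n) (x := x)
  have h : DirectedSystem.natLERec (iterBase Y) n (n + 1) (Nat.le_succ n) x = iterBase Y n x := by
    rw [DirectedSystem.coe_natLERec]
    exact Nat.leRecOn_succ' (C := fun n => (iterStep Y n).X) (next := fun {k} => iterBase Y k) x
  exact (congrArg _ h.symm).trans this

variable {Y}

theorem iterCut_mono {Z W : selLang.Substructure Y.X} (h : Z ≤ W) (n : ℕ) :
    iterCut Y Z n ≤ iterCut Y W n := by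
  induction n with
  | zero => exact h
  | succ n ih => exact stepCut_mono _ ih

theorem exists_lift_iterCut {Z : selLang.Substructure Y.X} {n m : ℕ} (h : n ≤ m)
    {x : (iterStep Y n).X} (hx : x ∈ iterCut Y Z n) :
    ∃ x' ∈ iterCut Y Z m, ofStep Y m x' = ofStep Y n x := by
  induction m, h using Nat.le_induction with
  | base => exact ⟨x, hx, rfl⟩
  | succ m _ ih =>
    obtain ⟨x', hx', e⟩ := ih
    exact ⟨iterBase Y m x', (stepBase_mem_stepCut _).2 hx', (ofStep_base Y m x').trans e⟩

/-- A later step adds no old element to a cut. Membership in the limit of the cuts can therefore be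
tested at any stage where the element exists. -/
theorem base_mem_iterCut {Z : selLang.Substructure Y.X} {n : ℕ} {x : (iterStep Y n).X}
    (k : ℕ) {x' : (iterStep Y (n + k)).X} (h : ofStep Y (n + k) x' = ofStep Y n x) :
    x' ∈ iterCut Y Z (n + k) ↔ x ∈ iterCut Y Z n := by
  induction k with
  | zero => rw [(ofStep Y n).injective h]; rfl
  | succ k ih =>
    obtain ⟨w, hw⟩ : ∃ w, ofStep Y (n + k) w = ofStep Y n x := by
      clear ih h x'
      induction k with
      | zero => exact ⟨x, rfl⟩
      | succ k ih =>
        obtain ⟨w, hw⟩ := ih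
        exact ⟨iterBase Y _ w, (ofStep_base Y _ w).trans hw⟩
    have : x' = iterBase Y (n + k) w :=
      (ofStep Y (n + k + 1)).injective (h.trans (hw.symm.trans (ofStep_base Y _ w).symm))
    rw [← ih hw, this]
    exact stepBase_mem_stepCut _

theorem ofStep_mem_iff {Z : selLang.Substructure Y.X} {n m : ℕ} {x : (iterStep Y n).X}
    {x' : (iterStep Y m).X} (h : ofStep Y m x' = ofStep Y n x) :
    x' ∈ iterCut Y Z m ↔ x ∈ iterCut Y Z n := by
  rcases le_total n m with hnm | hnm
  · obtain ⟨k, rfl⟩ := Nat.exists_eq_add_of_le hnm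
    exact base_mem_iterCut k h
  · obtain ⟨k, rfl⟩ := Nat.exists_eq_add_of_le hnm
    exact (base_mem_iterCut k h.symm).symm

theorem exists_ofStep_mem (d : Completion Y) : ∃ n x, ofStep Y n x = d :=
  Language.DirectLimit.exists_of (L := selLang) (G := fun n => (iterStep Y n).X)
    (f := DirectedSystem.natLERec (iterBase Y)) d

theorem iterCut_top (n : ℕ) (x : (iterStep Y n).X) : x ∈ iterCut Y ⊤ n := by
  cases n with
  | zero => trivial
  | succ n =>
    have : iterCut Y ⊤ n = ⊤ := top_le_iff.1 fun x _ => iterCut_top n x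
    obtain ⟨j, y, h⟩ := (stepGlue (iterStep Y n).isSel).cases_carrier x
    refine ⟨j, y, ?_, h⟩
    rw [this]
    exact fun _ _ => trivial

theorem ev_mem_limit {Z : selLang.Substructure Y.X} :
    ∀ d ∈ {d | ∃ n, ∃ x ∈ iterCut Y Z n, ofStep Y n x = d},
    ∀ d' ∈ {d | ∃ n, ∃ x ∈ iterCut Y Z n, ofStep Y n x = d},
      ev d d' ∈ {d | ∃ n, ∃ x ∈ iterCut Y Z n, ofStep Y n x = d} := by
  rintro _ ⟨n, x, hx, rfl⟩ _ ⟨m, y, hy, rfl⟩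
  obtain ⟨x', hx', h⟩ := exists_lift_iterCut (le_max_left n m) hx
  obtain ⟨y', hy', h'⟩ := exists_lift_iterCut (le_max_right n m) hy
  exact ⟨max n m, ev x' y', ev_mem _ hx' hy', by rw [emb_ev, h, h']⟩

/-- The completion of a substructure, inside the completion. -/
noncomputable def limitCut (Z : selLang.Substructure Y.X) : selLang.Substructure (Completion Y) :=
  selSub {d | ∃ n, ∃ x ∈ iterCut Y Z n, ofStep Y n x = d} ev_mem_limit

theorem mem_limitCut {Z : selLang.Substructure Y.X} {d : Completion Y} :
    d ∈ limitCut Z ↔ ∃ n, ∃ x ∈ iterCut Y Z n, ofStep Y n x = d := Iff.rfl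

theorem ofStep_mem_limitCut {Z : selLang.Substructure Y.X} {n : ℕ} {x : (iterStep Y n).X} :
    ofStep Y n x ∈ limitCut Z ↔ x ∈ iterCut Y Z n := by
  refine ⟨?_, fun h => ⟨n, x, h, rfl⟩⟩
  rintro ⟨m, x', hx', h⟩
  exact (ofStep_mem_iff h).1 hx'

theorem isSel_completion : IsSel (Completion Y) := by
  refine IsSel.of_local fun x y z => ?_
  obtain ⟨n, x, rfl⟩ := exists_ofStep_mem x
  obtain ⟨m, y, rfl⟩ := exists_ofStep_mem y
  obtain ⟨k, z, rfl⟩ := exists_ofStep_mem z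
  obtain ⟨a, -, ha⟩ := exists_lift_iterCut (m := max n (max m k)) (by omega) (iterCut_top n x)
  obtain ⟨b, -, hb⟩ := exists_lift_iterCut (m := max n (max m k)) (by omega) (iterCut_top m y)
  obtain ⟨c, -, hc⟩ := exists_lift_iterCut (m := max n (max m k)) (by omega) (iterCut_top k z)
  exact ⟨_, inferInstance, ofStep Y _, a, b, c, (iterStep Y _).isSel, ha, hb, hc⟩

/-- A finite problem over the limit already lives at some finite stage, inside the cut there, and
the next stage solves it inside its own cut. -/
theorem ec_limitCut (Z : selLang.Substructure Y.X) : EC (limitCut Z) where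
  isSel := isSel_completion.substructure _
  extend := by
    intro A B _ _ _ hB f g
    have : Finite A := Finite.of_injective f f.injective
    have hg : ∀ a, ∃ n, ∃ x ∈ iterCut Y Z n, ofStep Y n x = (g a : Completion Y) :=
      fun a => mem_limitCut.1 (g a).2
    choose n x hx hn using hg
    obtain ⟨N, hN⟩ := Finite.exists_le n
    choose g' hg' e using fun a => exists_lift_iterCut (hN a) (hx a)
    have e' : ∀ a, ofStep Y N (g' a) = (g a : Completion Y) := fun a => (e a).trans (hn a)
    have hp : PIso fun a y => g' a = y := by
      have := (PIso.of_embedding ((limitCut Z).subtype.comp g)).comp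
        (PIso.of_embedding (ofStep Y N)).symm
      convert this using 4 with a y
      constructor
      · rintro rfl
        exact ⟨_, rfl, e' a⟩
      · rintro ⟨w, rfl, h⟩
        exact (ofStep Y N).injective ((e' a).trans h.symm)
    obtain ⟨h, h1, h2⟩ := step_extend (iterStep Y N).isSel hB f
      (hp.toEmbedding (IsSel.of_embedding f hB) (iterStep Y N).isSel g') (Z := iterCut Y Z N) hg'
    let h' : B ↪[selLang] Completion Y := (ofStep Y (N + 1)).comp h
    refine ⟨h'.codRestrict (limitCut Z) fun b => ⟨N + 1, h b, h2 b, rfl⟩, fun a => ?_⟩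
    refine Subtype.ext ?_
    change ofStep Y (N + 1) (h (f a)) = g a
    rw [h1]
    exact (ofStep_base Y N _).trans (e' a)

theorem exists_mem_iterCut {ι : Type*} [LinearOrder ι] [Nonempty ι]
    {Z : ι → selLang.Substructure Y.X} (hZ : Monotone Z) {W : selLang.Substructure Y.X}
    (hW : ∀ y ∈ W, ∃ i, y ∈ Z i) (n : ℕ) :
    ∀ d ∈ iterCut Y W n, ∃ i, d ∈ iterCut Y (Z i) n := by
  induction n with
  | zero => exact hW
  | succ n ih =>
    intro d hd
    exact exists_mem_stepCut (iterStep Y n).isSel (Z := fun i => iterCut Y (Z i) n)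
      (fun i j h => iterCut_mono (hZ h) n) ih hd

theorem avoids_iterCut {Z : selLang.Substructure Y.X} {b : Y.X} (hb : IsO1 b)
    (h : Avoids (Z : Set Y.X) b) (n : ℕ) : ∃ b' : (iterStep Y n).X, IsO1 b' ∧
      ofStep Y n b' = ofStep Y 0 b ∧ Avoids (iterCut Y Z n : Set (iterStep Y n).X) b' := by
  induction n with
  | zero => exact ⟨b, hb, rfl, h⟩
  | succ n ih =>
    obtain ⟨b', h1, h2, h3⟩ := ih
    exact ⟨iterBase Y n b', (emb_O1 _ _).2 h1, (ofStep_base Y n b').trans h2,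
      avoids_stepCut _ h1 h3⟩

theorem avoids_limitCut {Z : selLang.Substructure Y.X} {b : Y.X} (hb : IsO1 b)
    (h : Avoids (Z : Set Y.X) b) :
    Avoids (limitCut Z : Set (Completion Y)) (ofStep Y 0 b) := by
  rintro _ ⟨n, x, hx, rfl⟩
  obtain ⟨b', -, h2, h3⟩ := avoids_iterCut hb h n
  rw [← h2, emb_E, emb_R0, emb_R1]
  exact h3 x hx

theorem mk_iterCut_le {Z : selLang.Substructure Y.X} {κ : Cardinal.{0}} (hκ : ℵ₀ ≤ κ)
    (hZ : #Z ≤ κ) (n : ℕ) : #(iterCut Y Z n) ≤ κ := by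
  induction n with
  | zero => exact hZ
  | succ n ih => exact mk_stepCut_le _ hκ ih

theorem mk_limitCut_le {Z : selLang.Substructure Y.X} {κ : Cardinal.{0}} (hκ : ℵ₀ ≤ κ)
    (hZ : #Z ≤ κ) : #(limitCut Z) ≤ κ := by
  have : ∀ d : limitCut Z, ∃ t : Σ n, iterCut Y Z n, ofStep Y t.1 t.2.1 = d.1 := by
    rintro ⟨d, n, x, hx, h⟩
    exact ⟨⟨n, x, hx⟩, h⟩
  choose F hF using this
  refine (Cardinal.mk_le_of_injective (f := F) fun d d' h => ?_).trans
    (mk_sigma_nat_le hκ _ (mk_iterCut_le hκ hZ))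
  refine Subtype.ext ?_
  rw [← hF d, ← hF d', h]

/-- Every model `Y` of `T` has an extension in which each substructure of `Y` generates, in a
monotone, continuous and cardinality preserving way, an existentially closed model. -/
theorem exists_completion (Y : Type) [selLang.Structure Y] (hY : IsSel Y) :
    ∃ (G : Type) (_ : selLang.Structure G) (e : Y ↪[selLang] G)
      (H : selLang.Substructure Y → selLang.Substructure G),
      (∀ Z, EC (H Z)) ∧ Monotone H ∧ (∀ Z y, e y ∈ H Z ↔ y ∈ Z) ∧
      (∀ (ι : Type 1) [LinearOrder ι] [Nonempty ι] (Z : ι → selLang.Substructure Y), Monotone Z →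
        ∀ W : selLang.Substructure Y, (∀ y ∈ W, ∃ i, y ∈ Z i) → ∀ d ∈ H W, ∃ i, d ∈ H (Z i)) ∧
      (∀ (Z : selLang.Substructure Y) (b : Y), IsO1 b → Avoids (Z : Set Y) b →
        Avoids (H Z : Set G) (e b)) ∧
      ∀ (Z : selLang.Substructure Y) (κ : Cardinal.{0}), ℵ₀ ≤ κ → #Z ≤ κ → #(H Z) ≤ κ := by
  let Y' : SelModel := ⟨Y, inferInstance, hY⟩
  refine ⟨Completion Y', inferInstance, ofStep Y' 0, limitCut (Y := Y'),
    ec_limitCut (Y := Y'), ?_, ?_, ?_, ?_, ?_⟩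
  · rintro Z W h _ ⟨n, x, hx, rfl⟩
    exact ⟨n, x, iterCut_mono h n hx, rfl⟩
  · exact fun Z y => ofStep_mem_limitCut (n := 0)
  · rintro ι _ _ Z hZ W hW _ ⟨n, x, hx, rfl⟩
    obtain ⟨i, hi⟩ := exists_mem_iterCut (Y := Y') hZ hW n x hx
    exact ⟨i, n, x, hi, rfl⟩
  · exact fun Z b => avoids_limitCut (Y := Y')
  · exact fun Z κ hκ hZ => mk_limitCut_le hκ hZ

/-- Every model of `T` embeds into an existentially closed one, of the same cardinality if
infinite. -/
theorem exists_ec (Y : Type) [selLang.Structure Y] (hY : IsSel Y) {κ : Cardinal.{0}} (hκ : ℵ₀ ≤ κ)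
    (h : #Y ≤ κ) : ∃ (G : Type) (_ : selLang.Structure G), EC G ∧ #G ≤ κ ∧
      Nonempty (Y ↪[selLang] G) := by
  obtain ⟨G, _, e, H, h1, -, h3, -, -, h6⟩ := exists_completion Y hY
  refine ⟨H ⊤, inferInstance, h1 _, h6 _ κ hκ ((Cardinal.mk_subtype_le _).trans h), ⟨?_⟩⟩
  exact e.codRestrict (H ⊤) fun y => (h3 _ _).2 trivial

end Completion

end Shredding

namespace Shredding

/-! ### The Fraïssé limit and its theory -/

section Limit

/-- The empty model of `T`. -/
def emptyRaw : SelRaw Empty :=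
  ⟨Empty.elim, Empty.elim, Empty.elim, Empty.elim, Empty.elim, Empty.elim⟩

instance : selLang.Structure Empty := emptyRaw.toStructure

theorem isSel_empty : IsSel Empty := by
  have : emptyRaw.Valid := by constructor <;> exact fun x => x.elim
  exact this.isSel

/-- The model of `T` consisting of one element of `F`. -/
def pointRaw : SelRaw Unit :=
  ⟨fun _ => True, fun _ => False, fun _ => False, fun _ _ => False, fun _ _ => False, fun x _ => x⟩

theorem pointRaw_valid : pointRaw.Valid := by constructor <;> simp [pointRaw]

theorem piso_empty (N N' : Type) [selLang.Structure N] [selLang.Structure N'] :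
    PIso fun (_ : N) (_ : N') => False := by
  constructor <;> exact fun h => h.elim

/-- The embedding of the empty model. -/
def emptyEmb {N : Type} [selLang.Structure N] (hN : IsSel N) : Empty ↪[selLang] N :=
  PIso.toEmbedding isSel_empty hN (fun x => x.elim) (by constructor <;> exact fun {x} => x.elim)

theorem EC.exists_embedding {N : Type} [selLang.Structure N] (hN : EC N) {B : Type}
    [selLang.Structure B] [Finite B] (hB : IsSel B) : Nonempty (B ↪[selLang] N) := by
  obtain ⟨h, -⟩ := hN.extend Empty B hB (emptyEmb hB) (emptyEmb hN.isSel)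
  exact ⟨h⟩

theorem EC.nonempty {N : Type} [selLang.Structure N] (hN : EC N) : Nonempty N := by
  let := pointRaw.toStructure
  obtain ⟨h⟩ := hN.exists_embedding pointRaw_valid.isSel
  exact ⟨h ()⟩

theorem IsSel.finite_of_fg {N : Type} [selLang.Structure N] (hN : IsSel N)
    (h : Structure.FG selLang N) : Finite N := by
  obtain ⟨s, hs, h⟩ := Structure.fg_iff.1 h
  have := hN.finite_closure hs
  rw [h] at this
  exact Finite.of_injective (fun x : N => (⟨x, trivial⟩ : (⊤ : selLang.Substructure N)))
    fun x y h => congrArg Subtype.val h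

/-- Finitely generated means finite here, and every finite model embeds as an extension of the empty
one. For countable structures ultrahomogeneity reduces to adding one point to the domain of a finite
partial map, which is an instance of `EC.extend`. -/
theorem EC.isFraisseLimit {N : Type} [selLang.Structure N] [Countable N] (hN : EC N) :
    IsFraisseLimit selClass N where
  age := by
    ext ⟨A, sA⟩
    constructor
    · rintro ⟨h, ⟨f⟩⟩
      have hA : IsSel A := IsSel.of_embedding f hN.isSel
      exact ⟨hA.finite_of_fg h, (models_selTheory_iff A).2 hA⟩
    · rintro ⟨h, h'⟩
      have hA : IsSel A := (models_selTheory_iff A).1 h'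
      have : Finite A := h
      exact ⟨Structure.fg_iff.2 ⟨Set.univ, Set.finite_univ, Substructure.closure_univ⟩,
        hN.exists_embedding hA⟩
  ultrahomogeneous := by
    rw [isUltrahomogeneous_iff_IsExtensionPair Structure.cg_of_countable,
      isExtensionPair_iff_exists_embedding_closure_singleton_sup]
    intro S hS f m
    have hfg : (Substructure.closure selLang {m} ⊔ S).FG :=
      (Substructure.fg_closure_singleton m).sup hS
    have hsel := hN.isSel.substructure (Substructure.closure selLang {m} ⊔ S)
    have := hsel.finite_of_fg ((Substructure.fg_iff_structure_fg _).1 hfg)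
    obtain ⟨g, hg⟩ := hN.extend S _ hsel (Substructure.inclusion le_sup_right) f
    exact ⟨g, by ext x; exact (hg x).symm⟩

/-! ### First-order axioms for existential closedness -/

section Diagram

open Classical in
/-- The formula `φ` or its negation, according to the truth value of `P`. -/
noncomputable def literal {α : Type} (P : Prop) (φ : selLang.Formula α) : selLang.Formula α :=
  if P then φ else ∼φ

theorem realize_literal {α N : Type} [selLang.Structure N] (P : Prop) (φ : selLang.Formula α)
    (v : α → N) : (literal P φ).Realize v ↔ (P ↔ φ.Realize v) := by
  unfold literal
  split_ifs with h
  · simp [h]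
  · simp [h, Formula.realize_not]

section

variable {α N : Type} [selLang.Structure N] {v : α → N} (t u : selLang.Term α)

theorem realize_formula_F : (Relations.formula₁ (L := selLang) SelRelations.F t).Realize v ↔
    IsF (t.realize v) := Formula.realize_rel₁

theorem realize_formula_O0 : (Relations.formula₁ (L := selLang) SelRelations.O0 t).Realize v ↔
    IsO0 (t.realize v) := Formula.realize_rel₁

theorem realize_formula_O1 : (Relations.formula₁ (L := selLang) SelRelations.O1 t).Realize v ↔
    IsO1 (t.realize v) := Formula.realize_rel₁

theorem realize_formula_E : (Relations.formula₂ (L := selLang) SelRelations.E t u).Realize v ↔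
    RelE (t.realize v) (u.realize v) := Formula.realize_rel₂

theorem realize_formula_R0 : (Relations.formula₂ (L := selLang) SelRelations.R0 t u).Realize v ↔
    Rel0 (t.realize v) (u.realize v) := Formula.realize_rel₂

theorem realize_term_eval : (Functions.apply₂ (L := selLang) SelFunctions.eval t u).realize v =
    ev (t.realize v) (u.realize v) := Term.realize_functions_apply₂

end

variable (A : Type) [selLang.Structure A] [Finite A]

/-- The quantifier free diagram of a finite structure. -/
noncomputable def diag : selLang.Formula A :=
  Formula.iInf (fun a : A =>
      literal (IsF a) (Relations.formula₁ (L := selLang) SelRelations.F (Term.var a)) ⊓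
      (literal (IsO0 a) (Relations.formula₁ (L := selLang) SelRelations.O0 (Term.var a)) ⊓
      literal (IsO1 a) (Relations.formula₁ (L := selLang) SelRelations.O1 (Term.var a)))) ⊓
  Formula.iInf (fun p : A × A =>
      literal (p.1 = p.2) (Term.equal (Term.var p.1) (Term.var p.2)) ⊓
      (literal (RelE p.1 p.2)
        (Relations.formula₂ (L := selLang) SelRelations.E (Term.var p.1) (Term.var p.2)) ⊓
      (literal (Rel0 p.1 p.2)
        (Relations.formula₂ (L := selLang) SelRelations.R0 (Term.var p.1) (Term.var p.2)) ⊓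
      Term.equal (Functions.apply₂ (L := selLang) SelFunctions.eval (Term.var p.1) (Term.var p.2))
        (Term.var (ev p.1 p.2)))))

theorem realize_diag {N : Type} [selLang.Structure N] (v : A → N) :
    (diag A).Realize v ↔ PIso fun a x => v a = x := by
  simp only [diag, Formula.realize_inf, Formula.realize_iInf, realize_literal,
    realize_formula_F, realize_formula_O0, realize_formula_O1, realize_formula_E,
    realize_formula_R0, realize_term_eval, Formula.realize_equal, Term.realize_var, Prod.forall]
  constructor
  · rintro ⟨h1, h2⟩
    exact
      { F := by rintro a _ rfl; exact (h1 a).1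
        O0 := by rintro a _ rfl; exact (h1 a).2.1
        O1 := by rintro a _ rfl; exact (h1 a).2.2
        eq := by rintro a _ b _ rfl rfl; exact (h2 a b).1
        E := by rintro a _ b _ rfl rfl; exact (h2 a b).2.1
        R0 := by rintro a _ b _ rfl rfl; exact (h2 a b).2.2.1
        ev := by rintro a _ b _ rfl rfl; exact (h2 a b).2.2.2.symm }
  · intro h
    exact ⟨fun a => ⟨h.F rfl, h.O0 rfl, h.O1 rfl⟩,
      fun a b => ⟨h.eq rfl rfl, h.E rfl rfl, h.R0 rfl rfl, (h.ev rfl rfl).symm⟩⟩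

variable {A} {B : Type} [selLang.Structure B] [Finite B]

/-- The sentence saying that every copy of `A` extends along `f` to a copy of `B`. -/
noncomputable def extSentence (f : A → B) : selLang.Sentence :=
  Formula.iAlls A (((diag A).relabel Sum.inr : selLang.Formula (Empty ⊕ A)).imp
    (Formula.iExs B (((diag B).relabel Sum.inr : selLang.Formula ((Empty ⊕ A) ⊕ B)) ⊓
      Formula.iInf fun a : A => Term.equal (Term.var (Sum.inr (f a)))
        (Term.var (Sum.inl (Sum.inr a))))))

theorem realize_extSentence {N : Type} [selLang.Structure N] (f : A → B) :
    N ⊨ extSentence f ↔ ∀ v : A → N, (PIso fun a x => v a = x) →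
      ∃ w : B → N, (PIso fun b x => w b = x) ∧ ∀ a, w (f a) = v a := by
  simp only [Sentence.Realize, extSentence, Formula.realize_iAlls, Formula.realize_imp,
    Formula.realize_relabel, Formula.realize_iExs, Formula.realize_inf, Formula.realize_iInf,
    Formula.realize_equal, Term.realize_var, Sum.elim_inr, Sum.elim_inl, Sum.elim_comp_inr,
    realize_diag]

end Diagram

/-- Existential closedness is axiomatized by `T` and the sentences `extSentence`, since a finite
structure has a single formula as its diagram. -/
theorem EC.of_completeTheory {M N : Type} [selLang.Structure M] [selLang.Structure N] (hM : EC M)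
    (h : ∀ φ : selLang.Sentence, M ⊨ φ → N ⊨ φ) : EC N := by
  have hN : IsSel N := by
    rw [← models_selTheory_iff, Theory.model_iff]
    have := (models_selTheory_iff M).2 hM.isSel
    exact fun φ hφ => h φ (Theory.realize_sentence_of_mem selTheory hφ)
  refine ⟨hN, ?_⟩
  intro A B _ _ _ hB f g
  have : Finite A := Finite.of_injective f f.injective
  have hA : IsSel A := IsSel.of_embedding f hB
  have key : N ⊨ extSentence f := by
    refine h _ ((realize_extSentence f).2 fun v hv => ?_)
    obtain ⟨k, hk⟩ := hM.extend A B hB f (hv.toEmbedding hA hM.isSel v)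
    exact ⟨k, PIso.of_embedding k, hk⟩
  obtain ⟨w, hw, e⟩ := (realize_extSentence f).1 key g (PIso.of_embedding g)
  exact ⟨hw.toEmbedding hB hN w, e⟩

/-- The empty relation is a partial isomorphism, and a sentence has no free variables to match. -/
theorem EC.realize_sentence {M N : Type} [selLang.Structure M] [selLang.Structure N] (hM : EC M)
    (hN : EC N) (φ : selLang.Sentence) : M ⊨ φ ↔ N ⊨ φ :=
  hM.realize_iff hN (piso_empty M N) φ _ _ fun a => a.elim

theorem exists_countable_ec : ∃ (M : Type) (_ : selLang.Structure M), Countable M ∧ EC M := by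
  obtain ⟨M, _, h, h', -⟩ := exists_ec Empty isSel_empty le_rfl
    (Cardinal.mk_le_aleph0 (α := Empty))
  exact ⟨M, inferInstance, Cardinal.mk_le_aleph0_iff.1 h', h⟩

theorem selTheoryStar_eq {M : Type} [selLang.Structure M] (hM : EC M) :
    selTheoryStar = selLang.completeTheory M := by
  obtain ⟨M₀, _, _, h₀⟩ := exists_countable_ec
  ext φ
  constructor
  · exact fun h => (hM.realize_sentence h₀ φ).2 (h M₀ h₀.isFraisseLimit)
  · intro h N _ _ hN
    obtain ⟨e⟩ := hN.nonempty_equiv h₀.isFraisseLimit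
    exact (StrongHomClass.realize_sentence e φ).2 ((hM.realize_sentence h₀ φ).1 h)

/-- The models of `T*` are the existentially closed models of `T`. -/
theorem models_selTheoryStar_iff {N : Type} [selLang.Structure N] :
    N ⊨ selTheoryStar ↔ EC N := by
  obtain ⟨M₀, _, _, h₀⟩ := exists_countable_ec
  constructor
  · intro h
    refine h₀.of_completeTheory fun φ hφ => Theory.realize_sentence_of_mem selTheoryStar ?_
    rw [selTheoryStar_eq h₀]
    exact hφ
  · intro h
    rw [selTheoryStar_eq h, Theory.model_iff]
    exact fun _ h => h

theorem ec_modelType (N : Theory.ModelType.{0, 0, 0} selTheoryStar) : EC N :=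
  models_selTheoryStar_iff.1 N.is_model

/-- An existentially closed model of `T` as a bundled model of `T*`. -/
def EC.toModelType {N : Type} [selLang.Structure N] (hN : EC N) :
    Theory.ModelType.{0, 0, 0} selTheoryStar :=
  haveI := hN.nonempty
  haveI := models_selTheoryStar_iff.2 hN
  Theory.ModelType.of selTheoryStar N

theorem isComplete_selTheoryStar : selTheoryStar.IsComplete := by
  obtain ⟨M, _, _, h⟩ := exists_countable_ec
  have := h.nonempty
  rw [selTheoryStar_eq h]
  exact completeTheory.isMaximal selLang M |>.isComplete

theorem categorical_selTheoryStar : Cardinal.Categorical (ℵ₀ : Cardinal.{0}) selTheoryStar := by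
  intro M N hM hN
  have : Countable M := Cardinal.mk_le_aleph0_iff.1 hM.le
  have : Countable N := Cardinal.mk_le_aleph0_iff.1 hN.le
  exact (ec_modelType M).isFraisseLimit.nonempty_equiv (ec_modelType N).isFraisseLimit

end Limit

end Shredding

namespace Shredding

/-! ### Free amalgamation of copies of a model -/

section Amalgam

variable {N : Type} [selLang.Structure N]

/-- Identifications of parts of copies, indexed by `J`, of a model, such that the parts of three
different copies meet only in a common base `S`. -/
structure Coherent {J : Type} (S : Set N) (I : J → J → N → N → Prop) : Prop where
  refl : ∀ {j x y}, I j j x y ↔ x = y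
  symm : ∀ {j k x y}, I j k x y → I k j y x
  piso : ∀ j k, PIso (I j k)
  base : ∀ j k, ∀ m ∈ S, I j k m m
  center : ∀ {j k l x y z}, j ≠ k → k ≠ l → j ≠ l → I j k x y → I k l y z → y ∈ S
  centerE : ∀ {j k l x y y' z}, j ≠ k → k ≠ l → j ≠ l → I j k x y → RelE y y' → I k l y' z →
    ∃ m ∈ S, RelE y m

namespace Coherent

variable {J : Type} {S : Set N} {I : J → J → N → N → Prop} (h : Coherent S I)

include h

/-- If two of the copies coincide, the identifications are identities or mutually inverse. For three
different copies the middle point lies in the base, where all identifications are the identity. -/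
theorem trans {j k l : J} {x y z : N} (h1 : I j k x y) (h2 : I k l y z) : I j l x z := by
  by_cases hjk : j = k
  · subst hjk
    obtain rfl := h.refl.1 h1
    exact h2
  by_cases hkl : k = l
  · subst hkl
    obtain rfl := h.refl.1 h2
    exact h1
  by_cases hjl : j = l
  · subst hjl
    exact h.refl.2 (((h.piso j k).eq h1 (h.symm h2)).2 rfl)
  have hy := h.center hjk hkl hjl h1 h2
  obtain rfl := ((h.piso j k).eq h1 (h.base j k y hy)).2 rfl
  obtain rfl := ((h.piso k l).eq h2 (h.base k l x hy)).1 rfl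
  exact h.base j l z hy

theorem trans_E (hN : IsSel N) {j k l : J} {x y y' z : N} (h1 : I j k x y) (hy : RelE y y')
    (h2 : I k l y' z) : ∃ x₁ z₁, RelE x x₁ ∧ I j l x₁ z₁ ∧ RelE z₁ z := by
  have hxO : RelE x x := ((h.piso j k).E h1 h1).2 (hN.E_trans _ _ _ hy (hN.E_symm _ _ hy))
  have hzO : RelE z z := ((h.piso k l).E h2 h2).1 (hN.E_trans _ _ _ (hN.E_symm _ _ hy) hy)
  by_cases hjk : j = k
  · subst hjk
    obtain rfl := h.refl.1 h1
    exact ⟨y', z, hy, h2, hzO⟩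
  by_cases hkl : k = l
  · subst hkl
    obtain rfl := h.refl.1 h2
    exact ⟨x, y, hxO, h1, hy⟩
  by_cases hjl : j = l
  · subst hjl
    exact ⟨z, z, ((h.piso j k).E h1 (h.symm h2)).2 hy, h.refl.2 rfl, hzO⟩
  obtain ⟨m, hm, hym⟩ := h.centerE hjk hkl hjl h1 hy h2
  exact ⟨m, m, ((h.piso j k).E h1 (h.base j k m hm)).2 hym, h.base j l m hm,
    ((h.piso k l).E (h.base k l m hm) h2).1 (hN.E_trans _ _ _ (hN.E_symm _ _ hym) hy)⟩

/-- The gluing data of coherent identifications. -/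
def glueData (hN : IsSel N) : GlueData fun _ : J => N where
  R p q := I p.1 q.1 p.2 q.2
  Rc p q := ∃ x y, RelE p.2 x ∧ I p.1 q.1 x y ∧ RelE y q.2
  isSel _ := hN
  R_refl _ := h.refl.2 rfl
  R_symm h' := h.symm h'
  R_trans := h.trans
  R_inj h' := h.refl.1 h'
  Rc_symm := by
    rintro p q ⟨x, y, h1, h2, h3⟩
    exact ⟨y, x, hN.E_symm _ _ h3, h.symm h2, hN.E_symm _ _ h1⟩
  Rc_trans := by
    rintro p q r ⟨x, y, h1, h2, h3⟩ ⟨y', z, h4, h5, h6⟩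
    obtain ⟨x₁, z₁, h7, h8, h9⟩ := h.trans_E hN h2 (hN.E_trans _ _ _ h3 h4) h5
    exact ⟨x₁, z₁, hN.E_trans _ _ _ h1 h7, h8, hN.E_trans _ _ _ h9 h6⟩
  Rc_iff := by
    intro j x y
    constructor
    · rintro ⟨x', y', h1, h2, h3⟩
      obtain rfl := h.refl.1 h2
      exact hN.E_trans _ _ _ h1 h3
    · intro h'
      exact ⟨x, x, hN.E_trans _ _ _ h' (hN.E_symm _ _ h'), h.refl.2 rfl, h'⟩
  Rc_of_R := by
    intro j k x y hxy hx
    exact ⟨x, y, hN.E_refl x hx, hxy, hN.E_refl y (((h.piso j k).O hN hN hxy).1 hx)⟩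
  F h' := ((h.piso _ _).F h').1
  O0 h' := ((h.piso _ _).O0 h').1
  O1 h' := ((h.piso _ _).O1 h').1
  ev := by
    rintro j k x x' y y' hxy hx ⟨x₁, y₁, h1, h2, h3⟩
    have := (h.piso j k).ev hxy h2
    rw [← hN.ev_congr x x' x₁ hx h1,
      hN.ev_congr y y₁ y' (((h.piso j k).F hxy).1 hx) h3] at this
    exact this
  R0 h1 h2 := ((h.piso _ _).R0 h1 h2).1

/-- The amalgam identifies no more than prescribed, for elements and for classes alike. This
exactness is what yields independence in the amalgam. -/
theorem exists_amalgam (hN : IsSel N) : ∃ (N' : Type) (_ : selLang.Structure N')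
    (g : J → N ↪[selLang] N'),
    EC N' ∧ (∀ j k x y, g j x = g k y ↔ I j k x y) ∧
    ∀ j k x y, RelE (g j x) (g k y) ↔ ∃ x₁ y₁, RelE x x₁ ∧ I j k x₁ y₁ ∧ RelE y₁ y := by
  let G := h.glueData hN
  obtain ⟨N', _, hN', -, ⟨f⟩⟩ := exists_ec G.Carrier G.isSel_carrier
    (κ := max ℵ₀ #G.Carrier) (le_max_left _ _) (le_max_right _ _)
  refine ⟨N', inferInstance, fun j => f.comp (G.of j), hN', fun j k x y => ?_, fun j k x y => ?_⟩
  · exact f.injective.eq_iff.trans G.inj_eq_iff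
  · exact (emb_E f _ _).trans G.E_inj

end Coherent

/-- Three copies of a model, glued along partial isomorphisms. -/
def tripleRel (I₀₁ I₀₂ I₁₂ : N → N → Prop) : Fin 3 → Fin 3 → N → N → Prop :=
  ![![Eq, I₀₁, I₀₂], ![flip I₀₁, Eq, I₁₂], ![flip I₀₂, flip I₁₂, Eq] ]

theorem piso_eq : PIso fun x y : N => x = y where
  F := by rintro x _ rfl; rfl
  O0 := by rintro x _ rfl; rfl
  O1 := by rintro x _ rfl; rfl
  eq := by rintro x _ x' _ rfl rfl; rfl
  E := by rintro x _ x' _ rfl rfl; rfl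
  R0 := by rintro x _ x' _ rfl rfl; rfl
  ev := by rintro x _ x' _ rfl rfl; rfl

/-- The identity of a substructure. -/
theorem piso_diag (S : selLang.Substructure N) : PIso fun x y : N => x = y ∧ x ∈ S where
  F := by rintro x _ ⟨rfl, -⟩; rfl
  O0 := by rintro x _ ⟨rfl, -⟩; rfl
  O1 := by rintro x _ ⟨rfl, -⟩; rfl
  eq := by rintro x _ x' _ ⟨rfl, -⟩ ⟨rfl, -⟩; rfl
  E := by rintro x _ x' _ ⟨rfl, -⟩ ⟨rfl, -⟩; rfl
  R0 := by rintro x _ x' _ ⟨rfl, -⟩ ⟨rfl, -⟩; rfl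
  ev := by rintro x _ x' _ ⟨rfl, hx⟩ ⟨rfl, hx'⟩; exact ⟨rfl, ev_mem S hx hx'⟩

/-- One condition on elements and one on classes for each possible middle copy; the opposite orders
of the outer copies follow by symmetry. -/
theorem coherent_tripleRel (hN : IsSel N) {S : Set N} {I₀₁ I₀₂ I₁₂ : N → N → Prop} (h₀₁ : PIso I₀₁)
    (h₀₂ : PIso I₀₂) (h₁₂ : PIso I₁₂) (b₀₁ : ∀ m ∈ S, I₀₁ m m) (b₀₂ : ∀ m ∈ S, I₀₂ m m)
    (b₁₂ : ∀ m ∈ S, I₁₂ m m)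
    (c₀ : ∀ x y z, I₀₁ x y → I₀₂ x z → x ∈ S)
    (c₁ : ∀ x y z, I₀₁ x y → I₁₂ y z → y ∈ S)
    (c₂ : ∀ x y z, I₀₂ x z → I₁₂ y z → z ∈ S)
    (e₀ : ∀ x x' y z, I₀₁ x y → I₀₂ x' z → RelE x x' → ∃ m ∈ S, RelE x m)
    (e₁ : ∀ x y y' z, I₀₁ x y → I₁₂ y' z → RelE y y' → ∃ m ∈ S, RelE y m)
    (e₂ : ∀ x y z z', I₀₂ x z → I₁₂ y z' → RelE z z' → ∃ m ∈ S, RelE z m) :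
    Coherent S (tripleRel I₀₁ I₀₂ I₁₂) where
  refl := by intro j x y; fin_cases j <;> exact Iff.rfl
  symm := by
    intro j k x y h
    fin_cases j <;> fin_cases k <;> first | exact h | exact Eq.symm h
  piso j k := by
    fin_cases j <;> fin_cases k
    exacts [piso_eq, h₀₁, h₀₂, h₀₁.symm, piso_eq, h₁₂, h₀₂.symm, h₁₂.symm, piso_eq]
  base j k m hm := by
    fin_cases j <;> fin_cases k
    exacts [rfl, b₀₁ m hm, b₀₂ m hm, b₀₁ m hm, rfl, b₁₂ m hm, b₀₂ m hm, b₁₂ m hm, rfl]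
  center := by
    intro j k l x y z hjk hkl hjl h h'
    fin_cases j <;> fin_cases k <;> first | exact (hjk rfl).elim | skip
    all_goals fin_cases l <;> first | exact (hkl rfl).elim | exact (hjl rfl).elim | skip
    · exact c₁ x y z h h'
    · exact c₂ x z y h h'
    · exact c₀ y x z h h'
    · exact c₂ z x y h' h
    · exact c₀ y z x h' h
    · exact c₁ z y x h' h
  centerE := by
    have symm : ∀ {u v : N}, (∃ m ∈ S, RelE u m) → RelE v u → ∃ m ∈ S, RelE v m :=
      fun ⟨m, hm, h⟩ h' => ⟨m, hm, hN.E_trans _ _ _ h' h⟩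
    intro j k l x y y' z hjk hkl hjl h hE h'
    have hE' := hN.E_symm _ _ hE
    fin_cases j <;> fin_cases k <;> first | exact (hjk rfl).elim | skip
    all_goals fin_cases l <;> first | exact (hkl rfl).elim | exact (hjl rfl).elim | skip
    · exact e₁ x y y' z h h' hE
    · exact e₂ x z y y' h h' hE
    · exact e₀ y y' x z h h' hE
    · exact symm (e₂ z x y' y h' h hE') hE
    · exact symm (e₀ y' y z x h' h hE') hE
    · exact symm (e₁ z y' y x h' h hE') hE

end Amalgam

/-! ### Types and definable closure in existentially closed models -/

section Dcl

variable {N N' : Type} [selLang.Structure N] [selLang.Structure N']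

/-- The relation between the values of a term at two tuples. -/
def TermRel {ι : Type} (v : ι → N) (v' : ι → N') (x : N) (y : N') : Prop :=
  ∃ t : selLang.Term ι, t.realize v = x ∧ t.realize v' = y

theorem TermRel.var {ι : Type} (v : ι → N) (v' : ι → N') (i : ι) : TermRel v v' (v i) (v' i) :=
  ⟨Term.var i, rfl, rfl⟩

/-- Each clause is an atomic formula in the terms, hence part of the common type of the two tuples.
-/
theorem TermRel.piso {ι : Type} {v : ι → N} {v' : ι → N'}
    (h : ∀ φ : selLang.Formula ι, φ.Realize v ↔ φ.Realize v') : PIso (TermRel v v') where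
  F := by
    rintro _ _ ⟨t, rfl, rfl⟩
    rw [← realize_formula_F, ← realize_formula_F]; exact h _
  O0 := by
    rintro _ _ ⟨t, rfl, rfl⟩
    rw [← realize_formula_O0, ← realize_formula_O0]; exact h _
  O1 := by
    rintro _ _ ⟨t, rfl, rfl⟩
    rw [← realize_formula_O1, ← realize_formula_O1]; exact h _
  eq := by
    rintro _ _ _ _ ⟨t, rfl, rfl⟩ ⟨u, rfl, rfl⟩
    rw [← Formula.realize_equal, ← Formula.realize_equal]; exact h _
  E := by
    rintro _ _ _ _ ⟨t, rfl, rfl⟩ ⟨u, rfl, rfl⟩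
    rw [← realize_formula_E, ← realize_formula_E]; exact h _
  R0 := by
    rintro _ _ _ _ ⟨t, rfl, rfl⟩ ⟨u, rfl, rfl⟩
    rw [← realize_formula_R0, ← realize_formula_R0]; exact h _
  ev := by
    rintro _ _ _ _ ⟨t, rfl, rfl⟩ ⟨u, rfl, rfl⟩
    exact ⟨_, realize_term_eval t u, realize_term_eval t u⟩

theorem realize_mem_closure {ι : Type} (t : selLang.Term ι) {v : ι → N} {A : Set N}
    (h : ∀ i, v i ∈ A) : t.realize v ∈ Substructure.closure selLang A := by
  induction t with
  | var i => exact Substructure.subset_closure (h i)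
  | func f ts ih => exact Substructure.fun_mem _ f _ ih

theorem TermRel.mem_closure {ι : Type} {v : ι → N} {v' : ι → N'} {A : Set N} {A' : Set N'}
    (h : ∀ i, v i ∈ A) (h' : ∀ i, v' i ∈ A') {x : N} {y : N'} :
    TermRel v v' x y →
      x ∈ Substructure.closure selLang A ∧ y ∈ Substructure.closure selLang A' := by
  rintro ⟨t, rfl, rfl⟩
  exact ⟨realize_mem_closure t h, realize_mem_closure t h'⟩

theorem EC.pullback (hN : EC N) (hN' : EC N') (g : N ↪[selLang] N') {α β : Type} [Finite β]
    (φ : selLang.Formula (α ⊕ β)) (v : α → N) {w : β → N'} (h : φ.Realize (Sum.elim (g ∘ v) w)) :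
    ∃ w' : β → N, φ.Realize (Sum.elim v w') := by
  have h1 : (Formula.iExs β φ).Realize (g ∘ v) := Formula.realize_iExs.2 ⟨w, h⟩
  exact Formula.realize_iExs.1 (((hN.elementary hN' g).map_formula _ v).1 h1)

/-- A point outside the generated substructure has two different images in the amalgam of two copies
over it, both satisfying any formula over `A` true of the point. So no formula over `A` isolates it.
-/
theorem EC.dcl_eq (hN : EC N) (A : Set N) : dcl selLang A = Substructure.closure selLang A := by
  ext x
  constructor
  · intro hx
    by_contra hx'
    obtain ⟨φ, hφ⟩ := Set.definable_iff_exists_formula_sum.1 hx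
    have key : ∀ y, φ.Realize (Sum.elim (fun a : A => (a : N)) (fun _ : Fin 1 => y)) ↔ y = x := by
      intro y
      exact (Set.ext_iff.1 hφ fun _ => y).symm
    let S := Substructure.closure selLang A
    -- With two copies there are no three different indices, and the conditions on middle points are
    -- void.
    have hc : Coherent (S : Set N) fun (j k : Bool) (x y : N) => x = y ∧ (j = k ∨ x ∈ S) :=
      { refl := by simp
        symm := by
          rintro j k x _ ⟨rfl, h⟩
          exact ⟨rfl, h.imp_left Eq.symm⟩
        piso := by
          intro j k
          by_cases h : j = k
          · simpa [h] using piso_eq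
          · simpa [h] using piso_diag S
        base := fun j k m hm => ⟨rfl, Or.inr hm⟩
        center := by intro j k l; cases j <;> cases k <;> cases l <;> simp
        centerE := by intro j k l; cases j <;> cases k <;> cases l <;> simp }
    obtain ⟨N', _, g, hN', hg, -⟩ := hc.exists_amalgam hN.isSel
    have hne : g true x ≠ g false x := by
      rw [Ne, hg]
      simpa using hx'
    have hA : ∀ a : A, g true a = g false a := fun a =>
      (hg _ _ _ _).2 ⟨rfl, Or.inr (Substructure.subset_closure a.2)⟩
    have hr : ∀ j, φ.Realize (Sum.elim (g true ∘ fun a : A => (a : N)) fun _ : Fin 1 => g j x) := by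
      intro j
      have h1 := ((hN.elementary hN' (g j)).map_formula φ _).2 ((key x).2 rfl)
      convert h1 using 1
      funext i
      rcases i with a | i
      · cases j
        · exact hA a
        · rfl
      · rfl
    -- Having two distinct solutions is an existential statement over `A`, so it descends from the
    -- amalgam to `N`.
    let ψ : selLang.Formula (A ⊕ Bool) :=
      (φ.relabel (Sum.map id fun _ => true)) ⊓ ((φ.relabel (Sum.map id fun _ => false)) ⊓
        ∼(Term.equal (Term.var (Sum.inr true)) (Term.var (Sum.inr false))))
    have hψ : ∀ (K : Type) [selLang.Structure K] (v : A → K) (w : Bool → K),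
        ψ.Realize (Sum.elim v w) ↔ (φ.Realize (Sum.elim v fun _ => w true)) ∧
          (φ.Realize (Sum.elim v fun _ => w false)) ∧ w true ≠ w false := by
      intro K _ v w
      simp only [ψ, Formula.realize_inf, Formula.realize_relabel, Formula.realize_not,
        Formula.realize_equal, Term.realize_var, Sum.elim_inr, Sum.elim_comp_map, Function.comp_id]
      rfl
    obtain ⟨w, hw⟩ := hN.pullback hN' (g true) ψ (fun a : A => (a : N)) (w := fun j => g j x)
      ((hψ _ _ _).2 ⟨hr true, hr false, hne⟩)
    obtain ⟨h1, h2, h3⟩ := (hψ _ _ _).1 hw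
    exact h3 (((key _).1 h1).trans ((key _).1 h2).symm)
  · intro hx
    obtain ⟨t, rfl⟩ := Substructure.mem_closure_iff_exists_term.1 hx
    refine Set.definable_iff_exists_formula_sum.2
      ⟨Term.equal (Term.var (Sum.inr 0)) (t.relabel Sum.inl), ?_⟩
    ext y
    simp only [Set.mem_ofPred_eq, Formula.realize_equal, Term.realize_var, Sum.elim_inr,
      Term.realize_relabel, Sum.elim_comp_inl]
    rfl

theorem EC.indStar_iff (hN : EC N) {A C B : Set N} : IndStar A C B ↔
    (∀ x ∈ Substructure.closure selLang (A ∪ C), ∀ y ∈ Substructure.closure selLang (B ∪ C),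
      RelE x y → ∃ m ∈ Substructure.closure selLang C, RelE x m) ∧
    ∀ x ∈ Substructure.closure selLang (A ∪ C), x ∈ Substructure.closure selLang (B ∪ C) →
      x ∈ Substructure.closure selLang C := by
  have hE : ∀ {x y : N}, RelE x y → {z | RelE x z} = {z | RelE y z} := fun h => Set.ext fun z =>
    ⟨hN.isSel.E_trans _ _ _ (hN.isSel.E_symm _ _ h), hN.isSel.E_trans _ _ _ h⟩
  have hE' : ∀ {x y : N}, IsO x → {z | RelE x z} = {z | RelE y z} → RelE x y := by
    intro x y hx h
    have : x ∈ {z | RelE x z} := hN.isSel.E_refl x hx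
    rw [h] at this
    exact hN.isSel.E_symm _ _ this
  unfold IndStar
  rw [hN.dcl_eq, hN.dcl_eq, hN.dcl_eq]
  refine and_congr ⟨fun h x hx y hy hxy => ?_, ?_⟩ ⟨fun h x hx hx' => h ⟨hx, hx'⟩,
    fun h x hx => h x hx.1 hx.2⟩
  · obtain ⟨m, hm, -, h'⟩ := h (show {z | RelE x z} ∈ _ from
      ⟨⟨x, hx, (hN.isSel.E_O _ _ hxy).1, rfl⟩, ⟨y, hy, (hN.isSel.E_O _ _ hxy).2, hE hxy⟩⟩)
    exact ⟨m, hm, hE' (hN.isSel.E_O _ _ hxy).1 h'⟩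
  · rintro h _ ⟨⟨x, hx, hxO, rfl⟩, ⟨y, hy, hyO, h'⟩⟩
    obtain ⟨m, hm, hxm⟩ := h x hx y hy (hE' hxO h')
    exact ⟨m, hm, (hN.isSel.E_O _ _ hxm).2, hE hxm⟩

/-- A formula has finitely many free variables, so naming all of `A` by variables is no stronger
than using finite tuples of parameters. -/
theorem SameTypeOver.realize_iff {α : Type} {A : Set N} (hA : A.Nonempty) {a a' : α → N}
    (h : SameTypeOver selLang A a a') (φ : selLang.Formula (α ⊕ A)) :
    φ.Realize (Sum.elim a (fun x : A => (x : N))) ↔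
      φ.Realize (Sum.elim a' (fun x : A => (x : N))) := by
  classical
  obtain ⟨m, hm⟩ := hA
  let q := φ.freeVarFinset.equivFin
  let f : φ.freeVarFinset → α ⊕ Fin φ.freeVarFinset.card := fun x =>
    match x.1 with
    | Sum.inl i => Sum.inl i
    | Sum.inr _ => Sum.inr (q x)
  -- The element `m` is a filler at the free variables from `α`, where no parameter is needed.
  let d : Fin φ.freeVarFinset.card → N := fun i =>
    Sum.elim (fun _ => m) (fun x : A => (x : N)) (q.symm i).1
  have hd : ∀ i, d i ∈ A := by
    intro i
    simp only [d]
    rcases (q.symm i).1 with x | x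
    · exact hm
    · exact x.2
  have hf : ∀ (b : α → N) (x : φ.freeVarFinset),
      Sum.elim b d (f x) = Sum.elim b (fun x : A => (x : N)) x.1 := by
    rintro b ⟨x | x, hx⟩
    · rfl
    · simp [f, d]
  have key := h _ (φ.restrictFreeVar f) d hd
  have e : ∀ b : α → N, Formula.Realize (φ.restrictFreeVar f) (Sum.elim b d) ↔
      φ.Realize (Sum.elim b fun x : A => (x : N)) := fun b =>
    BoundedFormula.realize_restrictFreeVar _ fun x => hf b x
  rwa [e, e] at key

theorem closure_elementarySubstructure (M : selLang.ElementarySubstructure N) :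
    (Substructure.closure selLang (M : Set N) : Set N) = M :=
  congrArg _ (Substructure.closure_eq M.toSubstructure)

/-- The independence theorem over models for `⫝*`. -/
theorem EC.independence_theorem (hN : EC N) (M : selLang.ElementarySubstructure N)
    (hM : (M : Set N).Nonempty) {α : Type} {a a' : α → N} {B C : Set N}
    (haa' : SameTypeOver selLang (M : Set N) a a')
    (haB : IndStar (Set.range a) (M : Set N) B) (haC : IndStar (Set.range a') (M : Set N) C)
    (hBC : IndStar B (M : Set N) C) :
    ∃ (N' : Type) (_ : selLang.Structure N') (_ : EC N') (e : N ↪ₑ[selLang] N') (a'' : α → N'),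
      SameTypeOver selLang (e '' ((M : Set N) ∪ B)) a'' (e ∘ a) ∧
      SameTypeOver selLang (e '' ((M : Set N) ∪ C)) a'' (e ∘ a') ∧
      IndStar (Set.range a'') (e '' (M : Set N)) (e '' (B ∪ C)) := by
  have hcM := closure_elementarySubstructure M
  have hcM' : ∀ {x}, x ∈ Substructure.closure selLang (M : Set N) ↔ x ∈ (M : Set N) := by
    intro x; exact Set.ext_iff.1 hcM x
  rw [hN.indStar_iff] at haB haC hBC
  simp only [hcM'] at haB haC hBC
  let SB := Substructure.closure selLang (B ∪ M)
  let SC := Substructure.closure selLang (C ∪ M)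
  let v : α ⊕ (M : Set N) → N := Sum.elim a fun x => x
  let v' : α ⊕ (M : Set N) → N := Sum.elim a' fun x => x
  have hv : ∀ i, v i ∈ Set.range a ∪ (M : Set N) := by
    rintro (i | i)
    exacts [Or.inl ⟨i, rfl⟩, Or.inr i.2]
  have hv' : ∀ i, v' i ∈ Set.range a' ∪ (M : Set N) := by
    rintro (i | i)
    exacts [Or.inl ⟨i, rfl⟩, Or.inr i.2]
  have hB : ∀ d ∈ (M : Set N) ∪ B, d ∈ SB := fun d hd => Substructure.subset_closure hd.symm
  have hC : ∀ d ∈ (M : Set N) ∪ C, d ∈ SC := fun d hd => Substructure.subset_closure hd.symm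
  -- Copy 0 carries `B` and `C`, copy 1 carries `a` and shares `B` with copy 0, copy 2 carries `a'`
  -- and shares `C` with copy 0. Copies 1 and 2 identify `a` with `a'` over `M`. The three
  -- independence hypotheses are the conditions at the middle copies 0, 1 and 2.
  have hco := coherent_tripleRel hN.isSel (S := (M : Set N)) (piso_diag SB) (piso_diag SC)
    (TermRel.piso (haa'.realize_iff hM)) (fun m hm => ⟨rfl, hB m (Or.inl hm)⟩)
    (fun m hm => ⟨rfl, hC m (Or.inl hm)⟩) (fun m hm => TermRel.var v v' (Sum.inr ⟨m, hm⟩))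
    (by rintro x _ _ ⟨rfl, h⟩ ⟨rfl, h'⟩; exact hBC.2 _ h h')
    (by
      rintro x _ z ⟨rfl, h⟩ h'
      exact haB.2 _ (TermRel.mem_closure hv hv' h').1 h)
    (by
      rintro x y _ ⟨rfl, h⟩ h'
      exact haC.2 _ (TermRel.mem_closure hv hv' h').2 h)
    (by rintro x x' _ _ ⟨rfl, h⟩ ⟨rfl, h'⟩ hE; exact hBC.1 _ h _ h' hE)
    (by
      rintro x _ y' z ⟨rfl, h⟩ h' hE
      obtain ⟨m, hm, hE'⟩ := haB.1 _ (TermRel.mem_closure hv hv' h').1 _ h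
        (hN.isSel.E_symm _ _ hE)
      exact ⟨m, hm, hN.isSel.E_trans _ _ _ hE hE'⟩)
    (by
      rintro x y _ z' ⟨rfl, h⟩ h' hE
      obtain ⟨m, hm, hE'⟩ := haC.1 _ (TermRel.mem_closure hv hv' h').2 _ h
        (hN.isSel.E_symm _ _ hE)
      exact ⟨m, hm, hN.isSel.E_trans _ _ _ hE hE'⟩)
  obtain ⟨N', _, g, hN', hg, hgE⟩ := hco.exists_amalgam hN.isSel
  have g01 : ∀ {x y}, g 0 x = g 1 y ↔ x = y ∧ x ∈ SB := hg 0 1 _ _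
  have g02 : ∀ {x y}, g 0 x = g 2 y ↔ x = y ∧ x ∈ SC := hg 0 2 _ _
  have g12 : ∀ i, g 1 (a i) = g 2 (a' i) := fun i =>
    (hg 1 2 _ _).2 (TermRel.var v v' (Sum.inl i))
  have hel : ∀ (j : Fin 3) {r : ℕ} (φ : selLang.Formula (α ⊕ Fin r)) (b : α → N) (d : Fin r → N),
      φ.Realize (Sum.elim (g j ∘ b) (g j ∘ d)) ↔ φ.Realize (Sum.elim b d) := by
    intro j r φ b d
    rw [← Sum.comp_elim]
    exact (hN.elementary hN' (g j)).map_formula φ _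
  -- The new tuple is the image of `a` from copy 1, which is also that of `a'` from copy 2.
  refine ⟨N', inferInstance, hN', hN.elementary hN' (g 0), g 1 ∘ a, ?_, ?_, ?_⟩
  · intro r φ d hd
    choose d' hd' hd'' using hd
    have e0 : d = g 0 ∘ d' := funext fun i => (hd'' i).symm
    have e1 : d = g 1 ∘ d' := by
      rw [e0]
      exact funext fun i => g01.2 ⟨rfl, hB _ (hd' i)⟩
    have h1 := hel 1 φ a d'
    have h0 := hel 0 φ a d'
    rw [← e1] at h1
    rw [← e0] at h0
    exact h1.trans h0.symm
  · intro r φ d hd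
    choose d' hd' hd'' using hd
    have e0 : d = g 0 ∘ d' := funext fun i => (hd'' i).symm
    have e1 : d = g 2 ∘ d' := by
      rw [e0]
      exact funext fun i => g02.2 ⟨rfl, hC _ (hd' i)⟩
    have h1 := hel 2 φ a' d'
    have h0 := hel 0 φ a' d'
    rw [← e1, show g 2 ∘ a' = g 1 ∘ a from funext fun i => (g12 i).symm] at h1
    rw [← e0] at h0
    exact h1.trans h0.symm
  · have gM : ∀ m ∈ (M : Set N), g 0 m = g 1 m := fun m hm => g01.2 ⟨rfl, hB m (Or.inl hm)⟩
    rw [hN'.indStar_iff]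
    have e1 : ∀ x ∈ Substructure.closure selLang
        (Set.range (g 1 ∘ a) ∪ (hN.elementary hN' (g 0)) '' (M : Set N)),
        ∃ y ∈ Substructure.closure selLang (Set.range a ∪ M), g 1 y = x := by
      intro x hx
      rw [show Set.range (g 1 ∘ a) ∪ (hN.elementary hN' (g 0)) '' (M : Set N) =
        (g 1).toHom '' (Set.range a ∪ M) by
          rw [Set.image_union, Set.range_comp]
          exact congrArg _ (Set.image_congr gM), ← Substructure.map_closure] at hx
      exact hx
    have e0 : ∀ x ∈ Substructure.closure selLang
        ((hN.elementary hN' (g 0)) '' (B ∪ C) ∪ (hN.elementary hN' (g 0)) '' (M : Set N)),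
        ∃ y, g 0 y = x := by
      intro x hx
      rw [← Set.image_union] at hx
      have hx' : x ∈ Substructure.closure selLang ((g 0).toHom '' ((B ∪ C) ∪ M)) := hx
      rw [← Substructure.map_closure] at hx'
      obtain ⟨y, -, h⟩ := hx'
      exact ⟨y, h⟩
    have eM : ∀ m ∈ (M : Set N), g 1 m ∈ Substructure.closure selLang
        ((hN.elementary hN' (g 0)) '' (M : Set N)) := fun m hm =>
      Substructure.subset_closure ⟨m, hm, gM m hm⟩
    constructor
    -- The set generated by `B`, `C` and `M` lies in copy 0, and copy 0 meets copy 1 only in what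
    -- `B` and `M` generate. Thus independence of `a` from `B` over `M` already suffices.
    · intro x hx z hz hE
      obtain ⟨y, hy, rfl⟩ := e1 x hx
      obtain ⟨z, rfl⟩ := e0 z hz
      obtain ⟨x₁, y₁, h1, ⟨rfl, h2⟩, h3⟩ := (hgE 0 1 z y).1 (hN'.isSel.E_symm _ _ hE)
      obtain ⟨m, hm, hE'⟩ := haB.1 y hy x₁ h2 (hN.isSel.E_symm _ _ h3)
      exact ⟨g 1 m, eM m hm, (emb_E (g 1) _ _).2 hE'⟩
    · intro x hx hz
      obtain ⟨y, hy, rfl⟩ := e1 x hx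
      obtain ⟨z, hz⟩ := e0 _ hz
      obtain ⟨rfl, h⟩ := g01.1 hz
      exact eM _ (haB.2 _ hy h)

end Dcl

end Shredding

namespace Shredding

/-! ### Ultrapowers -/

section Ultrapower

variable {N : Type} [selLang.Structure N]

/-- The ultrapower of an existentially closed model, with its limits of sequences. -/
theorem EC.exists_ultrapower (hN : EC N) : ∃ (U : Type) (_ : selLang.Structure U) (_ : EC U)
    (d : N ↪[selLang] U) (lim : (ℕ → N) → U),
    (∀ x, lim (fun _ => x) = d x) ∧
    ∀ (α : Type) (φ : selLang.Formula α) (s : α → ℕ → N), φ.Realize (fun a => lim (s a)) ↔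
      ∀ᶠ i in (Filter.hyperfilter ℕ : Filter ℕ), φ.Realize fun a => s a i := by
  have := hN.nonempty
  let U := (Filter.hyperfilter ℕ : Filter ℕ).Product fun _ => N
  let lim : (ℕ → N) → U := fun s => (s : (Filter.hyperfilter ℕ : Filter ℕ).Product fun _ => N)
  have hlim : ∀ (α : Type) (φ : selLang.Formula α) (s : α → ℕ → N),
      φ.Realize (fun a => lim (s a)) ↔
        ∀ᶠ i in (Filter.hyperfilter ℕ : Filter ℕ), φ.Realize fun a => s a i :=
    fun α φ s => Ultraproduct.realize_formula_cast φ s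
  let d : N ↪ₑ[selLang] U :=
    { toFun := fun x => lim fun _ => x
      map_formula' := fun n φ x => (hlim _ φ fun j _ => x j).trans (Filter.eventually_const) }
  exact ⟨U, inferInstance, hN.of_completeTheory fun φ hφ => (d.map_sentence φ).1 hφ,
    d.toEmbedding, lim, fun x => rfl, hlim⟩

variable {U : Type} [selLang.Structure U] {d : N ↪[selLang] U} {lim : (ℕ → N) → U}

/-- A limit of tuples from `X` is finitely satisfiable in `X`: an equality or `E`-relation between a
point of `N` and a term in the limits holds at some index, where the term has a value generated by
`X`. -/
theorem mem_closure_of_limit (hd : ∀ x, lim (fun _ => x) = d x)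
    (hlim : ∀ (α : Type) (φ : selLang.Formula α) (s : α → ℕ → N), φ.Realize (fun a => lim (s a)) ↔
      ∀ᶠ i in (Filter.hyperfilter ℕ : Filter ℕ), φ.Realize fun a => s a i)
    {X : Set N} {β : Type} {s : β → ℕ → N} (hs : ∀ b i, s b i ∈ X) {y : U}
    (hy : y ∈ Substructure.closure selLang (d '' X ∪ Set.range fun b => lim (s b))) :
    (∀ x, d x = y → x ∈ Substructure.closure selLang X) ∧
      ∀ x, RelE (d x) y → ∃ m ∈ Substructure.closure selLang X, RelE x m := by
  -- The elements of `X` are limits of constant sequences, so all generators become limits.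
  have hr : d '' X ∪ Set.range (fun b => lim (s b)) =
      Set.range fun p : X ⊕ β => lim (Sum.elim (fun (x : X) (_ : ℕ) => (x : N)) s p) := by
    rw [Sum.range_eq]
    congr 1
    ext u
    simp [Function.comp_def, hd]
  rw [hr] at hy
  obtain ⟨t, rfl⟩ : ∃ t : selLang.Term (X ⊕ β),
      t.realize (fun p => lim (Sum.elim (fun (x : X) (_ : ℕ) => (x : N)) s p)) = y := by
    have := Substructure.closure_le.2 (show Set.range _ ⊆ ((Substructure.closure selLang
      (Set.range fun p : X ⊕ β => lim (Sum.elim (fun (x : X) (_ : ℕ) => (x : N)) s p)) :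
        selLang.Substructure U) : Set U) from Substructure.subset_closure) hy
    obtain ⟨t, ht⟩ := Substructure.mem_closure_iff_exists_term.1 this
    choose q hq using fun x : Set.range
      (fun p : X ⊕ β => lim (Sum.elim (fun (x : X) (_ : ℕ) => (x : N)) s p)) => x.2
    refine ⟨t.relabel q, ?_⟩
    rw [Term.realize_relabel, ← ht]
    congr 1
    exact funext hq
  have hmem : ∀ i, t.realize (fun p => Sum.elim (fun (x : X) (_ : ℕ) => (x : N)) s p i) ∈
      Substructure.closure selLang X := fun i => realize_mem_closure t (by
    rintro (x | b)
    exacts [x.2, hs b i])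
  constructor
  · intro x hx
    have h1 := (hlim (Unit ⊕ (X ⊕ β)) (Term.equal (Term.var (Sum.inl ())) (t.relabel Sum.inr))
      (Sum.elim (fun _ _ => x) (Sum.elim (fun (x : X) (_ : ℕ) => (x : N)) s))).1 (by
        rw [Formula.realize_equal, Term.realize_relabel, Term.realize_var]
        exact (hd x).trans hx)
    obtain ⟨i, hi⟩ := h1.exists
    rw [Formula.realize_equal, Term.realize_relabel, Term.realize_var] at hi
    have : x = _ := hi
    rw [this]
    exact hmem i
  · intro x hx
    have h1 := (hlim (Unit ⊕ (X ⊕ β)) (Relations.formula₂ (L := selLang) SelRelations.E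
      (Term.var (Sum.inl ())) (t.relabel Sum.inr))
      (Sum.elim (fun _ _ => x) (Sum.elim (fun (x : X) (_ : ℕ) => (x : N)) s))).1 (by
        rw [realize_formula_E, Term.realize_relabel, Term.realize_var]
        rw [← hd] at hx
        exact hx)
    obtain ⟨i, hi⟩ := h1.exists
    rw [realize_formula_E, Term.realize_relabel, Term.realize_var] at hi
    exact ⟨_, hmem i, hi⟩

end Ultrapower

/-! ### Finitely many types -/

section Table

variable {N : Type} [selLang.Structure N] {ι : Type}

/-- The elements generated by a tuple. -/
def genVal (w : ι → N) : ι ⊕ ι × ι → N := Sum.elim w fun p => ev (w p.1) (w p.2)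

/-- The quantifier free type of a tuple. -/
def table (w : ι → N) :
    (ι ⊕ ι × ι → Prop × Prop × Prop) × ((ι ⊕ ι × ι) × (ι ⊕ ι × ι) → Prop × Prop × Prop) :=
  (fun t => (IsF (genVal w t), IsO0 (genVal w t), IsO1 (genVal w t)),
    fun t => (genVal w t.1 = genVal w t.2, RelE (genVal w t.1) (genVal w t.2),
      Rel0 (genVal w t.1) (genVal w t.2)))

/-- The index of the value is read off from the sorts alone, which the two tables share, so the same
index serves both tuples. -/
theorem IsSel.exists_genVal (hN : IsSel N) {w w' : ι → N} (h : table w = table w')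
    (t u : ι ⊕ ι × ι) : ∃ r, genVal w r = ev (genVal w t) (genVal w u) ∧
      genVal w' r = ev (genVal w' t) (genVal w' u) := by
  have h1 := fun t => congrFun (congrArg Prod.fst h) t
  simp only [table, Prod.mk.injEq, eq_iff_iff] at h1
  have hF := fun t => (h1 t).1
  have hO : ∀ t, IsO (genVal w t) ↔ IsO (genVal w' t) := fun t => by
    rw [hN.O_iff, hN.O_iff, (h1 t).2.1, (h1 t).2.2]
  by_cases htu : IsF (genVal w t) ∧ IsO (genVal w u)
  swap
  · refine ⟨t, (hN.ev_triv _ _ htu).symm, (hN.ev_triv _ _ ?_).symm⟩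
    rwa [← hF, ← hO]
  obtain ⟨htF, huO⟩ := htu
  -- A generated element of `F` is one of the original entries, because proper values of `eval` lie
  -- in `O₀`.
  obtain ⟨p, hp, hp'⟩ : ∃ p, genVal w t = w p ∧ genVal w' t = w' p := by
    rcases t with p | ⟨p, q⟩
    · exact ⟨p, rfl, rfl⟩
    · have key : ∀ w : ι → N, IsF (genVal w (Sum.inr (p, q))) →
          genVal w (Sum.inr (p, q)) = w p := fun w hw =>
        hN.ev_triv _ _ fun h => hN.not_F_O0 _ hw (hN.ev_O0 _ _ h.1 h.2)
      exact ⟨p, key w htF, key w' ((hF _).1 htF)⟩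
  have hpF := htF
  rw [hp] at hpF
  have hpF' := (hF _).1 htF
  rw [hp'] at hpF'
  rw [hp, hp']
  rcases u with q | ⟨p', q⟩
  · exact ⟨Sum.inr (p, q), rfl, rfl⟩
  · by_cases hq : IsF (w p') ∧ IsO (w q)
    · have hq' : IsF (w' p') ∧ IsO (w' q) := ⟨(hF (Sum.inl p')).1 hq.1, (hO (Sum.inl q)).1 hq.2⟩
      exact ⟨Sum.inr (p, q), hN.ev_congr _ _ _ hpF (hN.E_ev _ _ hq.1 hq.2),
        hN.ev_congr _ _ _ hpF' (hN.E_ev _ _ hq'.1 hq'.2)⟩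
    · have hq' : ¬ (IsF (w' p') ∧ IsO (w' q)) := fun h =>
        hq ⟨(hF (Sum.inl p')).2 h.1, (hO (Sum.inl q)).2 h.2⟩
      exact ⟨Sum.inr (p, p'), congrArg (ev (w p)) (hN.ev_triv _ _ hq).symm,
        congrArg (ev (w' p)) (hN.ev_triv _ _ hq').symm⟩

theorem IsSel.piso_of_table (hN : IsSel N) {w w' : ι → N} (h : table w = table w') :
    PIso fun x y => ∃ t, genVal w t = x ∧ genVal w' t = y := by
  have h1 := fun t => congrFun (congrArg Prod.fst h) t
  have h2 := fun t u => congrFun (congrArg Prod.snd h) (t, u)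
  simp only [table, Prod.mk.injEq, eq_iff_iff] at h1 h2
  exact
    { F := by rintro _ _ ⟨t, rfl, rfl⟩; exact (h1 t).1
      O0 := by rintro _ _ ⟨t, rfl, rfl⟩; exact (h1 t).2.1
      O1 := by rintro _ _ ⟨t, rfl, rfl⟩; exact (h1 t).2.2
      eq := by rintro _ _ _ _ ⟨t, rfl, rfl⟩ ⟨u, rfl, rfl⟩; exact (h2 t u).1
      E := by rintro _ _ _ _ ⟨t, rfl, rfl⟩ ⟨u, rfl, rfl⟩; exact (h2 t u).2.1
      R0 := by rintro _ _ _ _ ⟨t, rfl, rfl⟩ ⟨u, rfl, rfl⟩; exact (h2 t u).2.2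
      ev := by rintro _ _ _ _ ⟨t, rfl, rfl⟩ ⟨u, rfl, rfl⟩; exact hN.exists_genVal h t u }

/-- Among infinitely many finite tuples, two have the same type over a finite set. -/
theorem EC.exists_same_type (hN : EC N) [Finite ι] (w : ℕ → ι → N) : ∃ k j, k < j ∧
    ∀ (α : Type) [DecidableEq α] (φ : selLang.Formula α) (v v' : α → N),
      (∀ x ∈ φ.freeVarFinset, ∃ i, v x = w k i ∧ v' x = w j i) →
        (φ.Realize v ↔ φ.Realize v') := by
  -- Tables range over a finite type.
  obtain ⟨k, j, hkj, h⟩ : ∃ k j, k < j ∧ table (w k) = table (w j) := by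
    obtain ⟨k, j, hkj, h⟩ := Finite.exists_ne_map_eq_of_infinite fun i => table (w i)
    rcases lt_or_gt_of_ne hkj with h' | h'
    exacts [⟨k, j, h', h⟩, ⟨j, k, h', h.symm⟩]
  refine ⟨k, j, hkj, fun α _ φ v v' hv => ?_⟩
  refine hN.realize_iff_of_freeVar hN (hN.isSel.piso_of_table h) φ v v' fun x hx => ?_
  obtain ⟨i, hi, hi'⟩ := hv x hx
  exact ⟨Sum.inl i, hi.symm, hi'.symm⟩

end Table

/-! ### `NSOP₁` -/

section NSOP

variable {N : Type} [selLang.Structure N]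

/-- Let `b₀` be the limit of `s₀` in an ultrapower `U` of `N`, and `b₁` the limit of `s₁` in an
ultrapower `V` of `U`. They have the same type over `X`. As limits from `X`, the tuple `b₀` is
independent over `X` from `c`, which lies in `N`, and `b₁` from `b₀`, which lies in `U`. Since `φ`
holds of `c` and `b₀`, amalgamation produces a common solution at `b₀` and `b₁`, although these
instances are inconsistent. -/
theorem EC.not_sop_array (hN : EC N) {m n : ℕ} (φ : selLang.Formula (Fin m ⊕ Fin n)) {X : Set N}
    {s₀ s₁ : Fin n → ℕ → N} (hs₀ : ∀ j i, s₀ j i ∈ X) (hs₁ : ∀ j i, s₁ j i ∈ X) {c : Fin m → N}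
    (hc : ∀ i, φ.Realize (Sum.elim c fun j => s₀ j i))
    (hinc : ∀ i l, i ≤ l → ¬ ∃ x : Fin m → N, φ.Realize (Sum.elim x fun j => s₀ j l) ∧
      φ.Realize (Sum.elim x fun j => s₁ j i))
    (htp : ∀ ψ : selLang.Formula (Fin n ⊕ X), ∀ᶠ i in Filter.atTop,
      (ψ.Realize (Sum.elim (fun j => s₀ j i) fun x : X => (x : N)) ↔
        ψ.Realize (Sum.elim (fun j => s₁ j i) fun x : X => (x : N)))) : False := by
  obtain ⟨U, _, hU, d, lim, hd, hlim⟩ := hN.exists_ultrapower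
  obtain ⟨V, _, hV, d', lim', hd', hlim'⟩ := hU.exists_ultrapower
  have hdf : ∀ {α : Type} (ψ : selLang.Formula α) (v : α → N),
      ψ.Realize (fun a => d (v a)) ↔ ψ.Realize v := fun ψ v => (hN.elementary hU d).map_formula ψ v
  have hdf' : ∀ {α : Type} (ψ : selLang.Formula α) (v : α → U),
      ψ.Realize (fun a => d' (v a)) ↔ ψ.Realize v := fun ψ v =>
    (hU.elementary hV d').map_formula ψ v
  have hat : (Filter.hyperfilter ℕ : Filter ℕ) ≤ Filter.atTop := Nat.hyperfilter_le_atTop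
  let b₀ : Fin n → U := fun j => lim (s₀ j)
  let b₁ : Fin n → V := fun j => lim' fun i => d (s₁ j i)
  let φφ : selLang.Formula ((Fin n ⊕ Fin n) ⊕ Fin m) :=
    (φ.relabel (Sum.elim Sum.inr fun j => Sum.inl (Sum.inl j))) ⊓
      (φ.relabel (Sum.elim Sum.inr fun j => Sum.inl (Sum.inr j)))
  have hφφ : ∀ (K : Type) [selLang.Structure K] (y z : Fin n → K) (x : Fin m → K),
      φφ.Realize (Sum.elim (Sum.elim y z) x) ↔
        φ.Realize (Sum.elim x y) ∧ φ.Realize (Sum.elim x z) := by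
    intro K _ y z x
    simp only [φφ, Formula.realize_inf, Formula.realize_relabel, Sum.comp_elim, Sum.elim_comp_inr]
    rfl
  -- the two limits are inconsistent
  have hincU : ∀ i, ¬ ∃ x : Fin m → U, φ.Realize (Sum.elim x b₀) ∧
      φ.Realize (Sum.elim x fun j => d (s₁ j i)) := by
    rintro i ⟨x, hx⟩
    have h1 : (Formula.iExs (Fin m) φφ).Realize
        (fun p => lim (Sum.elim s₀ (fun j _ => s₁ j i) p)) := by
      refine Formula.realize_iExs.2 ⟨x, ?_⟩
      convert (hφφ U b₀ (fun j => d (s₁ j i)) x).2 hx using 2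
      funext p
      rcases p with p | p
      · rfl
      · exact hd _
    -- For fixed `i` almost all `l` satisfy `i ≤ l`. This is why the limit of `s₀` is taken first.
    have h2 := ((hlim _ _ _).1 h1).and ((Filter.eventually_ge_atTop i).filter_mono hat)
    obtain ⟨l, hl, hil⟩ := h2.exists
    obtain ⟨x, hx⟩ := Formula.realize_iExs.1 hl
    refine hinc i l hil ⟨x, (hφφ N _ _ x).1 ?_⟩
    convert hx using 2
    funext p
    rcases p with p | p <;> rfl
  have hincV : ¬ ∃ x : Fin m → V, φ.Realize (Sum.elim x fun j => d' (b₀ j)) ∧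
      φ.Realize (Sum.elim x b₁) := by
    rintro ⟨x, hx⟩
    have h1 : (Formula.iExs (Fin m) φφ).Realize
        (fun p => lim' (Sum.elim (fun j _ => b₀ j) (fun j i => d (s₁ j i)) p)) := by
      refine Formula.realize_iExs.2 ⟨x, ?_⟩
      convert (hφφ V (fun j => d' (b₀ j)) b₁ x).2 hx using 2
      funext p
      rcases p with p | p
      · exact hd' _
      · rfl
    obtain ⟨i, hi⟩ := ((hlim' _ _ _).1 h1).exists
    obtain ⟨x, hx⟩ := Formula.realize_iExs.1 hi
    refine hincU i ⟨x, (hφφ U _ _ x).1 ?_⟩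
    convert hx using 2
    funext p
    rcases p with p | p <;> rfl
  have hφU : φ.Realize (Sum.elim (fun j => d (c j)) b₀) := by
    have := (hlim _ φ (Sum.elim (fun j _ => c j) s₀)).2 (Filter.Eventually.of_forall fun i => by
      convert hc i using 1
      funext p
      rcases p with p | p <;> rfl)
    convert this using 1
    funext p
    rcases p with p | p
    · exact (hd _).symm
    · rfl
  have hφV : φ.Realize (Sum.elim (fun j => d' (d (c j))) fun j => d' (b₀ j)) := by
    have := (hdf' φ _).2 hφU
    convert this using 1
    funext p
    rcases p with p | p <;> rfl
  -- the two limits have the same type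
  let v₀ : Fin n ⊕ X → V := Sum.elim (fun j => d' (b₀ j)) fun x => d' (d x)
  let v₁ : Fin n ⊕ X → V := Sum.elim b₁ fun x => d' (d x)
  have hsame : ∀ ψ : selLang.Formula (Fin n ⊕ X), ψ.Realize v₁ ↔ ψ.Realize v₀ := by
    intro ψ
    have e1 : ψ.Realize v₁ ↔ ∀ᶠ i in (Filter.hyperfilter ℕ : Filter ℕ),
        ψ.Realize (Sum.elim (fun j => s₁ j i) fun x : X => (x : N)) := by
      rw [← (Filter.eventually_congr (Filter.Eventually.of_forall fun i =>
        hdf ψ (Sum.elim (fun j => s₁ j i) fun x : X => (x : N))) :)]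
      refine Iff.trans ?_ ((hlim' _ ψ (fun p i => d (Sum.elim (fun j => s₁ j i)
        (fun x : X => (x : N)) p))))
      have : v₁ = fun p => lim' fun i =>
          d (Sum.elim (fun j => s₁ j i) (fun x : X => (x : N)) p) := by
        funext p
        rcases p with p | p
        · rfl
        · exact (hd' _).symm
      rw [this]
    have e0 : ψ.Realize v₀ ↔ ∀ᶠ i in (Filter.hyperfilter ℕ : Filter ℕ),
        ψ.Realize (Sum.elim (fun j => s₀ j i) fun x : X => (x : N)) := by
      have : v₀ = fun p => d' (lim fun i =>
          Sum.elim (fun j => s₀ j i) (fun x : X => (x : N)) p) := by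
        funext p
        rcases p with p | p
        · rfl
        · exact congrArg d' (hd _).symm
      rw [this, hdf', hlim]
    rw [e1, e0]
    exact Filter.eventually_congr (((htp ψ).filter_mono hat).mono fun i hi => hi.symm)
  -- amalgamation
  let XV : Set V := d' '' (d '' X)
  let S := Substructure.closure selLang XV
  let S₀ := Substructure.closure selLang (XV ∪ Set.range fun j => d' (b₀ j))
  let Sc := Substructure.closure selLang (XV ∪ Set.range fun j => d' (d (c j)))
  let S₁ := Substructure.closure selLang (XV ∪ Set.range b₁)
  have hS₀ : S ≤ S₀ := Substructure.closure_mono Set.subset_union_left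
  have hSc : S ≤ Sc := Substructure.closure_mono Set.subset_union_left
  have hmap : ∀ A : Set U, ∀ x, x ∈ Substructure.closure selLang (d' '' A) ↔
      ∃ y ∈ Substructure.closure selLang A, d' y = x := by
    intro A x
    change x ∈ Substructure.closure selLang (d'.toHom '' A) ↔ _
    rw [← Substructure.map_closure]
    rfl
  have hmapU : ∀ A : Set N, ∀ x, x ∈ Substructure.closure selLang (d '' A) ↔
      ∃ y ∈ Substructure.closure selLang A, d y = x := by
    intro A x
    change x ∈ Substructure.closure selLang (d.toHom '' A) ↔ _
    rw [← Substructure.map_closure]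
    rfl
  have eS₀ : ∀ x ∈ S₀, ∃ y ∈ Substructure.closure selLang (d '' X ∪ Set.range b₀), d' y = x := by
    intro x hx
    refine (hmap _ _).1 ?_
    rwa [Set.image_union, ← Set.range_comp]
  have eSc : ∀ x ∈ Sc, ∃ y, d' (d y) = x := by
    intro x hx
    have hx' : x ∈ Substructure.closure selLang
        (d' '' (d '' (X ∪ Set.range c))) := by
      rwa [Set.image_union, Set.image_union, ← Set.range_comp, ← Set.range_comp]
    obtain ⟨y, hy, rfl⟩ := (hmap _ _).1 hx'
    obtain ⟨z, -, rfl⟩ := (hmapU _ _).1 hy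
    exact ⟨z, rfl⟩
  have inS : ∀ x ∈ Substructure.closure selLang X, d' (d x) ∈ S := fun x hx =>
    (hmap _ _).2 ⟨_, (hmapU _ _).2 ⟨x, hx, rfl⟩, rfl⟩
  -- the pairwise intersections
  have k₁ : ∀ x ∈ S₀, ∀ y ∈ Sc, (x = y → x ∈ S) ∧ (RelE y x → ∃ m ∈ S, RelE y m) := by
    intro x hx y hy
    obtain ⟨x, hx', rfl⟩ := eS₀ x hx
    obtain ⟨y, rfl⟩ := eSc y hy
    obtain ⟨h1, h2⟩ := mem_closure_of_limit hd hlim hs₀ hx'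
    constructor
    · intro h
      rw [h]
      exact inS _ (h1 y (d'.injective h).symm)
    · intro h
      obtain ⟨m, hm, h⟩ := h2 y ((emb_E d' _ _).1 h)
      exact ⟨_, inS m hm, by rwa [emb_E, emb_E]⟩
  have k₀ : ∀ x ∈ S₁, ∀ y ∈ S₀, (x = y → x ∈ S) ∧ (RelE y x → ∃ m ∈ S, RelE y m) := by
    intro x hx y hy
    obtain ⟨y, hy, rfl⟩ := eS₀ y hy
    obtain ⟨h1, h2⟩ := mem_closure_of_limit hd' hlim' (X := d '' X) (s := fun j i => d (s₁ j i))
      (fun j i => ⟨_, hs₁ j i, rfl⟩) hx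
    constructor
    · rintro rfl
      exact (hmap _ _).2 ⟨y, h1 y rfl, rfl⟩
    · intro h
      obtain ⟨m, hm, h⟩ := h2 y h
      exact ⟨_, (hmap _ _).2 ⟨m, hm, rfl⟩, (emb_E d' _ _).2 h⟩
  have hXv₀ : ∀ i, v₀ i ∈ XV ∪ Set.range fun j => d' (b₀ j) := by
    rintro (j | x)
    exacts [Or.inr ⟨j, rfl⟩, Or.inl ⟨_, ⟨x, x.2, rfl⟩, rfl⟩]
  have hXv₁ : ∀ i, v₁ i ∈ XV ∪ Set.range b₁ := by
    rintro (j | x)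
    exacts [Or.inr ⟨j, rfl⟩, Or.inl ⟨_, ⟨x, x.2, rfl⟩, rfl⟩]
  have hT := TermRel.piso hsame
  have hbase : ∀ x ∈ S, TermRel v₁ v₀ x x := by
    intro x hx
    have : S ≤ selSub {x | TermRel v₁ v₀ x x} (fun x hx y hy => hT.ev hx hy) := by
      refine Substructure.closure_le.2 ?_
      rintro _ ⟨_, ⟨x, hx, rfl⟩, rfl⟩
      exact TermRel.var v₁ v₀ (Sum.inr ⟨x, hx⟩)
    exact this hx
  have hE := hV.isSel.E_symm
  -- Copy 0 carries `b₀` and `b₁`. Copy 1 shares `b₀` with it, copy 2 has its own `b₀` identified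
  -- with the `b₁` of copy 0, and copies 1 and 2 share `c`. Then `φ` at `c` and `b₀`, read in copies
  -- 1 and 2, gives both instances at once.
  have hco := coherent_tripleRel hV.isSel (S := (S : Set V)) (piso_diag S₀) hT (piso_diag Sc)
    (fun x hx => ⟨rfl, hS₀ hx⟩) hbase (fun x hx => ⟨rfl, hSc hx⟩)
    (by
      rintro x _ z ⟨rfl, h⟩ h'
      exact (k₀ x (TermRel.mem_closure hXv₁ hXv₀ h').1 x h).1 rfl)
    (by
      rintro x _ _ ⟨rfl, h⟩ ⟨rfl, h'⟩
      exact (k₁ x h x h').1 rfl)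
    (by
      rintro x y _ h ⟨rfl, h'⟩
      exact (k₁ y (TermRel.mem_closure hXv₁ hXv₀ h).2 y h').1 rfl)
    (by
      rintro x x' _ z ⟨rfl, h⟩ h' hxx'
      exact (k₀ x' (TermRel.mem_closure hXv₁ hXv₀ h').1 x h).2 hxx')
    (by
      rintro x _ y' _ ⟨rfl, h⟩ ⟨rfl, h'⟩ hxy
      obtain ⟨m, hm, h⟩ := (k₁ x h y' h').2 (hE _ _ hxy)
      exact ⟨m, hm, hV.isSel.E_trans _ _ _ hxy h⟩)
    (by
      rintro x y z _ h ⟨rfl, h'⟩ hzy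
      obtain ⟨m, hm, h⟩ := (k₁ z (TermRel.mem_closure hXv₁ hXv₀ h).2 y h').2 (hE _ _ hzy)
      exact ⟨m, hm, hV.isSel.E_trans _ _ _ hzy h⟩)
  obtain ⟨W, _, g, hW, hg, -⟩ := hco.exists_amalgam hV.isSel
  have hgf : ∀ (j : Fin 3) (y : Fin n → V) (x : Fin m → V), φ.Realize (Sum.elim x y) →
      φ.Realize (Sum.elim (g j ∘ x) (g j ∘ y)) := by
    intro j y x h
    rw [← Sum.comp_elim]
    exact ((hV.elementary hW (g j)).map_formula φ _).2 h
  have r1 := hgf 1 _ _ hφV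
  have r2 := hgf 2 _ _ hφV
  have q1 : (g 1 ∘ fun j => d' (b₀ j)) = g 0 ∘ fun j => d' (b₀ j) := funext fun j =>
    ((hg 0 1 _ _).2 ⟨rfl, Substructure.subset_closure (Or.inr ⟨j, rfl⟩)⟩).symm
  have q2 : (g 2 ∘ fun j => d' (b₀ j)) = g 0 ∘ b₁ := funext fun j =>
    ((hg 0 2 _ _).2 (TermRel.var v₁ v₀ (Sum.inl j))).symm
  have q3 : (g 2 ∘ fun j => d' (d (c j))) = g 1 ∘ fun j => d' (d (c j)) := funext fun j =>
    ((hg 1 2 _ _).2 ⟨rfl, Substructure.subset_closure (Or.inr ⟨j, rfl⟩)⟩).symm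
  rw [q1] at r1
  rw [q2, q3] at r2
  obtain ⟨x, hx⟩ := hV.pullback hW (g 0) φφ (Sum.elim (fun j => d' (b₀ j)) b₁)
    (w := g 1 ∘ fun j => d' (d (c j))) (by
      rw [Sum.comp_elim]
      exact (hφφ W _ _ _).2 ⟨r1, r2⟩)
  exact hincV ⟨x, (hφφ V _ _ _).1 hx⟩

end NSOP

end Shredding

namespace Shredding

/-! ### From a tree to a path with side branches -/

section NSOP

variable {N : Type} [selLang.Structure N]

/-- Compactness: the limit of solutions of the initial segments solves all instances in an
ultrapower, and the other hypotheses transfer along the elementary diagonal embedding. -/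
theorem EC.not_sop_sequence (hN : EC N) {m n : ℕ} (φ : selLang.Formula (Fin m ⊕ Fin n)) {X : Set N}
    {s₀ s₁ : Fin n → ℕ → N} (hs₀ : ∀ j i, s₀ j i ∈ X) (hs₁ : ∀ j i, s₁ j i ∈ X)
    (hc : ∀ l, ∃ c : Fin m → N, ∀ i < l, φ.Realize (Sum.elim c fun j => s₀ j i))
    (hinc : ∀ i l, i ≤ l → ¬ ∃ x : Fin m → N, φ.Realize (Sum.elim x fun j => s₀ j l) ∧
      φ.Realize (Sum.elim x fun j => s₁ j i))
    (htp : ∀ ψ : selLang.Formula (Fin n ⊕ X), ∀ᶠ i in Filter.atTop,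
      (ψ.Realize (Sum.elim (fun j => s₀ j i) fun x : X => (x : N)) ↔
        ψ.Realize (Sum.elim (fun j => s₁ j i) fun x : X => (x : N)))) : False := by
  obtain ⟨U, _, hU, d, lim, hd, hlim⟩ := hN.exists_ultrapower
  choose c hc using hc
  have hdf : ∀ {α : Type} (ψ : selLang.Formula α) (v : α → N),
      ψ.Realize (fun a => d (v a)) ↔ ψ.Realize v := fun ψ v => (hN.elementary hU d).map_formula ψ v
  let q : X → (d '' X : Set U) := fun x => ⟨d x, x, x.2, rfl⟩
  have hq : Function.Surjective q := by
    rintro ⟨_, x, hx, rfl⟩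
    exact ⟨⟨x, hx⟩, rfl⟩
  refine hU.not_sop_array φ (X := d '' X) (s₀ := fun j i => d (s₀ j i))
    (s₁ := fun j i => d (s₁ j i)) (fun j i => ⟨_, hs₀ j i, rfl⟩) (fun j i => ⟨_, hs₁ j i, rfl⟩)
    (c := fun j => lim fun l => c l j) ?_ ?_ ?_
  · intro i
    have := (hlim _ φ (Sum.elim (fun j l => c l j) fun j _ => s₀ j i)).2
      (((Filter.eventually_gt_atTop i).filter_mono Nat.hyperfilter_le_atTop).mono fun l hl => by
        convert hc l i hl using 1
        funext p
        rcases p with p | p <;> rfl)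
    convert this using 1
    funext p
    rcases p with p | p
    · rfl
    · exact (hd _).symm
  · rintro i l hil ⟨x, h1, h2⟩
    let φφ : selLang.Formula ((Fin n ⊕ Fin n) ⊕ Fin m) :=
      (φ.relabel (Sum.elim Sum.inr fun j => Sum.inl (Sum.inl j))) ⊓
        (φ.relabel (Sum.elim Sum.inr fun j => Sum.inl (Sum.inr j)))
    have hφφ : ∀ (K : Type) [selLang.Structure K] (y z : Fin n → K) (x : Fin m → K),
        φφ.Realize (Sum.elim (Sum.elim y z) x) ↔
          φ.Realize (Sum.elim x y) ∧ φ.Realize (Sum.elim x z) := by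
      intro K _ y z x
      simp only [φφ, Formula.realize_inf, Formula.realize_relabel, Sum.comp_elim,
        Sum.elim_comp_inr]
      rfl
    obtain ⟨x, hx⟩ := hN.pullback hU d φφ (Sum.elim (fun j => s₀ j l) fun j => s₁ j i) (w := x) (by
      rw [Sum.comp_elim]
      exact (hφφ U _ _ _).2 ⟨h1, h2⟩)
    exact hinc i l hil ⟨x, (hφφ N _ _ x).1 hx⟩
  · intro ψ
    choose r hr using hq
    refine (htp (ψ.relabel (Sum.map id r))).mono fun i hi => ?_
    have e : ∀ y : Fin n → N, ψ.Realize (Sum.elim (fun j => d (y j)) fun x => (x : U)) ↔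
        (ψ.relabel (Sum.map id r)).Realize (Sum.elim y fun x : X => (x : N)) := by
      intro y
      rw [Formula.realize_relabel, ← hdf]
      have : (Sum.elim (fun j => d (y j)) fun x : (d '' X : Set U) => (x : U)) =
          fun a => d ((Sum.elim y (fun x : X => (x : N)) ∘ Sum.map id r) a) := by
        funext p
        rcases p with p | p
        · rfl
        · exact (congrArg Subtype.val (hr p)).symm
      rw [this]
    rw [e, e]
    exact hi

/-- In a tree of tuples, some branch point `σ⌢0ʲ⌢1` has the same type over the tree up to the level
of `σ` as an earlier one. -/
theorem EC.exists_branch (hN : EC N) {n : ℕ} (a : List Bool → Fin n → N) (σ : List Bool) :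
    ∃ k j, k < j ∧ ∀ ψ : selLang.Formula (Fin n ⊕ (List Bool × Fin n)),
      (∀ p, Sum.inr p ∈ ψ.freeVarFinset → p.1.length ≤ σ.length) →
        (ψ.Realize (Sum.elim (a (σ ++ List.replicate j false ++ [true])) fun p => a p.1 p.2) ↔
          ψ.Realize (Sum.elim (a (σ ++ List.replicate k false ++ [true])) fun p => a p.1 p.2)) := by
  have : Finite {l : List Bool | l.length ≤ σ.length} := (List.finite_length_le Bool _).to_subtype
  obtain ⟨k, j, hkj, h⟩ := hN.exists_same_type
    (ι := Fin n ⊕ ({l : List Bool | l.length ≤ σ.length} × Fin n))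
    fun i => Sum.elim (a (σ ++ List.replicate i false ++ [true])) fun p => a p.1 p.2
  refine ⟨k, j, hkj, fun ψ hψ => (h _ ψ _ _ ?_).symm⟩
  rintro (p | p) hp
  · exact ⟨Sum.inl p, rfl, rfl⟩
  · exact ⟨Sum.inr (⟨p.1, hψ p hp⟩, p.2), rfl, rfl⟩

/-- The path passes through nodes `σ` and from each of them continues with `j` zeros and a one; the
side branch has `k < j` zeros and a one. All later path nodes extend `σ` followed by `k + 1` zeros,
so they are inconsistent with the side branch, while the two continuations have the same type over
the tree up to the level of `σ`. -/
theorem EC.not_sop_tree (hN : EC N) {m n : ℕ} (φ : selLang.Formula (Fin m ⊕ Fin n))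
    (a : List Bool → Fin n → N)
    (hcons : ∀ η : ℕ → Bool, ∀ s : Finset ℕ, ∃ c : Fin m → N, ∀ k ∈ s,
      φ.Realize (Sum.elim c (a (List.ofFn fun i : Fin k => η i))))
    (hinc : ∀ ρ η : List Bool, (ρ ++ [false]) <+: η →
      ¬ ∃ c : Fin m → N, φ.Realize (Sum.elim c (a η)) ∧
        φ.Realize (Sum.elim c (a (ρ ++ [true])))) : False := by
  classical
  choose k j hkj htp using hN.exists_branch a
  let next : List Bool → List Bool := fun σ => σ ++ List.replicate (j σ) false ++ [true]
  let σ : ℕ → List Bool := fun i => next^[i] []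
  have hσ : ∀ i, σ (i + 1) = σ i ++ List.replicate (j (σ i)) false ++ [true] := fun i =>
    Function.iterate_succ_apply' next i []
  have hpre : ∀ i l, i ≤ l → σ i <+: σ l := by
    intro i l hil
    induction l, hil using Nat.le_induction with
    | base => exact List.prefix_rfl
    | succ l _ ih =>
      rw [hσ, List.append_assoc]
      exact ih.trans (List.prefix_append _ _)
  have hlen : ∀ i, i ≤ (σ i).length := by
    intro i
    induction i with
    | zero => exact Nat.zero_le _
    | succ i ih =>
      rw [hσ]
      simp only [List.length_append, List.length_singleton]
      omega
  -- The infinite branch through the nodes: `σ (t + 1)` has length greater than `t`, so the default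
  -- `false` is never used.
  let η : ℕ → Bool := fun t => (σ (t + 1)).getD t false
  have hη : ∀ i, (List.ofFn fun t : Fin (σ i).length => η t) = σ i := by
    intro i
    refine List.ext_getElem (by simp) fun t h1 h2 => ?_
    rw [List.getElem_ofFn]
    have h3 : t < (σ (t + 1)).length := hlen (t + 1)
    simp only [η, List.getD_eq_getElem _ _ h3]
    rcases le_total i (t + 1) with h | h
    · exact ((hpre _ _ h).getElem h2).symm
    · exact (hpre _ _ h).getElem h3
  let X : Set N := Set.range fun p : List Bool × Fin n => a p.1 p.2
  refine hN.not_sop_sequence φ (X := X) (s₀ := fun t i => a (σ (i + 1)) t)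
    (s₁ := fun t i => a (σ i ++ List.replicate (k (σ i)) false ++ [true]) t)
    (fun t i => ⟨(_, t), rfl⟩) (fun t i => ⟨(_, t), rfl⟩) ?_ ?_ ?_
  · intro l
    obtain ⟨c, hc⟩ := hcons η ((Finset.range l).image fun i => (σ (i + 1)).length)
    refine ⟨c, fun i hi => ?_⟩
    have := hc _ (Finset.mem_image_of_mem _ (Finset.mem_range.2 hi))
    rwa [hη] at this
  · intro i l hil
    refine hinc (σ i ++ List.replicate (k (σ i)) false) _
      (List.IsPrefix.trans ?_ (hpre (i + 1) (l + 1) (by omega)))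
    rw [hσ, List.append_assoc, List.append_assoc, ← List.replicate_succ',
      List.prefix_append_right_inj]
    refine List.IsPrefix.trans ?_ (List.prefix_append _ _)
    exact List.prefix_replicate_iff.2 ⟨by simpa using hkj (σ i), by simp⟩
  · intro ψ
    choose r hr using fun x : X => x.2
    let ψ' : selLang.Formula (Fin n ⊕ (List Bool × Fin n)) := ψ.relabel (Sum.map id r)
    have e : ∀ y : Fin n → N, ψ.Realize (Sum.elim y fun x : X => (x : N)) ↔
        ψ'.Realize (Sum.elim y fun p => a p.1 p.2) := by
      intro y
      rw [Formula.realize_relabel]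
      have : (Sum.elim y fun x : X => (x : N)) =
          Sum.elim y (fun p => a p.1 p.2) ∘ Sum.map id r := by
        funext p
        rcases p with p | p
        · rfl
        · exact (hr p).symm
      rw [this]
    -- Beyond the highest level of a parameter of `ψ` the equality of types applies, since the node
    -- of index `i` has length at least `i`.
    let L := ψ'.freeVarFinset.sup (Sum.elim (fun _ => 0) fun p => p.1.length)
    filter_upwards [Filter.eventually_ge_atTop L] with i hi
    rw [e, e]
    have h := htp (σ i) ψ' fun p hp =>
      (Finset.le_sup (f := Sum.elim (fun _ => 0) fun p : List Bool × Fin n => p.1.length) hp).trans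
        (hi.trans (hlen i))
    rw [← hσ] at h
    exact h

theorem nsop1_selTheoryStar : NSOP1 selTheoryStar := by
  rintro m n φ ⟨N, a, h1, h2⟩
  exact (ec_modelType N).not_sop_tree φ a h1 h2

end NSOP

end Shredding

namespace Shredding

/-! ### Realized types -/

/-- The type over `N` of a tuple of an elementary extension. -/
theorem exists_typeOver {L : FirstOrder.Language.{0, 0}} {N N' : Type} [L.Structure N]
    [L.Structure N'] [Nonempty N'] (f : N ↪ₑ[L] N') {m : ℕ} (c : Fin m → N') :
    ∃ p : TypeOver L N m, ∀ (r : ℕ) (φ : L.Formula (Fin m ⊕ Fin r)) (a : Fin r → N),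
      φ.Realize (Sum.elim c (f ∘ a)) → p.Contains φ a := by
  let : (constantsOn N).Structure N' := constantsOn.structure f
  have hmodel : N' ⊨ L.elementaryDiagram N := by
    rw [Theory.model_iff]
    intro φ hφ
    have hφ' : φ.Realize N := hφ
    rw [← Formula.realize_equivSentence_symm_con N φ] at hφ'
    rw [← Formula.realize_equivSentence_symm_con N' φ]
    exact (f.map_formula _ _).2 hφ'
  refine ⟨(L.elementaryDiagram N).typeOf c, fun r φ a h => ?_⟩
  refine Theory.CompleteType.formula_mem_typeOf.2 ?_
  refine BoundedFormula.realize_constantsVarsEquiv.1 ?_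
  rw [_root_.Equiv.apply_symm_apply]
  refine Formula.realize_relabel.2 ?_
  convert h using 1
  funext i
  rcases i with i | i <;> rfl

/-! ### A shredding formula -/

section Shreds

variable {N : Type} [selLang.Structure N]

/-- The formula `eval(x, y) = y`. -/
def selectsFormula : selLang.Formula (Fin 1 ⊕ Fin 1) :=
  Term.equal (Functions.apply₂ (L := selLang) SelFunctions.eval (Term.var (Sum.inl 0))
    (Term.var (Sum.inr 0))) (Term.var (Sum.inr 0))

theorem realize_selectsFormula (v : Fin 1 ⊕ Fin 1 → N) :
    selectsFormula.Realize v ↔ ev (v (Sum.inl 0)) (v (Sum.inr 0)) = v (Sum.inr 0) := by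
  rw [selectsFormula, Formula.realize_equal, realize_term_eval]
  rfl

/-- The formula `R₀(eval(x, y), y)`. -/
def detectsFormula : selLang.Formula ((Fin 1 × Fin 1) ⊕ Fin 1) :=
  Relations.formula₂ (L := selLang) SelRelations.R0
    (Functions.apply₂ (L := selLang) SelFunctions.eval (Term.var (Sum.inr 0))
      (Term.var (Sum.inl 0))) (Term.var (Sum.inl 0))

theorem realize_detectsFormula (v : (Fin 1 × Fin 1) ⊕ Fin 1 → N) :
    detectsFormula.Realize v ↔ Rel0 (ev (v (Sum.inr 0)) (v (Sum.inl 0))) (v (Sum.inl 0)) := by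
  rw [detectsFormula, realize_formula_R0, realize_term_eval]
  rfl

/-- Points of `O₁` of one class which are unrelated to `S` can be exchanged over `S`. -/
theorem IsSel.piso_of_avoids (hN : IsSel N) (S : selLang.Substructure N) {u : N} {ι : Type}
    {b b' : ι → N} (hb : ∀ i, IsO1 (b i)) (hb' : ∀ i, IsO1 (b' i)) (hu : ∀ i, RelE u (b i))
    (hu' : ∀ i, RelE u (b' i)) (hi : Function.Injective b) (hi' : Function.Injective b')
    (ha : ∀ i, Avoids (S : Set N) (b i)) (ha' : ∀ i, Avoids (S : Set N) (b' i)) :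
    PIso fun x y => (x = y ∧ (x ∈ S ∨ ∃ h ∈ S, IsF h ∧ IsO u ∧ x = ev h u)) ∨
      ∃ i, b i = x ∧ b' i = y := by
  have nF : ∀ {x : N}, IsO1 x → ¬ IsF x := fun h h' => hN.not_F_O1 _ h' h
  have nO0 : ∀ {x : N}, IsO1 x → ¬ IsO0 x := fun h h' => hN.not_O0_O1 _ h' h
  have isO : ∀ {x : N}, IsO1 x → IsO x := fun h => (hN.O_iff _).2 (Or.inr h)
  have ne : ∀ {b x : N}, IsO1 b → Avoids (S : Set N) b →
      (x ∈ S ∨ ∃ h ∈ S, IsF h ∧ IsO u ∧ x = ev h u) → x ≠ b := by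
    rintro b x hb ha (hx | ⟨h, hh, hF, hO, rfl⟩) rfl
    · exact (ha _ hx).1 (hN.E_refl _ (isO hb))
    · exact nO0 hb (hN.ev_O0 _ _ hF hO)
  have nR : ∀ {b x : N}, IsO1 b → Avoids (S : Set N) b → RelE u b →
      (x ∈ S ∨ ∃ h ∈ S, IsF h ∧ IsO u ∧ x = ev h u) → ¬ Rel0 x b := by
    rintro b x hb ha hu (hx | ⟨h, hh, hF, hO, rfl⟩)
    · exact (ha _ hx).2.1
    -- The value of `h` at `u` is its value at `b`, so its `R₀` relation to `b` is `R₁` between `h`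
    -- and `b`. Avoiding `R₁` therefore hides from `S` how `u` is related to the sequence.
    · rw [hN.ev_congr _ _ _ hF hu, hN.R0_iff_R1 _ _ hF hb]
      exact (ha _ hh).2.2
  have nR' : ∀ {b x : N}, IsO1 b → ¬ Rel0 b x := fun h h' => nO0 h (hN.R0_sort _ _ h').1
  have hE : ∀ {b x : N}, RelE u b → (RelE x b ↔ RelE x u) := fun h =>
    ⟨fun h' => hN.E_trans _ _ _ h' (hN.E_symm _ _ h), fun h' => hN.E_trans _ _ _ h' h⟩
  have hE' : ∀ {b x : N}, RelE u b → (RelE b x ↔ RelE u x) := fun h =>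
    ⟨fun h' => hN.E_trans _ _ _ h h', fun h' => hN.E_trans _ _ _ (hN.E_symm _ _ h) h'⟩
  exact
    { F := by
        rintro _ _ (⟨rfl, -⟩ | ⟨i, rfl, rfl⟩)
        exacts [Iff.rfl, iff_of_false (nF (hb i)) (nF (hb' i))]
      O0 := by
        rintro _ _ (⟨rfl, -⟩ | ⟨i, rfl, rfl⟩)
        exacts [Iff.rfl, iff_of_false (nO0 (hb i)) (nO0 (hb' i))]
      O1 := by
        rintro _ _ (⟨rfl, -⟩ | ⟨i, rfl, rfl⟩)
        exacts [Iff.rfl, iff_of_true (hb i) (hb' i)]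
      eq := by
        rintro x _ y _ (⟨rfl, hx⟩ | ⟨i, rfl, rfl⟩) (⟨rfl, hy⟩ | ⟨j, rfl, rfl⟩)
        · rfl
        · exact iff_of_false (ne (hb j) (ha j) hx) (ne (hb' j) (ha' j) hx)
        · exact iff_of_false (ne (hb i) (ha i) hy).symm (ne (hb' i) (ha' i) hy).symm
        · rw [hi.eq_iff, hi'.eq_iff]
      E := by
        rintro x _ y _ (⟨rfl, hx⟩ | ⟨i, rfl, rfl⟩) (⟨rfl, hy⟩ | ⟨j, rfl, rfl⟩)
        · rfl
        · rw [hE (hu j), hE (hu' j)]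
        · rw [hE' (hu i), hE' (hu' i)]
        · rw [hE' (hu i), hE' (hu' i)]
          exact iff_of_true (hu j) (hu' j)
      R0 := by
        rintro x _ y _ (⟨rfl, hx⟩ | ⟨i, rfl, rfl⟩) (⟨rfl, hy⟩ | ⟨j, rfl, rfl⟩)
        · rfl
        · exact iff_of_false (nR (hb j) (ha j) (hu j) hx) (nR (hb' j) (ha' j) (hu' j) hx)
        · exact iff_of_false (nR' (hb i)) (nR' (hb' i))
        · exact iff_of_false (nR' (hb i)) (nR' (hb' i))
      ev := by
        rintro x _ y y' (⟨rfl, hx⟩ | ⟨i, rfl, rfl⟩) hy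
        · rcases hx with hx | ⟨h, hh, hF, hO, rfl⟩
          · by_cases hxF : IsF x
            swap
            · rw [hN.ev_triv _ _ fun h => hxF h.1, hN.ev_triv _ _ fun h => hxF h.1]
              exact Or.inl ⟨rfl, Or.inl hx⟩
            rcases hy with ⟨rfl, hy | ⟨h, hh, hF, hO, rfl⟩⟩ | ⟨j, rfl, rfl⟩
            · exact Or.inl ⟨rfl, Or.inl (ev_mem S hx hy)⟩
            · exact Or.inl ⟨rfl, Or.inr ⟨x, hx, hxF, hO,
                (hN.ev_congr _ _ _ hxF (hN.E_ev _ _ hF hO)).symm⟩⟩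
            · rw [← hN.ev_congr _ _ _ hxF (hu j), ← hN.ev_congr _ _ _ hxF (hu' j)]
              exact Or.inl ⟨rfl, Or.inr ⟨x, hx, hxF, (hN.E_O _ _ (hu j)).1, rfl⟩⟩
          · have : ∀ z, ev (ev h u) z = ev h u := fun z =>
              hN.ev_triv _ _ fun h' => hN.not_F_O0 _ h'.1 (hN.ev_O0 _ _ hF hO)
            rw [this, this]
            exact Or.inl ⟨rfl, Or.inr ⟨h, hh, hF, hO, rfl⟩⟩
        · rw [hN.ev_triv _ _ fun h => nF (hb i) h.1, hN.ev_triv _ _ fun h => nF (hb' i) h.1]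
          exact Or.inr ⟨i, rfl, rfl⟩ }

/-- Division with remainder by `2` gives remainder `0` or `1`, and adding one at the right end
changes the parity, also past limits. -/
theorem two_dvd_add_one (α : Ordinal.{0}) : ¬ (2 ∣ α ↔ 2 ∣ α + 1) := by
  intro h
  have h2 : (2 : Ordinal.{0}) ≠ 0 := two_ne_zero
  by_cases h' : 2 ∣ α
  · have h1 : (2 : Ordinal.{0}) ∣ 1 := (Ordinal.dvd_add_iff h').1 (h.1 h')
    exact absurd (Ordinal.le_of_dvd one_ne_zero h1) (not_le.2 one_lt_two)
  · have h1 : α % 2 = 1 := by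
      have h3 : α % 2 < 1 + 1 := by
        rw [one_add_one_eq_two]
        exact Ordinal.mod_lt α h2
      refine le_antisymm (Order.lt_add_one_iff.1 h3) ?_
      rw [Order.one_le_iff_ne_zero]
      exact fun h0 => h' (Ordinal.dvd_of_mod_eq_zero h0)
    refine h' (h.2 ?_)
    rw [← Ordinal.div_add_mod α 2, h1, add_assoc, one_add_one_eq_two]
    exact (Ordinal.dvd_add_iff (dvd_mul_right _ _)).2 dvd_rfl

/-- Points of one class unrelated to `S` can be exchanged over `S`, which gives indiscernibility. A
solution `c` of `eval(x, u) = u` turns `R₀(eval(c, y), y)` into `R₀(u, y)`, whose truth value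
alternates along the sequence, so every end segment is divided. -/
theorem EC.witnessesShredding (hN : EC N) (S : selLang.Substructure N) {lam : Cardinal.{0}}
    (hlam : ℵ₀ ≤ lam) {u : N} {b : Ordinal.{0} → N} (hb : ∀ α < lam.ord, IsO1 (b α))
    (hu : ∀ α < lam.ord, RelE u (b α)) (hi : Set.InjOn b (Set.Iio lam.ord))
    (ha : ∀ α < lam.ord, Avoids (S : Set N) (b α)) (hR : ∀ α < lam.ord, Rel0 u (b α) ↔ 2 ∣ α) :
    WitnessesShredding lam selectsFormula (fun _ => u) (S : Set N) fun α (_ : Fin 1) => b α := by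
  constructor
  · intro k r ψ d hd f g hf hg hf' hg'
    refine hN.realize_iff hN (hN.isSel.piso_of_avoids S (u := u) (b := fun i : Fin k => b (f i))
      (b' := fun i => b (g i)) (fun i => hb _ (hf' i)) (fun i => hb _ (hg' i))
      (fun i => hu _ (hf' i)) (fun i => hu _ (hg' i))
      (fun i j h => hf.injective (hi (hf' i) (hf' j) h))
      (fun i j h => hg.injective (hi (hg' i) (hg' j) h))
      (fun i => ha _ (hf' i)) (fun i => ha _ (hg' i))) ψ _ _ ?_
    rintro (i | i)
    · exact Or.inr ⟨i.1, rfl, rfl⟩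
    · exact Or.inl ⟨rfl, Or.inl (hd i)⟩
  · intro N' _ e c hc α hα hind
    have hN' : EC N' := hN.of_completeTheory fun φ hφ => (e.map_sentence φ).1 hφ
    rw [realize_selectsFormula] at hc
    have hc' : ev (c 0) (e u) = e u := hc
    have hα' : α + 1 < lam.ord := by
      rw [← Order.succ_eq_add_one]
      exact (Cardinal.isSuccLimit_ord hlam).succ_lt hα
    have key := hind 1 1 detectsFormula c (fun i => Or.inr ⟨i, rfl⟩) (fun _ => α) (fun _ => α + 1)
      (Subsingleton.strictMono _) (Subsingleton.strictMono _) (fun _ => ⟨le_rfl, hα⟩)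
      (fun _ => ⟨le_self_add, hα'⟩)
    rw [realize_detectsFormula, realize_detectsFormula] at key
    have hev : ∀ β < lam.ord, ev (c 0) (e (b β)) = e u := by
      intro β hβ
      -- If `c` is not a function, the convention for `eval` makes it equal to `u` and all its
      -- values are `u` as well.
      by_cases hF : IsF (c 0)
      · rw [← hc', ← hN'.isSel.ev_congr _ (e u) (e (b β)) hF
          ((emb_E e.toEmbedding _ _).2 (hu β hβ)), hc']
      · have : ∀ z, ev (c 0) z = c 0 := fun z => hN'.isSel.ev_triv _ _ fun h => hF h.1
        rw [this, ← hc', this]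
    have hdet : ∀ β < lam.ord, Rel0 (ev (c 0) (e (b β))) (e (b β)) ↔ 2 ∣ β := by
      intro β hβ
      rw [hev β hβ, ← hR β hβ]
      exact emb_R0 e.toEmbedding _ _
    exact two_dvd_add_one α ((hdet α hα).symm.trans (key.trans (hdet _ hα')))

end Shreds

end Shredding

namespace Shredding

/-! ### Long shredding chains -/

section Array

variable {Ω : Type} (rk : Ω → Ordinal.{0})

/-- A function `none`, and for each `x : Ω` a class consisting of its selected element
`some (x, none)` and a sequence of elements `some (x, some y)` of `O₁`, every other one of which
is related to the selected element. -/
def arrayRaw : SelRaw (Option (Ω × Option Ω)) where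
  F y := y = none
  O0 y := ∃ x, y = some (x, none)
  O1 y := ∃ x z, y = some (x, some z)
  E y y' := ∃ x z z', y = some (x, z) ∧ y' = some (x, z')
  R0 y y' := ∃ x z, y = some (x, none) ∧ y' = some (x, some z) ∧ 2 ∣ rk z
  ev y y' := match y with
    | none => y'.map fun p => (p.1, none)
    | some p => some p

theorem arrayRaw_O {y : Option (Ω × Option Ω)} :
    (arrayRaw rk).O0 y ∨ (arrayRaw rk).O1 y ↔ ∃ p, y = some p := by
  constructor
  · rintro (⟨x, rfl⟩ | ⟨x, z, rfl⟩)
    exacts [⟨_, rfl⟩, ⟨_, rfl⟩]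
  · rintro ⟨⟨x, _ | z⟩, rfl⟩
    exacts [Or.inl ⟨x, rfl⟩, Or.inr ⟨x, z, rfl⟩]

theorem arrayRaw_valid : (arrayRaw rk).Valid where
  cover y := by
    rw [arrayRaw_O]
    rcases y with _ | p
    exacts [Or.inl rfl, Or.inr ⟨p, rfl⟩]
  not_F_O0 := by rintro _ rfl ⟨x, h⟩; cases h
  not_F_O1 := by rintro _ rfl ⟨x, z, h⟩; cases h
  not_O0_O1 := by rintro _ ⟨x, rfl⟩ ⟨x', z, h⟩; cases h
  E_O := by
    rintro _ _ ⟨x, z, z', rfl, rfl⟩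
    exact (arrayRaw_O rk).2 ⟨_, rfl⟩
  E_refl y hy := by
    obtain ⟨p, rfl⟩ := (arrayRaw_O rk).1 hy
    exact ⟨p.1, p.2, p.2, rfl, rfl⟩
  E_symm := by
    rintro _ _ ⟨x, z, z', rfl, rfl⟩
    exact ⟨x, z', z, rfl, rfl⟩
  E_trans := by
    rintro _ _ _ ⟨x, z, z', rfl, rfl⟩ ⟨x', w, w', h, rfl⟩
    obtain ⟨rfl, rfl⟩ := Prod.mk.inj (Option.some.inj h)
    exact ⟨x, z, w', rfl, rfl⟩
  ev_O0 := by
    rintro _ y rfl hy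
    obtain ⟨p, rfl⟩ := (arrayRaw_O rk).1 hy
    exact ⟨p.1, rfl⟩
  E_ev := by
    rintro _ y rfl hy
    obtain ⟨p, rfl⟩ := (arrayRaw_O rk).1 hy
    exact ⟨p.1, p.2, none, rfl, rfl⟩
  ev_congr := by
    rintro _ _ _ rfl ⟨x, z, z', rfl, rfl⟩
    rfl
  R0_sort := by
    rintro _ _ ⟨x, z, rfl, rfl, -⟩
    exact ⟨⟨x, rfl⟩, ⟨x, z, rfl⟩⟩
  ev_triv y y' h := by
    rcases y with _ | p
    · rcases y' with _ | q
      · rfl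
      · exact (h ⟨rfl, (arrayRaw_O rk).2 ⟨q, rfl⟩⟩).elim
    · rfl

/-- The part of the array below `i`. -/
def arrayPart (i : Ordinal.{0}) : Set (Option (Ω × Option Ω)) :=
  {y | ∃ p, y = some p ∧ rk p.1 < i ∧ ∀ z ∈ p.2, rk z < Ordinal.omega (rk p.1 + 1)}

/-- First coordinates have rank below `i`, and second coordinates, when present, have rank below
`ω_{j+1} ≤ ω_i` for some `j < i`. -/
theorem mk_arrayPart_le (hrk : Function.Injective rk) (i : Ordinal.{0}) :
    #(arrayPart rk i) ≤ ℵ_ i := by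
  have hmk : ∀ o : Ordinal.{0}, #{x : Ω // rk x < o} ≤ o.card := by
    intro o
    rw [← Cardinal.mk_toType]
    refine Cardinal.mk_le_of_injective
      (f := fun x => Ordinal.ToType.mk (⟨rk x.1, x.2⟩ : Set.Iio o)) fun x y h => ?_
    exact Subtype.ext (hrk (congrArg Subtype.val (Ordinal.ToType.mk.injective h)))
  have hω : ∀ o : Ordinal.{0}, (Ordinal.omega o).card = ℵ_ o := fun o => by
    rw [← Cardinal.ord_aleph, Cardinal.card_ord]
  have hle : ∀ p : Ω × Option Ω, rk p.1 < i → ∀ z, rk z < Ordinal.omega (rk p.1 + 1) →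
      rk z < Ordinal.omega i := fun p hp z hz => hz.trans_le
    (Ordinal.omega_le_omega.2 (Order.add_one_le_of_lt hp))
  let A := {x : Ω // rk x < i}
  let B := {x : Ω // rk x < Ordinal.omega i}
  let f : A × Option B → Option (Ω × Option Ω) := fun q => some (q.1.1, q.2.map Subtype.val)
  have hsub : arrayPart rk i ⊆ Set.range f := by
    rintro _ ⟨⟨x, z⟩, rfl, hx, hz⟩
    rcases z with _ | z
    · exact ⟨(⟨x, hx⟩, none), rfl⟩
    · exact ⟨(⟨x, hx⟩, some ⟨z, hle (x, some z) hx z (hz z rfl)⟩), rfl⟩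
  have hA : #A ≤ ℵ_ i := (hmk i).trans
    ((Ordinal.card_le_card (Ordinal.le_omega_self i)).trans_eq (hω i))
  have hB : #B ≤ ℵ_ i := (hmk _).trans_eq (hω i)
  have hinf := Cardinal.aleph0_le_aleph i
  calc #(arrayPart rk i) ≤ #(Set.range f) := Cardinal.mk_le_mk_of_subset hsub
    _ ≤ #(A × Option B) := Cardinal.mk_range_le
    _ = #A * (#B + 1) := by rw [Cardinal.mk_prod, Cardinal.mk_option]; simp
    _ ≤ ℵ_ i * ℵ_ i := mul_le_mul' hA
      (Cardinal.add_le_of_le hinf hB (Cardinal.one_le_aleph0.trans hinf))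
    _ = ℵ_ i := Cardinal.mul_eq_self hinf

end Array

theorem card_selLang_le : selLang.card ≤ ℵ₀ := by
  have : Countable (Σ l, selLang.Relations l) := by
    let f : (Σ l, selLang.Relations l) → ℕ := fun R => match R with
      | ⟨_, SelRelations.F⟩ => 0
      | ⟨_, SelRelations.O0⟩ => 1
      | ⟨_, SelRelations.O1⟩ => 2
      | ⟨_, SelRelations.O⟩ => 3
      | ⟨_, SelRelations.E⟩ => 4
      | ⟨_, SelRelations.R0⟩ => 5
      | ⟨_, SelRelations.R1⟩ => 6
    refine Function.Injective.countable (f := f) ?_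
    rintro ⟨_, R⟩ ⟨_, R'⟩ h
    cases R <;> cases R' <;> first | rfl | (simp [f] at h)
  have : Countable selLang.Symbols := inferInstanceAs (Countable (_ ⊕ _))
  exact Cardinal.mk_le_aleph0_iff.2 this

theorem EC.isElementary_range {A N : Type} [selLang.Structure A] [selLang.Structure N] (hA : EC A)
    (hN : EC N) (f : A ↪[selLang] N) : f.toHom.range.IsElementary :=
  have hS : EC f.toHom.range := hA.of_completeTheory fun φ hφ =>
    (StrongHomClass.realize_sentence f.equivRange φ).1 hφ
  fun _ φ x => (hS.elementary hN (Substructure.subtype _)).map_formula φ x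

/-- The models of the chain are the completions of the parts of the array, and the type is that of
the function `none`. At step `i` the class of rank `i` appears: its selected point gives the
shredding formula, and its sequence has no relation with the model below. -/
theorem hasShreddingChain (κ : Cardinal.{0}) (hκ : ℵ₀ ≤ κ) :
    HasShreddingChain selTheoryStar 1 κ := by
  classical
  -- Large enough to index the `κ` classes and, for each `i` below `κ`, a sequence of length
  -- `ω_{i+1}`.
  let o : Ordinal.{0} := Ordinal.omega κ.ord
  let Ω : Type := o.ToType
  let rk : Ω → Ordinal.{0} := fun x => (Ordinal.ToType.toOrd x : Set.Iio o)
  have hrk : Function.Injective rk := fun x y h =>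
    Ordinal.ToType.mk.symm.injective (Subtype.ext h)
  have hlim := Cardinal.isSuccLimit_ord hκ
  have hex : ∀ α < o, ∃ x, rk x = α := fun α hα =>
    ⟨Ordinal.ToType.mk (⟨α, hα⟩ : Set.Iio o),
      congrArg Subtype.val (Ordinal.ToType.mk.symm_apply_apply (⟨α, hα⟩ : Set.Iio o))⟩
  have hκo : κ.ord ≤ o := Ordinal.le_omega_self _
  have hωo : ∀ i < κ.ord, Ordinal.omega (i + 1) ≤ o := fun i hi =>
    Ordinal.omega_le_omega.2 (Order.add_one_le_of_lt hi)
  let Y := Option (Ω × Option Ω)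
  let : selLang.Structure Y := (arrayRaw rk).toStructure
  have hY : IsSel Y := (arrayRaw_valid rk).isSel
  -- The parts omit `none`, the only function of the array, so `eval` is trivial on them. The
  -- minimum makes the family constant from `κ` on.
  let Z : Ordinal.{0} → selLang.Substructure Y := fun i =>
    selSub (arrayPart rk (min i κ.ord)) (by
      rintro _ ⟨p, rfl, hp⟩ y _
      exact ⟨p, rfl, hp⟩)
  have hZmono : Monotone Z := by
    rintro i j hij _ ⟨p, rfl, hp, h⟩
    exact ⟨p, rfl, hp.trans_le (min_le_min_right _ hij), h⟩
  have hZle : ∀ i, Z i ≤ Z κ.ord := by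
    rintro i _ ⟨p, rfl, hp, h⟩
    exact ⟨p, rfl, hp.trans_le (by rw [min_self]; exact min_le_right _ _), h⟩
  obtain ⟨G, _, e, H, hEC, hHmono, hHmem, hHcont, hHav, hHcard⟩ := exists_completion Y hY
  let N : Type := H (Z κ.ord)
  have hN : EC N := hEC _
  have hT : EC (H ⊤) := hEC _
  have : Nonempty (H ⊤) := hT.nonempty
  let f : ∀ i, H (Z i) ↪[selLang] N := fun i => Substructure.inclusion (hHmono (hZle i))
  let M : Ordinal.{0} → selLang.ElementarySubstructure N := fun i => 
    ⟨(f i).toHom.range, (hEC _).isElementary_range hN (f i)⟩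
  have hM : ∀ i (d : N), d ∈ (M i : Set N) ↔ d.1 ∈ H (Z i) := by
    intro i d
    constructor
    · rintro ⟨d', rfl⟩
      exact d'.2
    · intro hd
      exact ⟨⟨d.1, hd⟩, rfl⟩
  -- The function realizing the type; it lies in the completion of the whole array but not in `N`.
  let star : H ⊤ := ⟨e none, (hHmem _ _).2 trivial⟩
  let g : N ↪ₑ[selLang] H ⊤ := hN.elementary hT (Substructure.inclusion (hHmono le_top))
  obtain ⟨p, hp⟩ := exists_typeOver g fun _ : Fin 1 => star
  refine ⟨hN.toModelType, M, p, ?_, ?_, ?_, ?_⟩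
  · exact Set.eq_univ_of_forall fun d => (hM _ d).2 d.2
  · exact fun i j hij _ d hd => (hM j d).2 (hHmono (hZmono hij) ((hM i d).1 hd))
  · intro δ hδ hδlim
    refine Set.Subset.antisymm (fun d hd => ?_) (Set.iUnion₂_subset fun i hi d hd =>
      (hM δ d).2 (hHmono (hZmono (le_of_lt hi)) ((hM i d).1 hd)))
    have : Nonempty (Set.Iio δ) := ⟨⟨0, hδlim.bot_lt⟩⟩
    obtain ⟨i, hi⟩ := hHcont (Set.Iio δ) (fun i => Z i) (fun i j hij => hZmono hij) (Z δ) (by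
      rintro _ ⟨q, rfl, hq, h⟩
      have hq' : rk q.1 < δ := hq.trans_le (min_le_left _ _)
      refine ⟨⟨rk q.1 + 1, ?_⟩, q, rfl, lt_min ?_ (hq.trans_le (min_le_right _ _)), h⟩
      · rw [← Order.succ_eq_add_one]
        exact hδlim.succ_lt hq'
      · exact Order.lt_add_one_iff.2 le_rfl) d.1 ((hM δ d).1 hd)
    exact Set.mem_iUnion₂.2 ⟨i, i.2, (hM i d).2 hi⟩
  · intro i hi
    have hi1 : i + 1 < κ.ord := by
      rw [← Order.succ_eq_add_one]
      exact hlim.succ_lt hi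
    have hlt : i < i + 1 := Order.lt_add_one_iff.2 le_rfl
    obtain ⟨x, hx⟩ := hex i (hi.trans_le hκo)
    have : Nonempty Ω := ⟨x⟩
    choose! el hel using hex
    set lam : Cardinal.{0} := Order.succ (selLang.card + ℵ₀ + #(M i : Set N)) with hlamdef
    have hlam : ℵ₀ ≤ lam := (self_le_add_left _ _).trans
      (((self_le_add_right _ _)).trans (Order.le_succ _))
    -- The model at `i` has size at most `ℵ_i`, so a sequence of the required length fits into the
    -- part at `i + 1`.
    have hlamle : lam.ord ≤ Ordinal.omega (i + 1) := by
      rw [← Cardinal.ord_aleph, Cardinal.ord_le_ord, ← Cardinal.succ_aleph]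
      refine Order.succ_le_succ ?_
      have hinf := Cardinal.aleph0_le_aleph i
      have hZi : #(Z i) ≤ ℵ_ i := by
        have := mk_arrayPart_le rk hrk (min i κ.ord)
        rw [min_eq_left hi.le] at this
        refine le_trans (le_of_eq ?_) this
        change #(arrayPart rk (min i κ.ord)) = _
        rw [min_eq_left hi.le]
      exact Cardinal.add_le_of_le hinf
        (Cardinal.add_le_of_le hinf (card_selLang_le.trans hinf) hinf)
        (Cardinal.mk_range_le.trans (hHcard _ _ hinf hZi))
    have hmemu : (some (x, none) : Y) ∈ Z (i + 1) :=
      ⟨_, rfl, by rw [min_eq_left hi1.le]; exact hx.trans_lt hlt, by rintro z ⟨⟩⟩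
    have hmemb : ∀ α < lam.ord, (some (x, some (el α)) : Y) ∈ Z (i + 1) := by
      intro α hα
      refine ⟨_, rfl, by rw [min_eq_left hi1.le]; exact hx.trans_lt hlt, ?_⟩
      rintro z ⟨⟩
      have h1 := hα.trans_le hlamle
      change rk (el α) < Ordinal.omega (rk x + 1)
      rw [hel α (h1.trans_le (hωo i hi)), hx]
      exact h1
    have hrkel : ∀ α < lam.ord, rk (el α) = α := fun α hα =>
      hel α ((hα.trans_le hlamle).trans_le (hωo i hi))
    let u : N := ⟨e (some (x, none)), (hHmem _ _).2 (hZle _ hmemu)⟩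
    -- The value `u` beyond `lam` is a filler.
    let b : Ordinal.{0} → N := fun α =>
      if h : α < lam.ord then ⟨e (some (x, some (el α))), (hHmem _ _).2 (hZle _ (hmemb α h))⟩
      else u
    have hb : ∀ α (h : α < lam.ord), b α =
        ⟨e (some (x, some (el α))), (hHmem _ _).2 (hZle _ (hmemb α h))⟩ := fun α h => dif_pos h
    let ι : N ↪[selLang] G := (H (Z κ.ord)).subtype
    have hιb : ∀ α < lam.ord, ι (b α) = e (some (x, some (el α))) := fun α h => by
      rw [hb α h]; rfl
    have hιu : ι u = e (some (x, none)) := rfl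
    have hO1 : ∀ z, IsO1 (some (x, some z) : Y) := fun z => ⟨x, z, rfl⟩
    refine ⟨fun d hd => (hM _ d).2 (hHmono (hZmono hlt.le) ((hM _ d).1 hd)), 1, selectsFormula,
      fun _ => u, fun _ => (hM _ u).2 ((hHmem _ _).2 hmemu), ?_, 1, fun α _ => b α, ?_, ?_⟩
    · refine hp _ _ _ ((realize_selectsFormula _).2 ?_)
      refine Subtype.ext ?_
      change (H ⊤).subtype (ev star (g u)) = (H ⊤).subtype (g u)
      rw [emb_ev]
      change ev (e none) (e (some (x, none))) = e (some (x, none))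
      rw [← emb_ev]
      rfl
    · intro α hα _
      refine (hM _ _).2 ?_
      change ι (b α) ∈ _
      rw [hιb α hα]
      exact (hHmem _ _).2 (hmemb α hα)
    · refine hN.witnessesShredding (M i).toSubstructure hlam ?_ ?_ ?_ ?_ ?_
      · intro α hα
        rw [← emb_O1 ι, hιb α hα, emb_O1]
        exact hO1 _
      · intro α hα
        rw [← emb_E ι, hιb α hα, hιu, emb_E]
        exact ⟨x, none, some (el α), rfl, rfl⟩
      · intro α hα β hβ h
        have h' := congrArg ι h
        rw [hιb α hα, hιb β hβ] at h'
        have h2 : el α = el β :=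
          Option.some.inj (Prod.mk.inj (Option.some.inj (e.injective h'))).2
        rw [← hrkel α hα, ← hrkel β hβ, h2]
      · intro α hα d hd
        have hav := hHav (Z i) (some (x, some (el α))) (hO1 _) (by
          -- The class of `x` has rank `i`, while the part at `i` has only classes of smaller rank.
          rintro _ ⟨q, rfl, hq, -⟩
          have hne : q.1 ≠ x := by
            rintro rfl
            rw [min_eq_left hi.le, hx] at hq
            exact lt_irrefl _ hq
          refine ⟨?_, ?_, ?_⟩
          · rintro ⟨x', z, z', h1, h2⟩
            exact hne ((congrArg Prod.fst (Option.some.inj h1)).trans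
              (congrArg Prod.fst (Option.some.inj h2)).symm)
          · rintro ⟨x', z, h1, h2, -⟩
            exact hne ((congrArg Prod.fst (Option.some.inj h1)).trans
              (congrArg Prod.fst (Option.some.inj h2)).symm)
          · rintro ⟨h, -⟩
            exact Option.some_ne_none _ h) d.1 ((hM i d).1 hd)
        rw [← hιb α hα] at hav
        exact ⟨fun h => hav.1 ((emb_E ι _ _).2 h), fun h => hav.2.1 ((emb_R0 ι _ _).2 h),
          fun h => hav.2.2 ((emb_R1 ι _ _).2 h)⟩
      · intro α hα
        rw [← emb_R0 ι, hιb α hα, hιu, emb_R0]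
        constructor
        · rintro ⟨x', z, -, h, h'⟩
          have : el α = z := Option.some.inj (Prod.mk.inj (Option.some.inj h)).2
          rwa [← this, hrkel α hα] at h'
        · intro h
          exact ⟨x, el α, rfl, rfl, by rwa [hrkel α hα]⟩

/-- One variable is enough: no regular cardinal lacks a chain, so the infimum is over the empty set.
-/
theorem kappaShred_selTheoryStar : kappaShred selTheoryStar = ⊤ := by
  refine top_unique (le_trans (le_of_eq ?_) (le_iSup _ 1))
  rw [kappaShredAt]
  have : {c | ∃ κ : Cardinal.{0}, κ.IsRegular ∧ ¬ HasShreddingChain selTheoryStar 1 κ ∧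
      c = (κ : WithTop Cardinal)} = ∅ := by
    ext c
    simp only [Set.mem_empty_iff_false, iff_false]
    rintro ⟨κ, hκ, h, -⟩
    exact h (hasShreddingChain κ hκ.aleph0_le)
  rw [this, sInf_empty]

end Shredding
theorem mainTheorem8 :
    -- `𝕂` is a Fraïssé class, it has a Fraïssé limit, and `T*` is the complete theory of the limit
    (IsFraisse selClass ∧
      ∃ (M : Type) (_ : selLang.Structure M) (_ : Countable M),
        IsFraisseLimit selClass M ∧ selTheoryStar = selLang.completeTheory M) ∧
    selTheoryStar.IsComplete ∧
    -- `T*` is `ℵ₀`-categorical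
    Cardinal.Categorical (ℵ₀ : Cardinal.{0}) selTheoryStar ∧
    -- the independence theorem over models for `⫝*`
    (∀ (N : Theory.ModelType.{0, 0, 0} selTheoryStar) (M : selLang.ElementarySubstructure N)
      (α : Type) (a a' : α → N) (B C : Set N),
      SameTypeOver selLang (M : Set N) a a' →
      IndStar (Set.range a) (M : Set N) B →
      IndStar (Set.range a') (M : Set N) C →
      IndStar B (M : Set N) C →
      ∃ (N' : Theory.ModelType.{0, 0, 0} selTheoryStar) (e : N ↪ₑ[selLang] N') (a'' : α → N'),
        SameTypeOver selLang (e '' ((M : Set N) ∪ B)) a'' (e ∘ a) ∧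
        SameTypeOver selLang (e '' ((M : Set N) ∪ C)) a'' (e ∘ a') ∧
        IndStar (Set.range a'') (e '' (M : Set N)) (e '' (B ∪ C))) ∧
    -- `T*` is `NSOP₁`
    NSOP1 selTheoryStar ∧
    -- `κ_shred(T*) = ∞`
    kappaShred selTheoryStar = ⊤ ∧
    -- hence `NSOP₁` does not imply unshreddability
    ¬ ∀ (L : FirstOrder.Language.{0, 0}) (T : L.Theory), T.IsComplete → NSOP1 T → Unshreddable T := by
  refine ⟨?_, isComplete_selTheoryStar, categorical_selTheoryStar, ?_, nsop1_selTheoryStar,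
    kappaShred_selTheoryStar, fun h => ?_⟩
  · obtain ⟨M, _, _, hM⟩ := exists_countable_ec
    exact ⟨hM.isFraisseLimit.isFraisse, M, inferInstance, inferInstance, hM.isFraisseLimit,
      selTheoryStar_eq hM⟩
  · intro N M α a a' B C haa' haB haC hBC
    have hN := ec_modelType N
    have hM : (M : Set N).Nonempty := Set.nonempty_coe_sort.1 (inferInstanceAs (Nonempty M))
    obtain ⟨N', _, hN', e, a'', h⟩ := hN.independence_theorem M hM haa' haB haC hBC
    exact ⟨hN'.toModelType, e, a'', h⟩
  · exact (h selLang selTheoryStar isComplete_selTheoryStar nsop1_selTheoryStar).ne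
      kappaShred_selTheoryStar
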